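/- Consider propositional formulas built from countably many variables $p_0,p_1,\dots$ and the constants $\top,\bot$ by means of $\wedge,\vee,\lnot$. An *introduction--elimination logic* is a binary relation $\vdash$ on formulas such that, for all formulas $\varphi,\psi,\chi$: $\varphi\vdash\varphi$; $\bot\vdash\varphi$; $\varphi\vdash\top$; $\varphi\wedge\psi\vdash\varphi$; $\varphi\wedge\psi\vdash\psi$; $\varphi\vdash\varphi\vee\psi$; $\psi\vdash\varphi\vee\psi$; $\varphi\vdash\lnot\lnot\varphi$; $\varphi\wedge\lnot\varphi\vdash\bot$; if $\varphi\vdash\psi$ and $\psi\vdash\chi$ then $\varphi\vdash\chi$; if $\varphi\vdash\psi$ and $\varphi\vdash\chi$ then $\varphi\vdash\psi\wedge\chi$; if $\varphi\vdash\chi$ and $\psi\vdash\chi$ then $\varphi\vee\psi\vdash\chi$; if $\varphi\vdash\psi$ then $\lnot\psi\vdash\lnot\varphi$. *Ex-logic* is the smallest introduction--elimination logic that contains all substitution instances of the axiom $$\textup{(Ex)}\qquad \lnot\big[a\wedge((b\wedge c)\vee(b\wedge d))\big]\wedge a\wedge(c\vee e)\wedge\lnot\lnot f\ \vdash\ \lnot\lnot(a\wedge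 f)\wedge\big[(a\wedge c)\vee(a\wedge e)\vee f\big]\wedge\big[(b\wedge(c\vee d))\vee\lnot(b\wedge(c\vee d))\big].$$ A *fundamental lattice* is a bounded lattice $(L,\wedge,\vee,0,1)$ with a unary operation $\lnot$ such that $a\le b$ implies $\lnot b\le\lnot a$, $a\wedge\lnot a=0$, and $a\le\lnot\lnot a$ for all $a,b\in L$. An entailment $\varphi\vdash\psi$ is *valid in $L$* if $v(\varphi)\le v(\psi)$ for every valuation $v$ of the variables in $L$ (extended to all formulas in the natural way), and an *Ex-lattice* is a fundamental lattice in which (Ex) is valid. Entailments are written as words over a fixed finite alphabet, with formulas in prefix notation and the indices of variables in binary. **Corollary.** The validity problem for Ex-logic is in $\mathsf{co\text{-}NP}$: the set of all (words encoding) entailments $\varphi\vdash\psi$ that belong to Ex-logic is a language in $\mathsf{co\text{-}NP}$, and so is the set of all (words encoding) entailments $\varphi\vdash\psi$ that are valid in all Ex-lattices. -/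

import Mathlib

universe u

namespace CQL

/-! ### The classes P, NP and co-NP

Languages over an alphabet, and polynomial-time Turing machines as in Mathlib
(`Turing.TM2ComputableInPolyTime`: finitely many control states, and finitely many stacks instead
of tapes; the time bound is a polynomial in the length of the input word). -/

/-- `L` is in P: some deterministic polynomial-time machine, which reads an arbitrary word over the
alphabet and writes one bit, decides membership in `L`. -/
def InP {A : Type} (L : Language A) : Prop :=
  ∃ f : List A → Bool,
    Nonempty (Turing.TM2ComputableInPolyTime (id : List A → List A) Computability.encodeBool f) ∧
      ∀ x : List A, x ∈ L ↔ f x = true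

/-- `L` is in NP: membership of a word `x` is witnessed by a certificate `w` over some finite
alphabet `B`, of length polynomial in that of `x`, and the pairs `(x, w)` are checked in polynomial
time. The pair is written as the word `x` followed by the word `w`, over the disjoint union of the
two alphabets. -/
def InNP {A : Type} (L : Language A) : Prop :=
  ∃ (B : Type) (_ : Fintype B) (R : Language (A ⊕ B)) (p : Polynomial ℕ), InP R ∧
    ∀ x : List A, x ∈ L ↔
      ∃ w : List B, w.length ≤ p.eval x.length ∧ x.map Sum.inl ++ w.map Sum.inr ∈ R

/-- `L` is in co-NP: the set of all words outside `L` is in NP. -/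
def InCoNP {A : Type} (L : Language A) : Prop :=
  InNP ({x | x ∉ L} : Language A)

/-! ### Formulas and entailments -/

/-- Propositional formulas in the signature `∧, ∨, ¬, ⊤, ⊥`, with variables indexed by `ℕ`. -/
inductive Formula : Type
  | var (n : ℕ)
  | top
  | bot
  | and (φ ψ : Formula)
  | or (φ ψ : Formula)
  | neg (φ : Formula)

/-- The finite alphabet in which formulas and entailments are written. -/
inductive Token : Type
  | var
  | bit (b : Bool)
  | top
  | bot
  | and
  | or
  | neg
  | entails
  deriving DecidableEq, Fintype

/-- A formula as a word, in prefix (Polish) notation. The variable with index `n` is written as the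
symbol `Token.var` followed by the binary digits of `n`, least significant first. -/
def Formula.encode : Formula → List Token
  | .var n => Token.var :: (Computability.encodeNat n).map Token.bit
  | .top => [Token.top]
  | .bot => [Token.bot]
  | .and φ ψ => Token.and :: (φ.encode ++ ψ.encode)
  | .or φ ψ => Token.or :: (φ.encode ++ ψ.encode)
  | .neg φ => Token.neg :: φ.encode

/-- The entailment `φ ⊢ ψ` as a word. -/
def encodeEntailment (φ ψ : Formula) : List Token :=
  φ.encode ++ Token.entails :: ψ.encode

/-- The decision problem of a binary relation on formulas, as a language: the words that encode an
entailment belonging to the relation. -/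
def entailmentProblem (V : Formula → Formula → Prop) : Language Token :=
  {x | ∃ φ ψ : Formula, V φ ψ ∧ x = encodeEntailment φ ψ}

/-! ### Ex-logic -/

/-- Introduction--elimination logics. -/
structure IsIntroElimLogic (R : Formula → Formula → Prop) : Prop where
  refl : ∀ φ, R φ φ
  bot_entails : ∀ φ, R .bot φ
  entails_top : ∀ φ, R φ .top
  and_left : ∀ φ ψ, R (.and φ ψ) φ
  and_right : ∀ φ ψ, R (.and φ ψ) ψ
  or_left : ∀ φ ψ, R φ (.or φ ψ)
  or_right : ∀ φ ψ, R ψ (.or φ ψ)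
  double_neg_intro : ∀ φ, R φ (.neg (.neg φ))
  contradiction : ∀ φ, R (.and φ (.neg φ)) .bot
  cut : ∀ φ ψ χ, R φ ψ → R ψ χ → R φ χ
  and_intro : ∀ φ ψ χ, R φ ψ → R φ χ → R φ (.and ψ χ)
  or_elim : ∀ φ ψ χ, R φ χ → R ψ χ → R (.or φ ψ) χ
  neg_antitone : ∀ φ ψ, R φ ψ → R (.neg ψ) (.neg φ)

/-- `¬[a ∧ ((b ∧ c) ∨ (b ∧ d))] ∧ a ∧ (c ∨ e) ∧ ¬¬f`. -/
def exLeft (a b c d e f : Formula) : Formula :=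
  .and (.and (.and (.neg (.and a (.or (.and b c) (.and b d)))) a) (.or c e)) (.neg (.neg f))

/-- `¬¬(a ∧ f) ∧ [(a ∧ c) ∨ (a ∧ e) ∨ f] ∧ [(b ∧ (c ∨ d)) ∨ ¬(b ∧ (c ∨ d))]`. -/
def exRight (a b c d e f : Formula) : Formula :=
  .and (.and (.neg (.neg (.and a f))) (.or (.or (.and a c) (.and a e)) f))
    (.or (.and b (.or c d)) (.neg (.and b (.or c d))))

/-- Ex-logic, that is, fundamental logic with the axiom (Ex) added: the smallest
introduction--elimination logic that contains all instances of (Ex). -/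
def ExLogic (φ ψ : Formula) : Prop :=
  ∀ R : Formula → Formula → Prop, IsIntroElimLogic R →
    (∀ a b c d e f, R (exLeft a b c d e f) (exRight a b c d e f)) → R φ ψ

/-! ### Ex-lattices -/

/-- Fundamental lattices: bounded lattices with a weak pseudo-complement `ᶜ`. -/
class FundamentalLattice (L : Type u) extends Lattice L, BoundedOrder L, Compl L where
  compl_antitone : ∀ a b : L, a ≤ b → bᶜ ≤ aᶜ
  inf_compl_eq_bot : ∀ a : L, a ⊓ aᶜ = ⊥
  le_compl_compl : ∀ a : L, a ≤ aᶜᶜ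

/-- The extension of a valuation `v` to all formulas. -/
def Formula.eval {L : Type u} [FundamentalLattice L] (v : ℕ → L) : Formula → L
  | .var n => v n
  | .top => ⊤
  | .bot => ⊥
  | .and φ ψ => φ.eval v ⊓ ψ.eval v
  | .or φ ψ => φ.eval v ⊔ ψ.eval v
  | .neg φ => (φ.eval v)ᶜ

/-- The entailment `φ ⊢ ψ` is valid in `L`. -/
def ValidIn (L : Type u) [FundamentalLattice L] (φ ψ : Formula) : Prop :=
  ∀ v : ℕ → L, φ.eval v ≤ ψ.eval v

/-- Ex-lattices: fundamental lattices in which the axiom (Ex) is valid. -/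
def IsExLattice (L : Type u) [FundamentalLattice L] : Prop :=
  ValidIn L (exLeft (.var 0) (.var 1) (.var 2) (.var 3) (.var 4) (.var 5))
    (exRight (.var 0) (.var 1) (.var 2) (.var 3) (.var 4) (.var 5))

/-- The entailment `φ ⊢ ψ` is valid in all Ex-lattices. -/
def ExValid (φ ψ : Formula) : Prop :=
  ∀ (L : Type u) [FundamentalLattice L], IsExLattice L → ValidIn L φ ψ

end CQL

/-!
Write `φ ⊢ ψ` for entailment in Ex-logic. The axiom (Ex) holds in every ortholattice, because there
`¬¬f = f` and `p ∨ ¬p = ⊤`; it also holds in every Kripke frame of intuitionistic logic, because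
there `∧` distributes over `∨`, so that the conjuncts `¬[a ∧ ((b ∧ c) ∨ (b ∧ d))]` and `a` imply
`¬(b ∧ (c ∨ d))`. So `φ ⊢ ψ` fails as soon as it has a countermodel in one of these
two classes, and the point of (Ex) is that one of them always suffices. In an Ex-lattice,
`a ≤ ¬¬b` is an entailment relation of orthologic, because `a ∧ ¬¬b ≤ ¬¬(a ∧ b)`, which is a
special case of (Ex). Consequently, if `φ ⊢ ¬¬ψ` fails, then orthologic refutes `φ ⊢ ψ`. If on the
other hand `φ ⊢ ¬¬ψ` holds but `φ ⊢ ψ` does not, then a filter that contains `φ` and is maximal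
among those without `ψ` is prime (`IsExLattice.exists_prime`), and so are the maximal proper filters
above it (`IsPrime.exists_maximal`); these are the root and the leaves of a Kripke model that
refutes the entailment.

In both cases, only the values of the subformulas of `φ` and `ψ` matter. In orthologic, it suffices
to take as points the values of the subformulas and of their negations
(`IsExLattice.orthoModel`), and in the other case one leaf for each subformula whose negation
fails at the root (`IsPrime.fanModel`). Hence every entailment that is not in Ex-logic has a
countermodel of polynomial size. The certificates are such countermodels, written as a table of
truth values at the positions of the word at which subformulas start, together with a table that
says where subformulas start and end. For a word that does not encode an entailment, the certificate
is a table of the positions at which no formula starts. Correctness of a certificate (`Certifies`)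
is a first-order property of the word followed by the certificate, in a language that can speak
about letters at sums of positions (`Definable.certifies`). Such properties are decided in
polynomial time by an exhaustive search over the values of the variables (`WordFormula.inP`); this
is proved with a small language of while-programs over stacks that is compiled to Turing machines
(`StackProgram.Prog.polyTime_of_exec`).

Completeness for Ex-lattices (`exValid_iff_exLogic`) is proved with the Lindenbaum algebra, and
shows that the two decision problems are the same.
-/

/-! ### While-programs over stacks, compiled to Turing machines -/

namespace StackProgram

open Turing Function

/-- While-programs over finitely many stacks, with stack alphabets `Γ k`, and one register with
values in `σ`. -/
inductive Prog {K : Type} (Γ : K → Type) (σ : Type) : Type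
  | push (k : K) (f : σ → Γ k)
  | peek (k : K) (f : σ → Option (Γ k) → σ)
  | pop (k : K) (f : σ → Option (Γ k) → σ)
  | load (f : σ → σ)
  | seq (p q : Prog Γ σ)
  | ite (c : σ → Bool) (p q : Prog Γ σ)
  | loop (c : σ → Bool) (p : Prog Γ σ)

namespace Prog

variable {K : Type} {Γ : K → Type} {σ : Type}

/-- The control points of a program: one for each instruction and each test. -/
def Label : Prog Γ σ → Type
  | push _ _ | peek _ _ | pop _ _ | load _ => Unit
  | seq p q => p.Label ⊕ q.Label
  | ite _ p q => Option (p.Label ⊕ q.Label)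
  | loop _ p => Option p.Label

/-- There are finitely many control points. -/
@[reducible] def labelFintype : (p : Prog Γ σ) → Fintype p.Label
  | push _ _ | peek _ _ | pop _ _ | load _ => inferInstanceAs (Fintype Unit)
  | seq p q =>
    letI := p.labelFintype
    letI := q.labelFintype
    inferInstanceAs (Fintype (p.Label ⊕ q.Label))
  | ite _ p q =>
    letI := p.labelFintype
    letI := q.labelFintype
    inferInstanceAs (Fintype (Option (p.Label ⊕ q.Label)))
  | loop _ p =>
    letI := p.labelFintype
    inferInstanceAs (Fintype (Option p.Label))

/-- The control point at which a program starts. -/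
def entry : (p : Prog Γ σ) → p.Label
  | push _ _ | peek _ _ | pop _ _ | load _ => ()
  | seq p _ => Sum.inl p.entry
  | ite _ _ _ => none
  | loop _ _ => none

/-- The statement at a control point, when the control points of the program are embedded by `emb`
into the labels `Λ` of a machine, which continues at the label `next` after the program. -/
def stmt {Λ : Type} : (p : Prog Γ σ) → (p.Label → Λ) → Λ → p.Label → TM2.Stmt Γ Λ σ
  | push k f, _, next, _ => .push k f (.goto fun _ => next)
  | peek k f, _, next, _ => .peek k f (.goto fun _ => next)
  | pop k f, _, next, _ => .pop k f (.goto fun _ => next)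
  | load f, _, next, _ => .load f (.goto fun _ => next)
  | seq p q, emb, _, Sum.inl l => p.stmt (emb ∘ Sum.inl) (emb (Sum.inr q.entry)) l
  | seq _ q, emb, next, Sum.inr l => q.stmt (emb ∘ Sum.inr) next l
  | ite c p q, emb, _, none =>
    .branch c (.goto fun _ => emb (some (Sum.inl p.entry)))
      (.goto fun _ => emb (some (Sum.inr q.entry)))
  | ite _ p _, emb, next, some (Sum.inl l) => p.stmt (emb ∘ some ∘ Sum.inl) next l
  | ite _ _ q, emb, next, some (Sum.inr l) => q.stmt (emb ∘ some ∘ Sum.inr) next l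
  | loop c p, emb, next, none =>
    .branch c (.goto fun _ => emb (some p.entry)) (.goto fun _ => next)
  | loop _ p, emb, _, some l => p.stmt (emb ∘ some) (emb none) l

variable [DecidableEq K]

/-- Big-step semantics: `Exec p v S t v' S'` says that `p`, started with register `v` and stacks
`S`, stops after `t` steps with register `v'` and stacks `S'`. -/
inductive Exec : Prog Γ σ → σ → (∀ k, List (Γ k)) → ℕ → σ → (∀ k, List (Γ k)) → Prop
  | push (k f v S) : Exec (push k f) v S 1 v (update S k (f v :: S k))
  | peek (k f v S) : Exec (peek k f) v S 1 (f v (S k).head?) S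
  | pop (k f v S) : Exec (pop k f) v S 1 (f v (S k).head?) (update S k (S k).tail)
  | load (f v S) : Exec (load f) v S 1 (f v) S
  | seq {p q v S t v' S' t' v'' S''} : Exec p v S t v' S' → Exec q v' S' t' v'' S'' →
      Exec (seq p q) v S (t + t') v'' S''
  | ite_true {c p q v S t v' S'} : c v = true → Exec p v S t v' S' →
      Exec (ite c p q) v S (t + 1) v' S'
  | ite_false {c p q v S t v' S'} : c v = false → Exec q v S t v' S' →
      Exec (ite c p q) v S (t + 1) v' S'
  | loop_done {c p v S} : c v = false → Exec (loop c p) v S 1 v S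
  | loop_step {c p v S t v' S' t' v'' S''} : c v = true → Exec p v S t v' S' →
      Exec (loop c p) v' S' t' v'' S'' → Exec (loop c p) v S (t + t' + 1) v'' S''

/-- The machine `M` gets from one configuration to another in `t` steps. -/
def Steps {Λ : Type} (M : Λ → TM2.Stmt Γ Λ σ) (t : ℕ) (a b : TM2.Cfg Γ Λ σ) : Prop :=
  (flip bind (TM2.step M))^[t] (some a) = some b

theorem Steps.one {Λ : Type} {M : Λ → TM2.Stmt Γ Λ σ} {l : Λ} {v : σ} {S : ∀ k, List (Γ k)}
    {b : TM2.Cfg Γ Λ σ} (h : TM2.stepAux (M l) v S = b) : Steps M 1 ⟨some l, v, S⟩ b := by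
  subst h; rfl

theorem Steps.trans {Λ : Type} {M : Λ → TM2.Stmt Γ Λ σ} {t t' : ℕ} {a b c : TM2.Cfg Γ Λ σ}
    (h : Steps M t a b) (h' : Steps M t' b c) : Steps M (t + t') a c := by
  unfold Steps at *
  rw [add_comm, iterate_add_apply, h, h']

/-- The compiled program simulates the big-step semantics step by step. -/
theorem Exec.steps {Λ : Type} {M : Λ → TM2.Stmt Γ Λ σ} {p : Prog Γ σ} {v v' : σ}
    {S S' : ∀ k, List (Γ k)} {t : ℕ} (h : Exec p v S t v' S') :
    ∀ (emb : p.Label → Λ) (next : Λ), (∀ l, M (emb l) = p.stmt emb next l) →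
      Steps M t ⟨some (emb p.entry), v, S⟩ ⟨some next, v', S'⟩ := by
  induction h with
  | push k f v S => exact fun emb next hM => Steps.one (by rw [hM]; rfl)
  | peek k f v S => exact fun emb next hM => Steps.one (by rw [hM]; rfl)
  | pop k f v S => exact fun emb next hM => Steps.one (by rw [hM]; rfl)
  | load f v S => exact fun emb next hM => Steps.one (by rw [hM]; rfl)
  | seq _ _ ihp ihq =>
    intro emb next hM
    exact (ihp _ _ fun l => hM (Sum.inl l)).trans (ihq (emb ∘ Sum.inr) _ fun l => hM (Sum.inr l))
  | ite_true hc _ ih =>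
    intro emb next hM
    rw [add_comm]
    refine Steps.trans (Steps.one ?_) (ih (emb ∘ some ∘ Sum.inl) next fun l => hM (some (Sum.inl l)))
    rw [hM]
    simp [entry, stmt, hc]; rfl
  | ite_false hc _ ih =>
    intro emb next hM
    rw [add_comm]
    refine Steps.trans (Steps.one ?_) (ih (emb ∘ some ∘ Sum.inr) next fun l => hM (some (Sum.inr l)))
    rw [hM]
    simp [entry, stmt, hc]; rfl
  | loop_done hc =>
    intro emb next hM
    refine Steps.one ?_
    rw [hM]
    simp [entry, stmt, hc]
  | loop_step hc _ _ ih ih' =>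
    intro emb next hM
    rw [add_comm]
    refine Steps.trans (Steps.one ?_) ((ih (emb ∘ some) (emb none) fun l => hM (some l)).trans
      (ih' emb next hM))
    rw [hM]
    simp [entry, stmt, hc]; rfl

/-- The machine that runs a program and halts. -/
def machine [Fintype K] [Fintype σ] (p : Prog Γ σ) (k₀ k₁ : K) [Fintype (Γ k₀)] (init : σ) :
    FinTM2 :=
  letI := p.labelFintype
  { K := K
    k₀ := k₀
    k₁ := k₁
    Γ := Γ
    Λ := Option p.Label
    main := some p.entry
    σ := σ
    initialState := init
    m := fun l => l.elim .halt (p.stmt some none) }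

theorem dite_eq_update (k₀ : K) (s : List (Γ k₀)) :
    (fun k => if h : k = k₀ then (by rw [h]; exact s) else []) =
      update (fun k => ([] : List (Γ k))) k₀ s := by
  funext k
  by_cases hk : k = k₀
  · subst hk; simp
  · simp [hk]

/-- A program that computes `f`, leaving nothing but the output behind, in time bounded by a
polynomial in the length of the input, yields a polynomial-time machine. -/
theorem polyTime_of_exec [Fintype K] [Fintype σ] (p : Prog Γ σ) {k₀ k₁ : K} [Fintype (Γ k₀)]
    (init : σ) {α β : Type} (ea : α → List (Γ k₀)) (eb : β → List (Γ k₁)) (f : α → β)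
    (T : Polynomial ℕ)
    (h : ∀ a, ∃ t ≤ T.eval (ea a).length,
      Exec p init (update (fun _ => []) k₀ (ea a)) t init (update (fun _ => []) k₁ (eb (f a)))) :
    Nonempty (TM2ComputableInPolyTime ea eb f) := by
  refine ⟨⟨⟨machine p k₀ k₁ init, Equiv.refl _, Equiv.refl _⟩, T + 1, fun a => ?_⟩⟩
  have hex : ∃ t ≤ (T + 1).eval (ea a).length,
      Steps (machine p k₀ k₁ init).m t
        ⟨some (some p.entry), init, update (fun _ => []) k₀ (ea a)⟩
        ⟨none, init, update (fun _ => []) k₁ (eb (f a))⟩ := by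
    obtain ⟨t, ht, he⟩ := h a
    refine ⟨t + 1, by simpa using ht, ?_⟩
    exact (he.steps (Λ := Option p.Label) some none fun l => rfl).trans (Steps.one rfl)
  have hi : initList (machine p k₀ k₁ init) (List.map (Equiv.refl (Γ k₀)).invFun (ea a)) =
      ⟨some (some p.entry), init, update (fun _ => []) k₀ (ea a)⟩ := by
    exact congrArg _ ((dite_eq_update k₀ _).trans (congrArg (update _ k₀) (List.map_id (ea a))))
  have ho : haltList (machine p k₀ k₁ init) (List.map (Equiv.refl (Γ k₁)).invFun (eb (f a))) =
      ⟨none, init, update (fun _ => []) k₁ (eb (f a))⟩ := by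
    exact congrArg _ ((dite_eq_update k₁ _).trans (congrArg (update _ k₁) (List.map_id (eb (f a)))))
  rw [← hi, ← ho] at hex
  exact ⟨⟨hex.choose, hex.choose_spec.2⟩, hex.choose_spec.1⟩

end Prog

end StackProgram

/-! ### First-order definable languages are in P -/

namespace StackProgram

open Turing Function

namespace Prog

variable {K : Type} {Γ : K → Type} {σ : Type} [DecidableEq K]

/-- Run `test`, then repeat `body` and `test` as long as the condition `c` holds. -/
def whileDo {K : Type} {Γ : K → Type} {σ : Type} (test : Prog Γ σ) (c : σ → Bool)
    (body : Prog Γ σ) : Prog Γ σ :=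
  .seq test (.loop c (.seq body test))

/-- The program `p` gets from one state to another in at most `T` steps. -/
def Runs (p : Prog Γ σ) (v : σ) (S : ∀ k, List (Γ k)) (T : ℕ) (v' : σ) (S' : ∀ k, List (Γ k)) :
    Prop :=
  ∃ t ≤ T, Exec p v S t v' S'

variable {p q : Prog Γ σ} {c : σ → Bool} {v v' v'' : σ} {S S' S'' : ∀ k, List (Γ k)} {T T' : ℕ}

theorem Exec.runs {t : ℕ} (h : Exec p v S t v' S') : Runs p v S t v' S' := ⟨t, le_rfl, h⟩

theorem Runs.mono (h : Runs p v S T v' S') (hT : T ≤ T') : Runs p v S T' v' S' :=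
  let ⟨t, ht, he⟩ := h
  ⟨t, ht.trans hT, he⟩

theorem Runs.seq (h : Runs p v S T v' S') (h' : Runs q v' S' T' v'' S'') :
    Runs (p.seq q) v S (T + T') v'' S'' :=
  let ⟨_, ht, he⟩ := h
  let ⟨_, ht', he'⟩ := h'
  ⟨_, add_le_add ht ht', he.seq he'⟩

theorem Runs.ite_true (hc : c v = true) (h : Runs p v S T v' S') :
    Runs (ite c p q) v S (T + 1) v' S' :=
  let ⟨_, ht, he⟩ := h
  ⟨_, Nat.succ_le_succ ht, he.ite_true hc⟩

theorem Runs.ite_false (hc : c v = false) (h : Runs q v S T v' S') :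
    Runs (ite c p q) v S (T + 1) v' S' :=
  let ⟨_, ht, he⟩ := h
  ⟨_, Nat.succ_le_succ ht, he.ite_false hc⟩

theorem Runs.loop_done (hc : c v = false) : Runs (loop c p) v S 1 v S :=
  (Exec.loop_done hc).runs

theorem Runs.loop_step (hc : c v = true) (h : Runs p v S T v' S')
    (h' : Runs (loop c p) v' S' T' v'' S'') : Runs (loop c p) v S (T + T' + 1) v'' S'' :=
  let ⟨_, ht, he⟩ := h
  let ⟨_, ht', he'⟩ := h'
  ⟨_, Nat.succ_le_succ (add_le_add ht ht'), he.loop_step hc he'⟩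

theorem Runs.whileDo_done (h : Runs p v S T v' S') (hc : c v' = false) :
    Runs (whileDo p c q) v S (T + 1) v' S' :=
  h.seq (Runs.loop_done hc)

theorem Runs.whileDo_step {T'' : ℕ} {w : σ} {R : ∀ k, List (Γ k)} (h : Runs p v S T v' S')
    (hc : c v' = true) (h' : Runs q v' S' T' v'' S'') (h'' : Runs (whileDo p c q) v'' S'' T'' w R) :
    Runs (whileDo p c q) v S (T + T' + T'' + 1) w R := by
  obtain ⟨_, ht, he⟩ := h''
  cases he with
  | seq h1 h2 =>
    exact (h.seq (Runs.loop_step hc (h'.seq h1.runs) h2.runs)).mono (by omega)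

end Prog

/-- The stacks of the machine that evaluates a formula over a word: the part of the word to the left
of the head, reversed, and the part to the right; an auxiliary counter; the output; and one unary
counter for each variable. -/
inductive Stack (m : ℕ) : Type
  | left
  | right
  | aux
  | out
  | counter (i : Fin m)
  deriving DecidableEq, Fintype

/-- The alphabets of the stacks. -/
abbrev Sym (A : Type) (m : ℕ) : Stack m → Type
  | .left | .right => A
  | .out => Bool
  | .aux | .counter _ => Unit

/-- The register: the letter read last, a flag that tells whether a counter was non-empty, and a
truth value. -/
abbrev Reg (A : Type) : Type := Option A × Bool × Bool

variable {A : Type} {m : ℕ}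

/-- The stacks with given contents. -/
def contents (l r : List A) (x : ℕ) (c : Fin m → ℕ) (o : List Bool) : ∀ k, List (Sym A m k)
  | .left => l
  | .right => r
  | .aux => List.replicate x ()
  | .out => o
  | .counter i => List.replicate (c i) ()

section

variable {l r l' r' : List A} {x y : ℕ} {c : Fin m → ℕ} {o o' : List Bool} {i : Fin m}

theorem update_left : update (contents l r x c o) .left l' = contents l' r x c o := by
  funext k; cases k <;> rfl

theorem update_right : update (contents l r x c o) .right r' = contents l r' x c o := by
  funext k; cases k <;> rfl

theorem update_out : update (contents l r x c o) .out o' = contents l r x c o' := by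
  funext k; cases k <;> rfl

theorem update_aux : update (contents l r x c o) .aux (List.replicate y ()) =
    contents l r y c o := by
  funext k; cases k <;> rfl

theorem update_counter : update (contents l r x c o) (.counter i) (List.replicate y ()) =
    contents l r x (update c i y) o := by
  funext k
  cases k with
  | counter j =>
    by_cases hj : j = i
    · subst hj; simp only [update_self, contents]
    · rw [update_of_ne (by simpa using hj)]
      simp only [contents, update_of_ne hj]
  | _ => rfl

open Prog

variable {v : Reg A}

theorem push_left_runs (f : Reg A → A) : Runs (.push .left f) v (contents l r x c o) 1 v
    (contents (f v :: l) r x c o) := by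
  rw [← update_left (l' := f v :: l)]; exact (Exec.push _ _ _ _).runs

theorem pop_left_runs (f : Reg A → Option A → Reg A) : Runs (.pop .left f) v (contents l r x c o) 1
    (f v l.head?) (contents l.tail r x c o) := by
  rw [← update_left (l' := l.tail)]; exact (Exec.pop _ _ _ _).runs

theorem push_right_runs (f : Reg A → A) : Runs (.push .right f) v (contents l r x c o) 1 v
    (contents l (f v :: r) x c o) := by
  rw [← update_right (r' := f v :: r)]; exact (Exec.push _ _ _ _).runs

theorem pop_right_runs (f : Reg A → Option A → Reg A) : Runs (.pop .right f) v (contents l r x c o)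
    1 (f v r.head?) (contents l r.tail x c o) := by
  rw [← update_right (r' := r.tail)]; exact (Exec.pop _ _ _ _).runs

theorem push_out_runs (f : Reg A → Bool) : Runs (.push .out f) v (contents l r x c o) 1 v
    (contents l r x c (f v :: o)) := by
  rw [← update_out (o' := f v :: o)]; exact (Exec.push _ _ _ _).runs

theorem push_aux_runs : Runs (.push .aux fun _ => ()) v (contents l r x c o) 1 v
    (contents l r (x + 1) c o) := by
  rw [← update_aux (y := x + 1)]; exact (Exec.push _ _ _ _).runs

theorem push_counter_runs : Runs (.push (.counter i) fun _ => ()) v (contents l r x c o) 1 v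
    (contents l r x (update c i (c i + 1)) o) := by
  rw [← update_counter (y := c i + 1)]; exact (Exec.push _ _ _ _).runs

/-- Decrease the auxiliary counter, and note in the flag whether it was positive. -/
def decrAux : Prog (Sym A m) (Reg A) :=
  .pop .aux fun v o => (v.1, o.isSome, v.2.2)

/-- Decrease a counter, and note in the flag whether it was positive. -/
def decr (i : Fin m) : Prog (Sym A m) (Reg A) :=
  .pop (.counter i) fun v o => (v.1, o.isSome, v.2.2)

theorem decrAux_zero_runs : Runs decrAux v (contents l r 0 c o) 1 (v.1, false, v.2.2)
    (contents l r 0 c o) := by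
  nth_rw 2 [← update_aux (x := 0) (y := 0)]; exact (Exec.pop _ _ _ _).runs

theorem decrAux_succ_runs : Runs decrAux v (contents l r (x + 1) c o) 1 (v.1, true, v.2.2)
    (contents l r x c o) := by
  rw [← update_aux (x := x + 1) (y := x)]; exact (Exec.pop _ _ _ _).runs

theorem decr_zero_runs (hi : c i = 0) : Runs (decr i) v (contents l r x c o) 1
    (v.1, false, v.2.2) (contents l r x c o) := by
  have h := (Exec.pop (Stack.counter i) (fun (v : Reg A) o => (v.1, o.isSome, v.2.2)) v
    (contents l r x c o)).runs
  have h0 : contents l r x c o (.counter i) = List.replicate 0 () := by simp only [contents, hi]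
  rw [h0, List.replicate_zero, List.tail_nil, ← List.replicate_zero, update_counter, ← hi,
    update_eq_self, hi] at h
  exact h

theorem decr_succ_runs (hi : c i = y + 1) : Runs (decr i) v (contents l r x c o) 1
    (v.1, true, v.2.2) (contents l r x (update c i y) o) := by
  have := (Exec.pop (Stack.counter i) (fun (v : Reg A) o => (v.1, o.isSome, v.2.2)) v
    (contents l r x c o)).runs
  simp only [contents, hi, List.replicate_succ, List.tail_cons] at this
  rwa [update_counter] at this

end

open Prog

section Programs

variable [Inhabited A]

/-- Move the head one position to the right; past the end of the word, do nothing. -/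
def headRight : Prog (Sym A m) (Reg A) :=
  .seq (.pop .right fun v o => (o, v.2))
    (.ite (fun v => v.1.isSome) (.push .left fun v => v.1.getD default) (.load id))

/-- Move the head back to the beginning of the word. -/
def rewind : Prog (Sym A m) (Reg A) :=
  whileDo (.pop .left fun v o => (o, v.2)) (fun v => v.1.isSome)
    (.push .right fun v => v.1.getD default)

/-- Increase a counter. -/
def incr (i : Fin m) : Prog (Sym A m) (Reg A) := .push (.counter i) fun _ => ()

/-- Move the head to the right by the value of a counter, which is kept. -/
def advance (i : Fin m) : Prog (Sym A m) (Reg A) :=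
  .seq (whileDo (decr i) (fun v => v.2.1) (.seq (.push .aux fun _ => ()) headRight))
    (whileDo decrAux (fun v => v.2.1) (incr i))

/-- Set a counter to `0`. -/
def reset (i : Fin m) : Prog (Sym A m) (Reg A) :=
  whileDo (decr i) (fun v => v.2.1) (.load id)

/-- The stacks with the head at position `p` of the word `z`, the auxiliary counter at `x`, the
counters at `c` and no output. -/
def headAt (z : List A) (p x : ℕ) (c : Fin m → ℕ) : ∀ k, List (Sym A m k) :=
  contents (z.take p).reverse (z.drop p) x c []

variable (z : List A) (p x : ℕ) (c : Fin m → ℕ)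

theorem headRight_runs (v : Reg A) :
    ∃ a, Runs headRight v (headAt z p x c) 3 (a, v.2) (headAt z (p + 1) x c) := by
  rcases lt_or_ge p z.length with hp | hp
  · have hd : z.drop p = z[p] :: z.drop (p + 1) := List.drop_eq_getElem_cons hp
    have ht : (z.take (p + 1)).reverse = z[p] :: (z.take p).reverse := by
      rw [List.take_succ_eq_append_getElem hp, List.reverse_append]; rfl
    refine ⟨some z[p], Runs.seq (T := 1) (T' := 2) (pop_right_runs _)
      (Runs.ite_true (T := 1) ?_ ?_)⟩
    · rw [hd]; rfl
    · rw [headAt, hd, ht]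
      exact push_left_runs _
  · have hd : z.drop p = [] := List.drop_eq_nil_of_le hp
    have hd' : z.drop (p + 1) = [] := List.drop_eq_nil_of_le (by omega)
    have ht : z.take (p + 1) = z.take p := by
      rw [List.take_of_length_le hp, List.take_of_length_le (by omega)]
    refine ⟨none, Runs.seq (T := 1) (T' := 2) (pop_right_runs _)
      (Runs.ite_false (T := 1) ?_ ?_)⟩
    · rw [hd]; rfl
    · rw [headAt, hd, hd', ht]
      exact (Exec.load _ _ _).runs

theorem rewind_runs (v : Reg A) : ∃ a, Runs rewind v (headAt z p x c) (3 * z.length + 2) (a, v.2)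
    (headAt z 0 x c) := by
  have key : ∀ (l r : List A) (v : Reg A), ∃ a,
      Runs rewind v (contents l r x c []) (3 * l.length + 2) (a, v.2)
        (contents [] (l.reverse ++ r) x c []) := by
    intro l
    induction l with
    | nil => exact fun r v => ⟨none, Runs.whileDo_done (pop_left_runs _) rfl⟩
    | cons b l ih =>
      intro r v
      obtain ⟨a, ha⟩ := ih (b :: r) (some b, v.2)
      refine ⟨a, (Runs.whileDo_step (pop_left_runs _) rfl (push_right_runs _)
        (v'' := (some b, v.2)) (T'' := 3 * l.length + 2) ?_).mono (by rw [List.length_cons]; omega)⟩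
      rw [List.reverse_cons, List.append_assoc]
      exact ha
  obtain ⟨a, ha⟩ := key (z.take p).reverse (z.drop p) v
  rw [List.reverse_reverse, List.take_append_drop, List.length_reverse, List.length_take] at ha
  exact ⟨a, ha.mono (by omega)⟩

omit [Inhabited A] in
theorem reset_runs (v : Reg A) (i : Fin m) {l r : List A} {o : List Bool} :
    Runs (reset i) v (contents l r x c o) (3 * c i + 2) (v.1, false, v.2.2)
      (contents l r x (update c i 0) o) := by
  generalize hy : c i = y
  induction y generalizing c v with
  | zero =>
    rw [show update c i 0 = c by rw [← hy, update_eq_self]]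
    exact (Runs.whileDo_done (decr_zero_runs hy) rfl)
  | succ y ih =>
    have h := ih (update c i y) (v.1, true, v.2.2) (update_self ..)
    rw [update_idem] at h
    exact (Runs.whileDo_step (decr_succ_runs hy) rfl (Exec.load _ _ _).runs h).mono (by omega)

theorem advance_runs (v : Reg A) (i : Fin m) :
    ∃ a, Runs (advance i) v (headAt z p 0 c) (9 * c i + 4) (a, false, v.2.2)
      (headAt z (p + c i) 0 c) := by
  -- The first loop moves the counter to the auxiliary one, and the second loop restores it.
  have key : ∀ (y p x : ℕ) (c : Fin m → ℕ) (v : Reg A), c i = y → ∃ a,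
      Runs (whileDo (decr i) (fun v => v.2.1) (.seq (.push .aux fun _ => ()) headRight)) v
        (headAt z p x c) (6 * y + 2) (a, false, v.2.2)
        (headAt z (p + y) (x + y) (update c i 0)) := by
    intro y
    induction y with
    | zero =>
      intro p x c v hy
      rw [show update c i 0 = c by rw [← hy, update_eq_self]]
      exact ⟨_, Runs.whileDo_done (decr_zero_runs hy) rfl⟩
    | succ y ih =>
      intro p x c v hy
      obtain ⟨b, hb⟩ := headRight_runs z p (x + 1) (update c i y) (v.1, true, v.2.2)
      obtain ⟨a, ha⟩ := ih (p + 1) (x + 1) (update c i y) (b, true, v.2.2) (update_self ..)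
      rw [update_idem, show p + 1 + y = p + (y + 1) by omega,
        show x + 1 + y = x + (y + 1) by omega] at ha
      exact ⟨a, (Runs.whileDo_step (decr_succ_runs hy) rfl (Runs.seq push_aux_runs hb) ha).mono
        (by omega)⟩
  have key' : ∀ (y : ℕ) (c : Fin m → ℕ) (v : Reg A) (l r : List A),
      Runs (whileDo decrAux (fun v => v.2.1) (incr i)) v (contents l r y c []) (3 * y + 2)
        (v.1, false, v.2.2) (contents l r 0 (update c i (c i + y)) []) := by
    intro y
    induction y with
    | zero =>
      intro c v l r
      rw [add_zero, update_eq_self]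
      exact Runs.whileDo_done decrAux_zero_runs rfl
    | succ y ih =>
      intro c v l r
      have h := ih (update c i (c i + 1)) (v.1, true, v.2.2) l r
      rw [update_idem, update_self, show c i + 1 + y = c i + (y + 1) by omega] at h
      exact (Runs.whileDo_step decrAux_succ_runs rfl push_counter_runs h).mono (by omega)
  obtain ⟨a, ha⟩ := key (c i) p 0 c v rfl
  have h := key' (0 + c i) (update c i 0) (a, false, v.2.2) (z.take (p + c i)).reverse
    (z.drop (p + c i))
  rw [update_idem, update_self, Nat.zero_add, Nat.zero_add, update_eq_self] at h
  rw [Nat.zero_add] at ha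
  exact ⟨_, (ha.seq h).mono (by omega)⟩

/-- Move the head to the right by the sum of the values of some counters. -/
def advanceSum : List (Fin m) → Prog (Sym A m) (Reg A)
  | [] => .load id
  | i :: is => .seq (advance i) (advanceSum is)

/-- Move the head to the right by a constant. -/
def advanceConst : ℕ → Prog (Sym A m) (Reg A)
  | 0 => .load id
  | n + 1 => .seq headRight (advanceConst n)

/-- Test the letter at the position `n + ∑ is`, that is `none` past the end of the word. -/
def lookup (n : ℕ) (is : List (Fin m)) (t : Option A → Bool) : Prog (Sym A m) (Reg A) :=
  .seq (advanceConst n) (.seq (advanceSum is) (.seq (.peek .right fun v o => (v.1, v.2.1, t o)) rewind))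

theorem advanceSum_runs {N : ℕ} (hN : ∀ i, c i ≤ N) (is : List (Fin m)) :
    ∀ (p : ℕ) (v : Reg A), ∃ v', Runs (advanceSum is) v (headAt z p 0 c)
      (is.length * (9 * N + 4) + 1) v' (headAt z (p + (is.map c).sum) 0 c) := by
  induction is with
  | nil => exact fun p v => ⟨v, (Exec.load _ _ _).runs.mono (by omega)⟩
  | cons i is ih =>
    intro p v
    obtain ⟨a, ha⟩ := advance_runs z p c v i
    obtain ⟨v', hv'⟩ := ih (p + c i) (a, false, v.2.2)
    refine ⟨v', ?_⟩
    rw [List.map_cons, List.sum_cons, ← add_assoc, List.length_cons]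
    refine (ha.seq hv').mono ?_
    have := hN i
    nlinarith

theorem advanceConst_runs (n : ℕ) : ∀ (p : ℕ) (v : Reg A), ∃ v', Runs (advanceConst n) v
    (headAt z p x c) (3 * n + 1) v' (headAt z (p + n) x c) := by
  induction n with
  | zero => exact fun p v => ⟨v, (Exec.load _ _ _).runs.mono (by omega)⟩
  | succ n ih =>
    intro p v
    obtain ⟨a, ha⟩ := headRight_runs z p x c v
    obtain ⟨v', hv'⟩ := ih (p + 1) (a, v.2)
    rw [show p + 1 + n = p + (n + 1) by omega] at hv'
    exact ⟨v', (ha.seq hv').mono (by omega)⟩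

theorem lookup_runs (hN : ∀ i, c i ≤ z.length) (n : ℕ) (is : List (Fin m)) (t : Option A → Bool)
    (v : Reg A) : ∃ v', Runs (lookup n is t) v (headAt z 0 0 c)
      (3 * n + is.length * (9 * z.length + 4) + 3 * z.length + 5) v' (headAt z 0 0 c) ∧
      v'.2.2 = t z[n + (is.map c).sum]? := by
  obtain ⟨v₁, h₁⟩ := advanceConst_runs z 0 c n 0 v
  rw [Nat.zero_add] at h₁
  obtain ⟨v₂, h₂⟩ := advanceSum_runs z c hN is n v₁
  have h₃ := (Exec.peek (Γ := Sym A m) .right (fun v o => (v.1, v.2.1, t o)) v₂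
    (headAt z (n + (is.map c).sum) 0 c)).runs
  obtain ⟨a, h₄⟩ := rewind_runs z (n + (is.map c).sum) 0 c
    (v₂.1, v₂.2.1, t (z.drop (n + (is.map c).sum)).head?)
  exact ⟨_, (h₁.seq (h₂.seq (h₃.seq h₄))).mono (by omega), by rw [List.head?_drop]⟩

end Programs

end StackProgram

section FirstOrder

open Turing Function StackProgram Prog

/-- First-order formulas about the positions of a word. The variables are numbered by the depth at
which they are bound: the variables `0, …, d - 1` may be free in a formula at depth `d`, and a
quantifier at depth `d` binds the variable `d`. The atomic formula `letter n ts p` says that the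
letter at the position `n + ∑ t ∈ ts, t` has the property `p`; this letter is `none` if the position
lies past the end. -/
inductive WordFormula (A : Type) : Type
  | letter (n : ℕ) (ts : List ℕ) (p : Option A → Bool)
  | not (φ : WordFormula A)
  | and (φ ψ : WordFormula A)
  | all (φ : WordFormula A)

namespace WordFormula

variable {A : Type} {m : ℕ}

/-- Truth of a formula at depth `d` in the word `z`, under an assignment of positions to variables.
Quantifiers range over the positions of the word. -/
def Holds (z : List A) : WordFormula A → ℕ → (ℕ → ℕ) → Prop
  | letter n ts p, _, ρ => p z[n + (ts.map ρ).sum]? = true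
  | not φ, d, ρ => ¬φ.Holds z d ρ
  | and φ ψ, d, ρ => φ.Holds z d ρ ∧ ψ.Holds z d ρ
  | all φ, d, ρ => ∀ i < z.length, φ.Holds z (d + 1) (update ρ d i)

/-- At depth `d`, the formula is well-formed and has less than `m` variables. -/
def wellScoped (m : ℕ) : WordFormula A → ℕ → Bool
  | letter _ ts _, d => ts.all (· < d)
  | not φ, d => φ.wellScoped m d
  | and φ ψ, d => φ.wellScoped m d && ψ.wellScoped m d
  | all φ, d => d < m && φ.wellScoped m (d + 1)

/-- The program that evaluates a formula at depth `d`, by an exhaustive search for each quantifier.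
-/
def prog [Inhabited A] [NeZero m] : WordFormula A → ℕ → Prog (Sym A m) (Reg A)
  | letter n ts p, _ => lookup n (ts.map (Fin.ofNat m)) p
  | not φ, d => .seq (φ.prog d) (.load fun v => (v.1, v.2.1, !v.2.2))
  | and φ ψ, d => .seq (φ.prog d) (.ite (fun v => v.2.2) (ψ.prog d) (.load id))
  | all φ, d =>
    .seq
      (.seq
        (whileDo (.seq (lookup 0 [Fin.ofNat m d] Option.isSome)
            (.ite (fun v => v.2.2) (φ.prog (d + 1)) (.load id)))
          (fun v => v.2.2) (incr (Fin.ofNat m d)))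
        (lookup 0 [Fin.ofNat m d] Option.isNone))
      (reset (Fin.ofNat m d))

open Polynomial in
/-- A bound for the running time of the evaluation, as a function of the length of the word. -/
noncomputable def time : WordFormula A → ℕ[X]
  | letter n ts _ => C (3 * n) + C ts.length * (9 * X + 4) + 3 * X + 5
  | not φ => φ.time + 1
  | and φ ψ => φ.time + ψ.time + 2
  | all φ => (X + 1) * (φ.time + 12 * X + 13) + 15 * X + 11

/-- The values of the counters, when the variables `0, …, d - 1` have values given by `ρ`. -/
def counters (m d : ℕ) (ρ : ℕ → ℕ) : Fin m → ℕ := fun i => if i < d then ρ i else 0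

theorem counters_succ [NeZero m] {d : ℕ} (hd : d < m) (ρ : ℕ → ℕ) (j : ℕ) :
    counters m (d + 1) (update ρ d j) = update (counters m d ρ) (Fin.ofNat m d) j := by
  funext i
  by_cases hi : i = Fin.ofNat m d
  · subst hi
    simp [counters, Nat.mod_eq_of_lt hd]
  · have : (i : ℕ) ≠ d := fun h => hi (by ext; simp [h, Nat.mod_eq_of_lt hd])
    rw [update_of_ne hi]
    simp only [counters, update_of_ne this]
    congr 1
    simp only [eq_iff_iff]
    omega

theorem counters_zero [NeZero m] {d : ℕ} (hd : d < m) (ρ : ℕ → ℕ) :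
    update (counters m d ρ) (Fin.ofNat m d) 0 = counters m d ρ := by
  rw [update_eq_self_iff]
  simp [counters, Nat.mod_eq_of_lt hd]

theorem counters_le {d N : ℕ} {ρ : ℕ → ℕ} (hρ : ∀ i < d, ρ i ≤ N) (i : Fin m) :
    counters m d ρ i ≤ N := by
  unfold counters
  split_ifs with h
  · exact hρ i h
  · exact Nat.zero_le _

theorem update_le {d N j : ℕ} {ρ : ℕ → ℕ} (hρ : ∀ i < d, ρ i ≤ N) (hj : j ≤ N) :
    ∀ i < d + 1, update ρ d j i ≤ N := by
  intro i hi
  rcases eq_or_ne i d with rfl | h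
  · simpa using hj
  · rw [update_of_ne h]
    exact hρ i (by omega)

/-- Correctness and running time of the evaluation of formulas. -/
theorem prog_runs [Inhabited A] [NeZero m] (z : List A) (φ : WordFormula A) :
    ∀ (d : ℕ) (ρ : ℕ → ℕ) (v : Reg A), d ≤ m → φ.wellScoped m d → (∀ i < d, ρ i ≤ z.length) →
      ∃ v', Runs (φ.prog d) v (headAt z 0 0 (counters m d ρ)) (φ.time.eval z.length) v'
        (headAt z 0 0 (counters m d ρ)) ∧ (v'.2.2 = true ↔ φ.Holds z d ρ) := by
  induction φ with
  | letter n ts p =>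
    intro d ρ v hd hs hρ
    obtain ⟨v', h, hv'⟩ := lookup_runs z (counters m d ρ) (counters_le hρ) n
      (ts.map (Fin.ofNat m)) p v
    refine ⟨v', ?_, ?_⟩
    · simpa [time, prog] using h
    · rw [hv', List.map_map]
      have : ts.map (counters m d ρ ∘ Fin.ofNat m) = ts.map ρ := by
        refine List.map_congr_left fun t ht => ?_
        have : t < d := by simpa using List.all_eq_true.1 hs t ht
        simp [counters, Nat.mod_eq_of_lt (this.trans_le hd), this]
      rw [this]
      rfl
  | not φ ih =>
    intro d ρ v hd hs hρ
    obtain ⟨v', h, hv'⟩ := ih d ρ v hd hs hρ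
    refine ⟨_, (h.seq (Exec.load _ _ _).runs).mono (by simp [time]), ?_⟩
    rw [Holds, ← hv']
    simp
  | and φ ψ ihφ ihψ =>
    intro d ρ v hd hs hρ
    have hs : φ.wellScoped m d = true ∧ ψ.wellScoped m d = true := by
      simpa only [wellScoped, Bool.and_eq_true] using hs
    obtain ⟨v', h, hv'⟩ := ihφ d ρ v hd hs.1 hρ
    by_cases hφ : φ.Holds z d ρ
    · obtain ⟨v'', h', hv''⟩ := ihψ d ρ v' hd hs.2 hρ
      refine ⟨v'', (h.seq (Runs.ite_true (hv'.2 hφ) h')).mono ?_, ?_⟩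
      · simp [time]; omega
      · simp [Holds, hv'', hφ]
    · refine ⟨v', (h.seq (Runs.ite_false (by simpa [hφ] using hv') (Exec.load _ _ _).runs)).mono ?_,
        ?_⟩
      · simp [time]
      · simp [Holds, hv', hφ]
  | all φ ih =>
    intro d ρ v hd hs hρ
    simp only [wellScoped, Bool.and_eq_true, decide_eq_true_eq] at hs
    obtain ⟨hdm, hs⟩ := hs
    set N := z.length with hN
    set T := φ.time.eval N with hT
    have hsum : ∀ j, ((([Fin.ofNat m d]).map (counters m (d + 1) (update ρ d j))).sum) = j := by
      intro j
      simp [counters, Nat.mod_eq_of_lt hdm]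
    have test : ∀ j ≤ N, ∀ v : Reg A, ∃ v', Runs
        (.seq (lookup 0 [Fin.ofNat m d] Option.isSome)
          (.ite (fun v => v.2.2) (φ.prog (d + 1)) (.load id))) v
        (headAt z 0 0 (counters m (d + 1) (update ρ d j))) (T + 12 * N + 11) v'
        (headAt z 0 0 (counters m (d + 1) (update ρ d j))) ∧
        (v'.2.2 = true ↔ j < N ∧ φ.Holds z (d + 1) (update ρ d j)) := by
      intro j hj v
      obtain ⟨v₁, h₁, hv₁⟩ := lookup_runs z (counters m (d + 1) (update ρ d j))
        (counters_le (update_le hρ hj)) 0 [Fin.ofNat m d] Option.isSome v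
      rw [hsum, Nat.zero_add] at hv₁
      by_cases hjN : j < N
      · obtain ⟨v₂, h₂, hv₂⟩ := ih (d + 1) (update ρ d j) v₁ hdm hs (update_le hρ hj)
        refine ⟨v₂, (h₁.seq (Runs.ite_true ?_ h₂)).mono ?_, ?_⟩
        · rw [hv₁]; simpa using hjN
        · simp only [List.length_singleton, ← hN]; omega
        · simp [hv₂, hjN]
      · refine ⟨v₁, (h₁.seq (Runs.ite_false ?_ (Exec.load _ _ _).runs)).mono ?_, ?_⟩
        · rw [hv₁]; simpa using hjN
        · simp only [List.length_singleton, ← hN]; omega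
        · rw [hv₁]; simp [hjN, ← hN]
    -- The search stops at the first counterexample, or behind the end of the word.
    have search : ∀ k j, j + k = N → ∀ v : Reg A, ∃ v', ∃ j' ≤ N, Runs
        (whileDo (.seq (lookup 0 [Fin.ofNat m d] Option.isSome)
          (.ite (fun v => v.2.2) (φ.prog (d + 1)) (.load id)))
          (fun v => v.2.2) (incr (Fin.ofNat m d))) v
        (headAt z 0 0 (counters m (d + 1) (update ρ d j))) ((k + 1) * (T + 12 * N + 13)) v'
        (headAt z 0 0 (counters m (d + 1) (update ρ d j'))) ∧
        (j' = N ↔ ∀ i < N, j ≤ i → φ.Holds z (d + 1) (update ρ d i)) := by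
      intro k
      induction k with
      | zero =>
        intro j hj v
        obtain ⟨v', h, hv'⟩ := test j (by omega) v
        refine ⟨v', j, by omega, (Runs.whileDo_done h ?_).mono (by omega), ?_⟩
        · rw [← Bool.not_eq_true, hv']; omega
        · exact ⟨fun _ i hi hji => by omega, fun _ => by omega⟩
      | succ k ihk =>
        intro j hj v
        obtain ⟨v', h, hv'⟩ := test j (by omega) v
        by_cases hφ : φ.Holds z (d + 1) (update ρ d j)
        · obtain ⟨v'', j', hj', h', hv''⟩ := ihk (j + 1) (by omega) v'
          refine ⟨v'', j', hj', (Runs.whileDo_step h ?_ (T' := 1) ?_ h').mono ?_, ?_⟩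
          · exact hv'.2 ⟨by omega, hφ⟩
          · have := push_counter_runs (v := v') (l := (z.take 0).reverse) (r := z.drop 0) (x := 0)
              (c := counters m (d + 1) (update ρ d j)) (o := []) (i := Fin.ofNat m d)
            rw [counters_succ hdm, update_self, update_idem, ← counters_succ hdm,
              ← counters_succ hdm] at this
            exact this
          · ring_nf; omega
          · rw [hv'']
            refine ⟨fun H i hi hji => ?_, fun H i hi hji => H i hi (by omega)⟩
            rcases hji.eq_or_lt with rfl | hlt
            · exact hφ
            · exact H i hi hlt
        · refine ⟨v', j, by omega, (Runs.whileDo_done h ?_).mono ?_, ?_⟩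
          · rw [← Bool.not_eq_true, hv']; exact fun h => hφ h.2
          · ring_nf; omega
          · exact ⟨fun hjN => by omega, fun H => absurd (H j (by omega) le_rfl) hφ⟩
    obtain ⟨v₁, j, hj, h₁, hv₁⟩ := search N 0 (by omega) v
    obtain ⟨v₂, h₂, hv₂⟩ := lookup_runs z (counters m (d + 1) (update ρ d j))
        (counters_le (update_le hρ hj)) 0 [Fin.ofNat m d] Option.isNone v₁
    rw [hsum, Nat.zero_add] at hv₂
    have h₃ := reset_runs 0 (counters m (d + 1) (update ρ d j)) v₂ (Fin.ofNat m d)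
      (l := (z.take 0).reverse) (r := z.drop 0) (o := [])
    have h₄ := (h₁.seq h₂).seq h₃
    rw [counters_succ hdm, counters_succ hdm, update_idem, counters_zero hdm, update_self] at h₄
    refine ⟨_, h₄.mono ?_, ?_⟩
    · simp [time, ← hN, ← hT]
      ring_nf
      omega
    · change v₂.2.2 = true ↔ _
      rw [hv₂]
      simp only [Option.isNone_iff_eq_none, List.getElem?_eq_none_iff, Holds]
      constructor
      · exact fun h i hi => hv₁.1 (by omega) i hi (Nat.zero_le _)
      · exact fun h => (hv₁.2 fun i hi _ => h i hi).ge

/-- The program that evaluates a sentence, clears the stacks and writes the truth value. -/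
def decider [Inhabited A] [NeZero m] (φ : WordFormula A) : Prog (Sym A m) (Reg A) :=
  .seq (φ.prog 0)
    (.seq (whileDo (.pop .right fun v o => (o, v.2)) (fun v => v.1.isSome) (.load id))
      (.seq (.push .out fun v => v.2.2) (.load fun _ => (none, false, false))))

open Classical Polynomial in
/-- Languages that are defined by a first-order sentence are in P: exhaustive search for each of a
constant number of quantifiers takes polynomial time. -/
theorem inP [Fintype A] [Inhabited A] (φ : WordFormula A) (m : ℕ) (hφ : φ.wellScoped (m + 1) 0)
    (L : Language A) (hL : ∀ z, z ∈ L ↔ φ.Holds z 0 fun _ => 0) : CQL.InP L := by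
  refine ⟨fun z => decide (z ∈ L), ?_, by simp⟩
  refine polyTime_of_exec (φ.decider (m := m + 1)) (k₀ := .right) (k₁ := .out)
    (none, false, false) id Computability.encodeBool _ (φ.time + 3 * X + 4) fun z => ?_
  have clear : ∀ (r : List A) (v : Reg A) (c : Fin (m + 1) → ℕ),
      Runs (whileDo (.pop .right fun v o => (o, v.2)) (fun v => v.1.isSome) (.load id)) v
        (contents [] r 0 c []) (3 * r.length + 2) (none, v.2) (contents [] [] 0 c []) := by
    intro r
    induction r with
    | nil => exact fun v c => Runs.whileDo_done (pop_right_runs _) rfl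
    | cons a r ih =>
      intro v c
      exact (Runs.whileDo_step (pop_right_runs _) rfl (Exec.load _ _ _).runs
        (ih (some a, v.2) c)).mono (by rw [List.length_cons]; omega)
  obtain ⟨v, h, hv⟩ := φ.prog_runs (m := m + 1) z 0 (fun _ => 0) (none, false, false)
    (Nat.zero_le _) hφ (by simp)
  have h₂ := clear z v (counters (m + 1) 0 fun _ => 0)
  have h₃ := push_out_runs (v := (none, v.2)) (l := ([] : List A)) (r := []) (x := 0)
    (c := counters (m + 1) 0 fun _ => 0) (o := []) fun v => v.2.2
  have h₄ := h.seq (h₂.seq (h₃.seq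
    (Exec.load (fun _ : Reg A => ((none, false, false) : Reg A)) _ _).runs))
  obtain ⟨t, ht, he⟩ := h₄
  refine ⟨t, ht.trans ?_, ?_⟩
  · simp; omega
  · have e₁ : headAt z 0 0 (counters (m + 1) 0 fun _ => 0) =
        update (fun _ => []) Stack.right z := by
      funext k; cases k <;> rfl
    have e₂ : contents [] [] 0 (counters (m + 1) 0 fun _ => 0) [v.2.2] =
        update (fun k => ([] : List (Sym A (m + 1) k))) Stack.out
          (Computability.encodeBool (decide (z ∈ L))) := by
      have : v.2.2 = decide (z ∈ L) := by rw [Bool.eq_iff_iff, hv, decide_eq_true_iff, hL]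
      rw [this]
      funext k; cases k <;> rfl
    rw [e₁, e₂] at he
    exact he

end WordFormula

end FirstOrder

/-! ### Ex-logic is the logic of Ex-lattices -/

namespace CQL

theorem isIntroElimLogic_exLogic : IsIntroElimLogic ExLogic where
  refl _ := fun _ h _ => h.refl _
  bot_entails _ := fun _ h _ => h.bot_entails _
  entails_top _ := fun _ h _ => h.entails_top _
  and_left _ _ := fun _ h _ => h.and_left _ _
  and_right _ _ := fun _ h _ => h.and_right _ _
  or_left _ _ := fun _ h _ => h.or_left _ _
  or_right _ _ := fun _ h _ => h.or_right _ _
  double_neg_intro _ := fun _ h _ => h.double_neg_intro _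
  contradiction _ := fun _ h _ => h.contradiction _
  cut _ _ _ := fun h₁ h₂ _ h e => h.cut _ _ _ (h₁ _ h e) (h₂ _ h e)
  and_intro _ _ _ := fun h₁ h₂ _ h e => h.and_intro _ _ _ (h₁ _ h e) (h₂ _ h e)
  or_elim _ _ _ := fun h₁ h₂ _ h e => h.or_elim _ _ _ (h₁ _ h e) (h₂ _ h e)
  neg_antitone _ _ := fun h₁ _ h e => h.neg_antitone _ _ (h₁ _ h e)

theorem exLogic_ex (a b c d e f : Formula) :
    ExLogic (exLeft a b c d e f) (exRight a b c d e f) :=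
  fun _ _ h => h a b c d e f

theorem isIntroElimLogic_validIn (L : Type u) [FundamentalLattice L] :
    IsIntroElimLogic (ValidIn L) where
  refl _ := fun _ => le_rfl
  bot_entails _ := fun _ => bot_le
  entails_top _ := fun _ => le_top
  and_left _ _ := fun _ => inf_le_left
  and_right _ _ := fun _ => inf_le_right
  or_left _ _ := fun _ => le_sup_left
  or_right _ _ := fun _ => le_sup_right
  double_neg_intro _ := fun _ => FundamentalLattice.le_compl_compl _
  contradiction _ := fun _ => (FundamentalLattice.inf_compl_eq_bot _).le
  cut _ _ _ := fun h₁ h₂ v => (h₁ v).trans (h₂ v)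
  and_intro _ _ _ := fun h₁ h₂ v => le_inf (h₁ v) (h₂ v)
  or_elim _ _ _ := fun h₁ h₂ v => sup_le (h₁ v) (h₂ v)
  neg_antitone _ _ := fun h v => FundamentalLattice.compl_antitone _ _ (h v)

/-- The inequality that (Ex) expresses. -/
theorem IsExLattice.ex_le {L : Type u} [FundamentalLattice L] (hL : IsExLattice L)
    (a b c d e f : L) :
    (a ⊓ (b ⊓ c ⊔ b ⊓ d))ᶜ ⊓ a ⊓ (c ⊔ e) ⊓ fᶜᶜ ≤
      (a ⊓ f)ᶜᶜ ⊓ (a ⊓ c ⊔ a ⊓ e ⊔ f) ⊓ (b ⊓ (c ⊔ d) ⊔ (b ⊓ (c ⊔ d))ᶜ) :=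
  hL fun
    | 0 => a
    | 1 => b
    | 2 => c
    | 3 => d
    | 4 => e
    | _ => f

/-- Formulas, lifted to the universe `u` and ordered by entailment in Ex-logic. -/
def LiftedFormula : Type u := ULift.{u} Formula

instance : Preorder LiftedFormula.{u} where
  le φ ψ := ExLogic φ.down ψ.down
  le_refl _ := isIntroElimLogic_exLogic.refl _
  le_trans _ _ _ := isIntroElimLogic_exLogic.cut _ _ _

/-- The Lindenbaum algebra of Ex-logic. -/
def Lindenbaum : Type u := Antisymmetrization LiftedFormula.{u} (· ≤ ·)

namespace Lindenbaum

/-- The class of a formula. -/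
def mk (φ : Formula) : Lindenbaum.{u} := toAntisymmetrization (· ≤ ·) (ULift.up φ)

instance : PartialOrder Lindenbaum.{u} :=
  inferInstanceAs (PartialOrder (Antisymmetrization LiftedFormula.{u} (· ≤ ·)))

theorem mk_le_mk {φ ψ : Formula} : (mk φ : Lindenbaum.{u}) ≤ mk ψ ↔ ExLogic φ ψ := Iff.rfl

/-- A formula in a given class. -/
noncomputable def rep (a : Lindenbaum.{u}) : Formula := (ofAntisymmetrization (· ≤ ·) a).down

theorem mk_rep (a : Lindenbaum.{u}) : mk (rep a) = a :=
  toAntisymmetrization_ofAntisymmetrization (· ≤ ·) a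

theorem rep_mk_entails (φ : Formula) : ExLogic (rep (mk.{u} φ)) φ :=
  mk_le_mk.1 (mk_rep (mk.{u} φ)).le

theorem entails_rep_mk (φ : Formula) : ExLogic φ (rep (mk.{u} φ)) :=
  mk_le_mk.1 (mk_rep (mk.{u} φ)).ge

noncomputable instance : FundamentalLattice Lindenbaum.{u} where
  sup a b := mk (.or (rep a) (rep b))
  inf a b := mk (.and (rep a) (rep b))
  compl a := mk (.neg (rep a))
  top := mk .top
  bot := mk .bot
  le_sup_left a b := by
    conv_lhs => rw [← mk_rep a]
    exact isIntroElimLogic_exLogic.or_left _ _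
  le_sup_right a b := by
    conv_lhs => rw [← mk_rep b]
    exact isIntroElimLogic_exLogic.or_right _ _
  sup_le a b c ha hb := by
    rw [← mk_rep a, ← mk_rep c] at ha
    rw [← mk_rep b, ← mk_rep c] at hb
    conv_rhs => rw [← mk_rep c]
    exact isIntroElimLogic_exLogic.or_elim _ _ _ ha hb
  inf_le_left a b := by
    conv_rhs => rw [← mk_rep a]
    exact isIntroElimLogic_exLogic.and_left _ _
  inf_le_right a b := by
    conv_rhs => rw [← mk_rep b]
    exact isIntroElimLogic_exLogic.and_right _ _
  le_inf a b c ha hb := by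
    rw [← mk_rep a, ← mk_rep b] at ha
    rw [← mk_rep a, ← mk_rep c] at hb
    conv_lhs => rw [← mk_rep a]
    exact isIntroElimLogic_exLogic.and_intro _ _ _ ha hb
  le_top a := by
    rw [← mk_rep a]
    exact isIntroElimLogic_exLogic.entails_top _
  bot_le a := by
    rw [← mk_rep a]
    exact isIntroElimLogic_exLogic.bot_entails _
  compl_antitone a b h := by
    rw [← mk_rep a, ← mk_rep b] at h
    exact isIntroElimLogic_exLogic.neg_antitone _ _ h
  inf_compl_eq_bot a := by
    have h := isIntroElimLogic_exLogic
    refine le_antisymm (mk_le_mk.2 (h.cut _ _ _ (h.and_intro _ _ _ (h.and_left _ _)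
      (h.cut _ _ _ (h.and_right _ _) (rep_mk_entails _))) (h.contradiction (rep a))))
      (mk_le_mk.2 (h.bot_entails _))
  le_compl_compl a := by
    have h := isIntroElimLogic_exLogic
    conv_lhs => rw [← mk_rep a]
    exact mk_le_mk.2 (h.cut _ _ _ (h.double_neg_intro _) (h.neg_antitone _ _ (rep_mk_entails _)))

theorem mk_and (φ ψ : Formula) : mk.{u} (.and φ ψ) = mk φ ⊓ mk ψ := by
  have h := isIntroElimLogic_exLogic
  refine le_antisymm (le_inf (mk_le_mk.2 (h.and_left _ _)) (mk_le_mk.2 (h.and_right _ _))) ?_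
  exact mk_le_mk.2 (h.and_intro _ _ _ (h.cut _ _ _ (h.and_left _ _) (rep_mk_entails _))
    (h.cut _ _ _ (h.and_right _ _) (rep_mk_entails _)))

theorem mk_or (φ ψ : Formula) : mk.{u} (.or φ ψ) = mk φ ⊔ mk ψ := by
  have h := isIntroElimLogic_exLogic
  refine le_antisymm ?_ (sup_le (mk_le_mk.2 (h.or_left _ _)) (mk_le_mk.2 (h.or_right _ _)))
  exact mk_le_mk.2 (h.or_elim _ _ _ (h.cut _ _ _ (entails_rep_mk _) (h.or_left _ _))
    (h.cut _ _ _ (entails_rep_mk _) (h.or_right _ _)))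

theorem mk_neg (φ : Formula) : mk.{u} (.neg φ) = (mk φ)ᶜ := by
  have h := isIntroElimLogic_exLogic
  exact le_antisymm (mk_le_mk.2 (h.neg_antitone _ _ (rep_mk_entails _)))
    (mk_le_mk.2 (h.neg_antitone _ _ (entails_rep_mk _)))

theorem eval_var (φ : Formula) : φ.eval (fun n => mk.{u} (.var n)) = mk φ := by
  induction φ with
  | var n => rfl
  | top => rfl
  | bot => rfl
  | and φ ψ ihφ ihψ => rw [mk_and, ← ihφ, ← ihψ]; rfl
  | or φ ψ ihφ ihψ => rw [mk_or, ← ihφ, ← ihψ]; rfl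
  | neg φ ih => rw [mk_neg, ← ih]; rfl

theorem isExLattice : IsExLattice Lindenbaum.{u} := by
  intro v
  have h := mk_le_mk.{u}.2 (exLogic_ex (rep (v 0)) (rep (v 1)) (rep (v 2)) (rep (v 3)) (rep (v 4))
    (rep (v 5)))
  simp only [exLeft, exRight, mk_and, mk_or, mk_neg, mk_rep] at h
  exact h

end Lindenbaum

/-- Soundness and completeness of Ex-logic for Ex-lattices in any universe. -/
theorem exValid_iff_exLogic (φ ψ : Formula) : ExValid.{u} φ ψ ↔ ExLogic φ ψ := by
  constructor
  · intro h
    have := h Lindenbaum.{u} Lindenbaum.isExLattice fun n => Lindenbaum.mk (.var n)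
    rwa [Lindenbaum.eval_var, Lindenbaum.eval_var, Lindenbaum.mk_le_mk] at this
  · exact fun h L _ hL => h _ (isIntroElimLogic_validIn L) fun a b c d e f v => hL.ex_le _ _ _ _ _ _

/-! ### Soundness for orthoframes and for Kripke frames -/

section Orthoframe

variable {ι : Type} (C : ι → ι → Prop)

/-- The points that are in the relation `C` to all points of `X`. -/
def perp (X : Set ι) : Set ι := {s | ∀ t ∈ X, C s t}

/-- The value of a formula in the ortholattice of all sets `X` with `perp C (perp C X) = X`. -/
def orthoEval (v : ℕ → Set ι) : Formula → Set ι
  | .var n => v n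
  | .top => Set.univ
  | .bot => ∅
  | .and φ ψ => orthoEval v φ ∩ orthoEval v ψ
  | .or φ ψ => perp C (perp C (orthoEval v φ) ∩ perp C (orthoEval v ψ))
  | .neg φ => perp C (orthoEval v φ)

variable {C}

theorem perp_anti {X Y : Set ι} (h : X ⊆ Y) : perp C Y ⊆ perp C X :=
  fun _ hs t ht => hs t (h ht)

theorem subset_perp_perp (hC : ∀ s t, C s t → C t s) (X : Set ι) : X ⊆ perp C (perp C X) :=
  fun s hs _ ht => hC _ _ (ht s hs)

theorem perp_perp_perp (hC : ∀ s t, C s t → C t s) (X : Set ι) :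
    perp C (perp C (perp C X)) = perp C X :=
  (perp_anti (subset_perp_perp hC X)).antisymm (subset_perp_perp hC _)

theorem inter_perp (hC : ∀ s, ¬C s s) (X : Set ι) : X ∩ perp C X = ∅ :=
  Set.eq_empty_of_forall_notMem fun s hs => hC s (hs.2 s hs.1)

theorem perp_perp_orthoEval (hC : ∀ s t, C s t → C t s) (hC' : ∀ s, ¬C s s) {v : ℕ → Set ι}
    (hv : ∀ n, perp C (perp C (v n)) = v n) (φ : Formula) :
    perp C (perp C (orthoEval C v φ)) = orthoEval C v φ := by
  refine Set.Subset.antisymm ?_ (subset_perp_perp hC _)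
  induction φ with
  | var n => exact (hv n).le
  | top => exact Set.subset_univ _
  | bot =>
    intro s hs
    exact absurd (hs s fun _ ht => ht.elim) (hC' s)
  | and φ ψ ihφ ihψ =>
    exact Set.subset_inter ((perp_anti (perp_anti Set.inter_subset_left)).trans ihφ)
      ((perp_anti (perp_anti Set.inter_subset_right)).trans ihψ)
  | or φ ψ => exact (perp_perp_perp hC _).le
  | neg φ => exact (perp_perp_perp hC _).le

/-- Entailments of Ex-logic hold in all orthoframes. In the proof, the last factor of the conclusion
of (Ex) is the law of excluded middle. -/
theorem ExLogic.orthoEval_subset (hC : ∀ s t, C s t → C t s) (hC' : ∀ s, ¬C s s) {φ ψ : Formula}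
    (h : ExLogic φ ψ) {v : ℕ → Set ι} (hv : ∀ n, perp C (perp C (v n)) = v n) :
    orthoEval C v φ ⊆ orthoEval C v ψ := by
  have cl := perp_perp_orthoEval hC hC' hv
  have orL : ∀ φ ψ, orthoEval C v φ ⊆ orthoEval C v (.or φ ψ) := fun φ ψ =>
    (cl φ).ge.trans (perp_anti Set.inter_subset_left)
  have orR : ∀ φ ψ, orthoEval C v ψ ⊆ orthoEval C v (.or φ ψ) := fun φ ψ =>
    (cl ψ).ge.trans (perp_anti Set.inter_subset_right)
  refine h (fun φ ψ => orthoEval C v φ ⊆ orthoEval C v ψ) ?_ ?_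
  · exact
    { refl := fun _ => subset_rfl
      bot_entails := fun _ => Set.empty_subset _
      entails_top := fun _ => Set.subset_univ _
      and_left := fun _ _ => Set.inter_subset_left
      and_right := fun _ _ => Set.inter_subset_right
      or_left := orL
      or_right := orR
      double_neg_intro := fun _ => subset_perp_perp hC _
      contradiction := fun _ => (inter_perp hC' _).le
      cut := fun _ _ _ => subset_trans
      and_intro := fun _ _ _ => Set.subset_inter
      or_elim := fun φ ψ χ h₁ h₂ =>
        (perp_anti (Set.subset_inter (perp_anti h₁) (perp_anti h₂))).trans (cl χ).le
      neg_antitone := fun _ _ => perp_anti }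
  · rintro a b c d e f s ⟨⟨⟨-, ha⟩, -⟩, hf⟩
    have hf' : s ∈ orthoEval C v f := (cl f).le hf
    refine ⟨⟨subset_perp_perp hC _ ⟨ha, hf'⟩, orR _ _ hf'⟩, ?_⟩
    intro t ht
    have := inter_perp hC' (perp C (orthoEval C v (b.and (c.or d))))
    exact absurd ht (this ▸ Set.notMem_empty t)

end Orthoframe

section Kripke

variable {P : Type} (r : P → P → Prop)

/-- The intuitionistic truth of a formula at a point of a Kripke frame. -/
def Forces (v : P → ℕ → Prop) : Formula → P → Prop
  | .var n, p => v p n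
  | .top, _ => True
  | .bot, _ => False
  | .and φ ψ, p => Forces v φ p ∧ Forces v ψ p
  | .or φ ψ, p => Forces v φ p ∨ Forces v ψ p
  | .neg φ, p => ∀ q, r p q → ¬Forces v φ q

variable {r}

theorem Forces.mono (hr : ∀ p q s, r p q → r q s → r p s) {v : P → ℕ → Prop}
    (hv : ∀ p q n, r p q → v p n → v q n) {p q : P} (hpq : r p q) {φ : Formula}
    (h : Forces r v φ p) : Forces r v φ q := by
  induction φ with
  | var n => exact hv p q n hpq h
  | top => trivial
  | bot => exact h
  | and φ ψ ihφ ihψ => exact ⟨ihφ h.1, ihψ h.2⟩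
  | or φ ψ ihφ ihψ => exact h.imp ihφ ihψ
  | neg φ ih => exact fun s hs => h s (hr _ _ _ hpq hs)

/-- Entailments of Ex-logic hold in all Kripke models. -/
theorem ExLogic.forces (hr : ∀ p, r p p) (hr' : ∀ p q s, r p q → r q s → r p s) {φ ψ : Formula}
    (h : ExLogic φ ψ) {v : P → ℕ → Prop} (hv : ∀ p q n, r p q → v p n → v q n) (p : P)
    (hφ : Forces r v φ p) : Forces r v ψ p := by
  refine h (fun φ ψ => ∀ p, Forces r v φ p → Forces r v ψ p) ?_ ?_ p hφ
  · exact
    { refl := fun _ _ => id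
      bot_entails := fun _ _ => False.elim
      entails_top := fun _ _ _ => trivial
      and_left := fun _ _ _ h => h.1
      and_right := fun _ _ _ h => h.2
      or_left := fun _ _ _ h => Or.inl h
      or_right := fun _ _ _ h => Or.inr h
      double_neg_intro := fun _ _ h q hq h' => h' q (hr q) (h.mono hr' hv hq)
      contradiction := fun _ p h => h.2 p (hr p) h.1
      cut := fun _ _ _ h₁ h₂ p h => h₂ p (h₁ p h)
      and_intro := fun _ _ _ h₁ h₂ p h => ⟨h₁ p h, h₂ p h⟩
      or_elim := fun _ _ _ h₁ h₂ p h => h.elim (h₁ p) (h₂ p)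
      neg_antitone := fun _ _ h p h' q hq h'' => h' q hq (h q h'') }
  · rintro a b c d e f p ⟨⟨⟨hn, ha⟩, hce⟩, hf⟩
    refine ⟨⟨?_, ?_⟩, ?_⟩
    · intro q hq h'
      refine hf q hq fun s hs hfs => h' s hs ⟨ha.mono hr' hv (hr' _ _ _ hq hs), hfs⟩
    · exact Or.inl (hce.imp (fun h => ⟨ha, h⟩) fun h => ⟨ha, h⟩)
    · refine Or.inr fun q hq h => hn q hq ⟨ha.mono hr' hv hq, ?_⟩
      exact h.2.imp (fun h' => ⟨h.1, h'⟩) fun h' => ⟨h.1, h'⟩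

end Kripke

/-! ### The structure of Ex-lattices -/

section ExLattice

open FundamentalLattice

variable {L : Type u} [FundamentalLattice L]

theorem compl_compl_compl_eq (a : L) : aᶜᶜᶜ = aᶜ :=
  (compl_antitone _ _ (le_compl_compl a)).antisymm (le_compl_compl _)

theorem compl_bot_eq : (⊥ : L)ᶜ = ⊤ := by
  have : (⊤ : L)ᶜ = ⊥ := by simpa using inf_compl_eq_bot (⊤ : L)
  rw [eq_top_iff, ← this]
  exact le_compl_compl _

theorem compl_compl_le_iff {a b : L} : a ≤ bᶜᶜ ↔ aᶜᶜ ≤ bᶜᶜ := by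
  refine ⟨fun h => ?_, (le_compl_compl a).trans⟩
  rw [← compl_compl_compl_eq bᶜ]
  exact compl_antitone _ _ (compl_antitone _ _ h)

theorem le_compl_comm {a b : L} (h : a ≤ bᶜ) : b ≤ aᶜ :=
  (le_compl_compl b).trans (compl_antitone _ _ h)

theorem le_compl_sup {a b c : L} : c ≤ (a ⊔ b)ᶜ ↔ c ≤ aᶜ ∧ c ≤ bᶜ :=
  ⟨fun h => ⟨h.trans (compl_antitone _ _ le_sup_left), h.trans (compl_antitone _ _ le_sup_right)⟩,
    fun h => le_compl_comm (sup_le (le_compl_comm h.1) (le_compl_comm h.2))⟩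

/-- In an Ex-lattice, double negation preserves meets. This is a consequence of the first factor of
the conclusion of (Ex). -/
theorem IsExLattice.le_compl_compl_inf (hL : IsExLattice L) {a b c : L} :
    c ≤ (a ⊓ b)ᶜᶜ ↔ c ≤ aᶜᶜ ∧ c ≤ bᶜᶜ := by
  have key : ∀ a b : L, a ⊓ bᶜᶜ ≤ (a ⊓ b)ᶜᶜ := by
    intro a b
    have := (hL.ex_le a ⊥ ⊥ ⊥ ⊤ b).trans (inf_le_left.trans inf_le_left)
    simpa [compl_bot_eq] using this
  constructor
  · exact fun h => ⟨h.trans (compl_antitone _ _ (compl_antitone _ _ inf_le_left)),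
      h.trans (compl_antitone _ _ (compl_antitone _ _ inf_le_right))⟩
  · intro h
    have h₁ : c ≤ (aᶜᶜ ⊓ b)ᶜᶜ := (le_inf h.1 h.2).trans (key _ _)
    rw [compl_compl_le_iff] at h₁
    refine (le_compl_compl c).trans (h₁.trans (compl_compl_le_iff.1 ?_))
    rw [inf_comm, inf_comm a b]
    exact key _ _

/-- Filters of a lattice, possibly improper. -/
structure IsFilter (F : Set L) : Prop where
  top_mem : ⊤ ∈ F
  mem_of_le : ∀ {a b}, a ≤ b → a ∈ F → b ∈ F
  inf_mem : ∀ {a b}, a ∈ F → b ∈ F → a ⊓ b ∈ F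

theorem isFilter_Ici (a : L) : IsFilter (Set.Ici a) :=
  ⟨le_top, fun h ha => le_trans ha h, le_inf⟩

/-- The filter generated by a filter and one more element. -/
theorem IsFilter.adjoin {F : Set L} (hF : IsFilter F) (c : L) :
    IsFilter {b | ∃ a ∈ F, a ⊓ c ≤ b} where
  top_mem := ⟨⊤, hF.top_mem, le_top⟩
  mem_of_le := fun h ⟨a, ha, hab⟩ => ⟨a, ha, hab.trans h⟩
  inf_mem := fun ⟨a, ha, hab⟩ ⟨a', ha', hab'⟩ => ⟨a ⊓ a', hF.inf_mem ha ha',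
    le_inf ((inf_le_inf_right _ inf_le_left).trans hab)
      ((inf_le_inf_right _ inf_le_right).trans hab')⟩

/-- By Zorn's lemma, a filter without `y` is contained in a maximal one. -/
theorem IsFilter.exists_maximal {F : Set L} (hF : IsFilter F) {y : L} (hy : y ∉ F) :
    ∃ M, IsFilter M ∧ F ⊆ M ∧ y ∉ M ∧ ∀ c, c ∉ M → ∃ a ∈ M, a ⊓ c ≤ y := by
  obtain ⟨M, hFM, hM⟩ := zorn_subset_nonempty {G : Set L | IsFilter G ∧ y ∉ G} (fun c hc hch hne => by
    refine ⟨⋃₀ c, ⟨⟨?_, ?_, ?_⟩, ?_⟩, fun s hs => Set.subset_sUnion_of_mem hs⟩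
    · obtain ⟨G, hG⟩ := hne
      exact ⟨G, hG, (hc hG).1.top_mem⟩
    · rintro a b hab ⟨G, hG, ha⟩
      exact ⟨G, hG, (hc hG).1.mem_of_le hab ha⟩
    · rintro a b ⟨G, hG, ha⟩ ⟨H, hH, hb⟩
      rcases hch.total hG hH with h | h
      · exact ⟨H, hH, (hc hH).1.inf_mem (h ha) hb⟩
      · exact ⟨G, hG, (hc hG).1.inf_mem ha (h hb)⟩
    · rintro ⟨G, hG, h⟩
      exact (hc hG).2 h) F ⟨hF, hy⟩
  refine ⟨M, hM.prop.1, hFM, hM.prop.2, fun c hc => ?_⟩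
  by_contra hne
  refine hc (hM.le_of_ge (y := {b | ∃ a ∈ M, a ⊓ c ≤ b}) ⟨hM.prop.1.adjoin c, hne⟩ ?_ ?_)
  · exact fun a ha => ⟨a, ha, inf_le_left⟩
  · exact ⟨⊤, hM.prop.1.top_mem, inf_le_right⟩

/-- Primeness of a filter. -/
def IsPrime (F : Set L) : Prop := ∀ a b, a ⊔ b ∈ F → a ∈ F ∨ b ∈ F

/-- If double negation does not separate `x` from `y`, then a prime filter does: the second factor of
the conclusion of (Ex) is distributivity relative to `y`, below the double negation of `y`. -/
theorem IsExLattice.exists_prime (hL : IsExLattice L) {x y : L} (hxy : ¬x ≤ y) (h : x ≤ yᶜᶜ) :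
    ∃ F, IsFilter F ∧ x ∈ F ∧ y ∉ F ∧ IsPrime F := by
  obtain ⟨F, hF, hxF, hyF, hmax⟩ := (isFilter_Ici x).exists_maximal (y := y) hxy
  have hx : x ∈ F := hxF le_rfl
  refine ⟨F, hF, hx, hyF, fun c e hce => ?_⟩
  by_contra! hne
  obtain ⟨a, ha, hac⟩ := hmax c hne.1
  obtain ⟨b, hb, hbe⟩ := hmax e hne.2
  set w := a ⊓ b ⊓ x with hw
  have key : w ⊓ (c ⊔ e) ⊓ yᶜᶜ ≤ w ⊓ c ⊔ w ⊓ e ⊔ y := by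
    have := (hL.ex_le w ⊥ c ⊥ e y).trans (inf_le_left.trans inf_le_right)
    simpa [compl_bot_eq] using this
  have h₁ : w ⊓ c ⊔ w ⊓ e ⊔ y ≤ y :=
    sup_le (sup_le ((inf_le_inf_right _ (inf_le_left.trans inf_le_left)).trans hac)
      ((inf_le_inf_right _ (inf_le_left.trans inf_le_right)).trans hbe)) le_rfl
  have hwF : w ∈ F := hF.inf_mem (hF.inf_mem ha hb) hx
  exact hyF (hF.mem_of_le (key.trans h₁)
    (hF.inf_mem (hF.inf_mem hwF hce) (hF.mem_of_le h hx)))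

/-- The third factor of the conclusion of (Ex). -/
theorem IsExLattice.le_sup_compl (hL : IsExLattice L) (a b c d : L) :
    (a ⊓ (b ⊓ c ⊔ b ⊓ d))ᶜ ⊓ a ≤ b ⊓ (c ⊔ d) ⊔ (b ⊓ (c ⊔ d))ᶜ := by
  have h := (hL.ex_le a b c d ⊤ ⊤).trans inf_le_right
  refine le_trans ?_ h
  refine le_inf (le_inf le_rfl (by simp)) ?_
  exact le_top.trans (FundamentalLattice.le_compl_compl _)

/-- A proper prime filter contains `cᶜ` as soon as it contains an element disjoint from `c`: it
contains `c ⊔ cᶜ`, by the third factor of the conclusion of (Ex). -/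
theorem IsPrime.compl_mem (hL : IsExLattice L) {F : Set L} (hF : IsFilter F) (hp : IsPrime F)
    (hbot : ⊥ ∉ F) {a c : L} (ha : a ∈ F) (hac : a ⊓ c ≤ ⊥) : cᶜ ∈ F := by
  have h := hL.le_sup_compl a ⊤ c c
  simp only [top_inf_eq, sup_idem, le_bot_iff.1 hac, compl_bot_eq] at h
  exact (hp _ _ (hF.mem_of_le h ha)).resolve_left fun hc =>
    hbot (hF.mem_of_le hac (hF.inf_mem ha hc))

/-- Above a proper prime filter `F` that does not contain `cᶜ`, there is a maximal proper filter
that contains `c`. It is prime by the third factor of the conclusion of (Ex). -/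
theorem IsPrime.exists_maximal (hL : IsExLattice L) {F : Set L} (hF : IsFilter F) (hp : IsPrime F)
    (hbot : ⊥ ∉ F) {c : L} (hc : cᶜ ∉ F) :
    ∃ M, IsFilter M ∧ F ⊆ M ∧ ⊥ ∉ M ∧ c ∈ M ∧ IsPrime M ∧ ∀ a, a ∈ M ∨ aᶜ ∈ M := by
  obtain ⟨M, hM, hFM, hbM, hmax⟩ := (hF.adjoin c).exists_maximal (y := ⊥) (by
    rintro ⟨a, ha, hac⟩
    exact hc (hp.compl_mem hL hF hbot ha hac))
  have hFM' : F ⊆ M := fun a ha => hFM ⟨a, ha, inf_le_left⟩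
  have hprime : IsPrime M := by
    intro d e hde
    by_contra! hne
    obtain ⟨a, ha, had⟩ := hmax d hne.1
    obtain ⟨b, hb, hbe⟩ := hmax e hne.2
    set w := a ⊓ b with hw
    have hwd : w ⊓ d = ⊥ := le_bot_iff.1 ((inf_le_inf_right _ inf_le_left).trans had)
    have hwe : w ⊓ e = ⊥ := le_bot_iff.1 ((inf_le_inf_right _ inf_le_right).trans hbe)
    -- The element `w` is disjoint from `d` and from `e`. Hence `F` contains `w ⊓ (d ⊔ e)` or its
    -- complement; both are impossible.
    have h := hL.le_sup_compl ⊤ w d e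
    simp only [hwd, hwe, le_refl, sup_of_le_left, inf_bot_eq, compl_bot_eq, inf_top_eq,
      top_le_iff] at h
    have hwM : w ⊓ (d ⊔ e) ∈ M := hM.inf_mem (hM.inf_mem ha hb) hde
    rcases hp _ _ (h ▸ hF.top_mem) with h₁ | h₁
    · rcases hp _ _ (hF.mem_of_le inf_le_right h₁) with h₂ | h₂
      · exact hne.1 (hFM' h₂)
      · exact hne.2 (hFM' h₂)
    · refine hbM (hM.mem_of_le (FundamentalLattice.inf_compl_eq_bot _).le (hM.inf_mem hwM (hFM' h₁)))
  refine ⟨M, hM, hFM', hbM, hFM ⟨⊤, hF.top_mem, inf_le_right⟩, hprime, fun a => ?_⟩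
  refine or_iff_not_imp_left.2 fun ha => ?_
  obtain ⟨b, hb, hba⟩ := hmax a ha
  exact hprime.compl_mem hL hM hbM hb hba

end ExLattice

end CQL

/-! ### Subformulas as positions of a word -/

namespace CQL

/-- The letter is a binary digit. -/
def IsBit (o : Option Token) : Prop := ∃ b, o = some (.bit b)

/-- The symbol at position `i`, if it is `Token.var`, is followed by exactly `u` digits, which form
the binary expansion of a number, that is, the last of them is not `0`. -/
structure VarLength (x : List Token) (i u : ℕ) : Prop where
  le_length : i + 1 + u ≤ x.length
  not_isBit : ¬IsBit x[i + 1 + u]?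
  isBit : ∀ a < u, IsBit x[i + 1 + a]?
  last : ∀ a, a + 1 = u → x[i + 1 + a]? = some (.bit true)

/-- The symbols at the positions `i` and `j`, if they are `Token.var`, are followed by the same
digits. -/
def SameDigits (x : List Token) (i j : ℕ) : Prop :=
  ∃ u, VarLength x i u ∧ ¬IsBit x[j + 1 + u]? ∧ ∀ a < u, x[i + 1 + a]? = x[j + 1 + a]?

/-- `Occ x i φ e`: the formula `φ` stands in the word `x` from the position `i` up to, but not
including, the position `e`. -/
inductive Occ (x : List Token) : ℕ → Formula → ℕ → Prop
  | var {i m} : x[i]? = some .var → VarLength x i (Computability.encodeNat m).length →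
      (∀ a < (Computability.encodeNat m).length,
        x[i + 1 + a]? = ((Computability.encodeNat m)[a]?).map Token.bit) →
      Occ x i (.var m) (i + 1 + (Computability.encodeNat m).length)
  | top {i} : x[i]? = some .top → Occ x i .top (i + 1)
  | bot {i} : x[i]? = some .bot → Occ x i .bot (i + 1)
  | and {i k e φ ψ} : x[i]? = some .and → Occ x (i + 1) φ k → Occ x k ψ e → Occ x i (.and φ ψ) e
  | or {i k e φ ψ} : x[i]? = some .or → Occ x (i + 1) φ k → Occ x k ψ e → Occ x i (.or φ ψ) e
  | neg {i e φ} : x[i]? = some .neg → Occ x (i + 1) φ e → Occ x i (.neg φ) e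

variable {x : List Token}

theorem VarLength.unique {i u u' : ℕ} (h : VarLength x i u) (h' : VarLength x i u') : u = u' := by
  rcases lt_trichotomy u u' with hlt | heq | hlt
  · exact absurd (h'.isBit u hlt) h.not_isBit
  · exact heq
  · exact absurd (h.isBit u' hlt) h'.not_isBit

theorem Occ.unique {i e e' : ℕ} {φ φ' : Formula} (h : Occ x i φ e) (h' : Occ x i φ' e') :
    φ = φ' ∧ e = e' := by
  induction h generalizing φ' e' with
  | @var i m hi hu hd =>
    cases h' with
    | @var _ m' _ hu' hd' =>
      have hl := hu.unique hu'
      have : Computability.encodeNat m = Computability.encodeNat m' := by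
        refine List.ext_getElem hl fun a ha ha' => ?_
        have h₁ := hd a ha
        rw [hd' a ha', List.getElem?_eq_getElem ha, List.getElem?_eq_getElem ha'] at h₁
        simpa using h₁.symm
      have hm : m = m' := by
        rw [← Computability.decode_encodeNat m, this, Computability.decode_encodeNat]
      exact ⟨by rw [hm], by rw [hm]⟩
    | _ => simp_all
  | top hi => cases h' <;> simp_all
  | bot hi => cases h' <;> simp_all
  | and hi _ _ ih₁ ih₂ =>
    cases h' with
    | and _ h₁ h₂ =>
      obtain ⟨rfl, rfl⟩ := ih₁ h₁
      obtain ⟨rfl, rfl⟩ := ih₂ h₂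
      exact ⟨rfl, rfl⟩
    | _ => simp_all
  | or hi _ _ ih₁ ih₂ =>
    cases h' with
    | or _ h₁ h₂ =>
      obtain ⟨rfl, rfl⟩ := ih₁ h₁
      obtain ⟨rfl, rfl⟩ := ih₂ h₂
      exact ⟨rfl, rfl⟩
    | _ => simp_all
  | neg hi _ ih =>
    cases h' with
    | neg _ h₁ =>
      obtain ⟨rfl, rfl⟩ := ih h₁
      exact ⟨rfl, rfl⟩
    | _ => simp_all

theorem Occ.lt {i e : ℕ} {φ : Formula} (h : Occ x i φ e) : i < e := by
  induction h <;> omega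

theorem Occ.le_length {i e : ℕ} {φ : Formula} (h : Occ x i φ e) : e ≤ x.length := by
  induction h with
  | var _ h _ => exact h.le_length
  | top h => exact (List.getElem?_eq_some_iff.1 h).1
  | bot h => exact (List.getElem?_eq_some_iff.1 h).1
  | and _ _ _ _ ih => exact ih
  | or _ _ _ _ ih => exact ih
  | neg _ _ ih => exact ih

theorem drop_eq_cons {i : ℕ} {t : Token} (h : x[i]? = some t) : x.drop i = t :: x.drop (i + 1) := by
  obtain ⟨hi, rfl⟩ := List.getElem?_eq_some_iff.1 h
  exact List.drop_eq_getElem_cons hi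

/-- What stands at a position is the code of the formula. -/
theorem Occ.drop {i e : ℕ} {φ : Formula} (h : Occ x i φ e) :
    x.drop i = φ.encode ++ x.drop e := by
  induction h with
  | @var i m hi hu hd =>
    rw [drop_eq_cons hi, Formula.encode, List.cons_append]
    congr 1
    set l := Computability.encodeNat m
    rw [← List.take_append_drop l.length (x.drop (i + 1)), List.drop_drop]
    congr 1
    refine List.ext_getElem? fun a => ?_
    rcases lt_or_ge a l.length with ha | ha
    · rw [List.getElem?_take_of_lt ha, List.getElem?_drop, hd a ha, List.getElem?_map]
    · rw [List.getElem?_eq_none (by simp; omega), List.getElem?_eq_none (by simpa using ha)]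
  | top hi => exact drop_eq_cons hi
  | bot hi => exact drop_eq_cons hi
  | and hi _ _ ih₁ ih₂ => simp [drop_eq_cons hi, ih₁, ih₂, Formula.encode]
  | or hi _ _ ih₁ ih₂ => simp [drop_eq_cons hi, ih₁, ih₂, Formula.encode]
  | neg hi _ ih => simp [drop_eq_cons hi, ih, Formula.encode]

theorem encodePosNum_getLast? (p : PosNum) :
    (Computability.encodePosNum p).getLast? = some true := by
  induction p with
  | one => rfl
  | bit0 p ih => rw [Computability.encodePosNum, List.getLast?_cons, ih]; rfl
  | bit1 p ih => rw [Computability.encodePosNum, List.getLast?_cons, ih]; rfl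

/-- Binary expansions have no superfluous leading zeros. -/
theorem encodeNat_getLast? (m : ℕ) : ∀ b ∈ (Computability.encodeNat m).getLast?, b = true := by
  unfold Computability.encodeNat
  cases (m : Num) with
  | zero => simp [Computability.encodeNum]
  | pos p => simp [Computability.encodeNum, encodePosNum_getLast?]

theorem exists_encodePosNum (l : List Bool) (h : l.getLast? = some true) :
    ∃ p, Computability.encodePosNum p = l := by
  induction l with
  | nil => simp at h
  | cons b l ih =>
    rcases l with _ | ⟨c, l⟩
    · simp only [List.getLast?_singleton, Option.some.injEq] at h
      exact ⟨.one, by rw [h]; rfl⟩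
    · obtain ⟨p, hp⟩ := ih (by rwa [List.getLast?_cons_cons] at h)
      cases b
      · exact ⟨.bit0 p, by rw [← hp]; rfl⟩
      · exact ⟨.bit1 p, by rw [← hp]; rfl⟩

/-- Every list of digits without superfluous leading zeros is a binary expansion. -/
theorem exists_encodeNat (l : List Bool) (h : ∀ b ∈ l.getLast?, b = true) :
    ∃ m, Computability.encodeNat m = l := by
  rcases hl : l.getLast? with _ | b
  · exact ⟨0, (List.getLast?_eq_none_iff.1 hl).symm⟩
  · obtain ⟨p, hp⟩ := exists_encodePosNum l (by rw [hl, h b hl])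
    refine ⟨p, ?_⟩
    unfold Computability.encodeNat
    rw [PosNum.of_to_nat]
    exact hp

theorem VarLength.exists_occ {i u : ℕ} (hi : x[i]? = some .var) (h : VarLength x i u) :
    ∃ m, Occ x i (.var m) (i + 1 + u) := by
  have hb : ∀ a : Fin u, ∃ b, x[i + 1 + a]? = some (.bit b) := fun a => h.isBit a a.2
  choose b hb using hb
  obtain ⟨m, hm⟩ := exists_encodeNat (List.ofFn b) (by
    intro c hc
    rcases u with _ | u
    · simp at hc
    · have h₁ := h.last u rfl
      have h₂ := hb (Fin.last u)
      rw [Fin.val_last, h₁] at h₂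
      rw [List.getLast?_eq_getElem?, List.length_ofFn, Nat.add_sub_cancel,
        List.getElem?_eq_getElem (by simp), List.getElem_ofFn] at hc
      simp only [Option.mem_def, Option.some.injEq] at hc
      simp only [Option.some.injEq, Token.bit.injEq] at h₂
      rw [← hc, h₂]
      rfl)
  have hl : (Computability.encodeNat m).length = u := by rw [hm, List.length_ofFn]
  refine ⟨m, ?_⟩
  have := Occ.var (m := m) hi (hl.symm ▸ h) fun a ha => by
    have : a < u := hl ▸ ha
    rw [hb ⟨a, this⟩]
    simp only [hm, List.getElem?_ofFn, this, dite_true]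
    rfl
  rwa [hl] at this

theorem SameDigits.varLength {i j : ℕ} (h : SameDigits x i j) (hj : x[j]? = some .var) :
    ∃ u, VarLength x i u ∧ VarLength x j u ∧ ∀ a < u, x[i + 1 + a]? = x[j + 1 + a]? := by
  obtain ⟨u, hu, hn, hs⟩ := h
  refine ⟨u, hu, ⟨?_, hn, fun a ha => hs a ha ▸ hu.isBit a ha, fun a ha => ?_⟩, hs⟩
  · rcases u with _ | u
    · exact (List.getElem?_eq_some_iff.1 hj).1
    · obtain ⟨b, hb⟩ := hu.isBit u (Nat.lt_succ_self u)
      rw [hs u (Nat.lt_succ_self u)] at hb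
      have := (List.getElem?_eq_some_iff.1 hb).1
      omega
  · rw [← hs a (by omega)]; exact hu.last a ha

theorem SameDigits.occ {i j e m : ℕ} (h : SameDigits x i j) (hi : Occ x i (.var m) e)
    (hj : x[j]? = some .var) : ∃ e', Occ x j (.var m) e' := by
  obtain ⟨u, hu, hu', hs⟩ := h.varLength hj
  cases hi with
  | var hi hv hd =>
    obtain rfl := hu.unique hv
    exact ⟨_, Occ.var hj hu' fun a ha => by rw [← hs a ha, hd a ha]⟩

theorem SameDigits.exists_occ {i j : ℕ} (h : SameDigits x i j) (hi : x[i]? = some .var)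
    (hj : x[j]? = some .var) :
    ∃ m, (∃ e, Occ x i (.var m) e) ∧ ∃ e, Occ x j (.var m) e := by
  obtain ⟨u, hu, -⟩ := id h
  obtain ⟨m, hm⟩ := hu.exists_occ hi
  exact ⟨m, ⟨_, hm⟩, h.occ hm hj⟩

theorem Occ.sameDigits {i j e e' m : ℕ} (h : Occ x i (.var m) e) (h' : Occ x j (.var m) e') :
    SameDigits x i j := by
  cases h with
  | var hi hu hd =>
    cases h' with
    | var hj hu' hd' => exact ⟨_, hu, hu'.not_isBit, fun c hc => by rw [hd c hc, hd' c hc]⟩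

theorem Occ.getElem?_var {i e m : ℕ} (h : Occ x i (.var m) e) : x[i]? = some .var := by
  cases h; assumption

theorem encode_head? (φ : Formula) (l : List Token) : ¬IsBit (φ.encode ++ l).head? := by
  rintro ⟨b, hb⟩
  cases φ <;> simp [Formula.encode] at hb

theorem occ_of_encode (φ : Formula) : ∀ l r : List Token, ¬IsBit r.head? →
    Occ (l ++ φ.encode ++ r) l.length φ (l.length + φ.encode.length) := by
  induction φ with
  | var m =>
    intro l r hr
    set d := Computability.encodeNat m with hd
    have hx : ∀ a, (l ++ (Formula.var m).encode ++ r)[l.length + 1 + a]? =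
        (d.map Token.bit ++ r)[a]? := by
      intro a
      rw [Formula.encode, List.append_assoc, List.getElem?_append_right (by omega),
        show l.length + 1 + a - l.length = a + 1 by omega]
      rfl
    have hlt : ∀ a < d.length, (l ++ (Formula.var m).encode ++ r)[l.length + 1 + a]? =
        d[a]?.map Token.bit := by
      intro a ha
      rw [hx, List.getElem?_append_left (by simpa using ha), List.getElem?_map]
    have h := Occ.var (x := l ++ (Formula.var m).encode ++ r) (i := l.length) (m := m)
      (by simp [Formula.encode]) ⟨?_, ?_, ?_, ?_⟩ hlt
    · rw [show l.length + (Formula.var m).encode.length = l.length + 1 + d.length by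
        simp [Formula.encode, ← hd]; omega]
      exact h
    · simp only [Formula.encode, List.length_append, List.length_cons, List.length_map, ← hd]; omega
    · rw [hx, List.getElem?_append_right (by simp [← hd])]
      simpa [← hd, List.head?_eq_getElem?] using hr
    · intro a ha
      rw [hlt a ha, List.getElem?_eq_getElem ha]
      exact ⟨_, rfl⟩
    · intro a ha
      have had : a < d.length := by rw [hd]; omega
      rw [hlt a had]
      have h₁ := encodeNat_getLast? m d[a] (by
        rw [List.getLast?_eq_getElem?, ← hd, ← ha, Nat.add_sub_cancel,
          List.getElem?_eq_getElem had]
        rfl)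
      rw [List.getElem?_eq_getElem had, h₁]
      rfl
  | top => exact fun l r _ => Occ.top (by simp [Formula.encode])
  | bot => exact fun l r _ => Occ.bot (by simp [Formula.encode])
  | and φ ψ ihφ ihψ =>
    intro l r hr
    have h₁ := ihφ (l ++ [.and]) (ψ.encode ++ r) (encode_head? ψ r)
    have h₂ := ihψ (l ++ [.and] ++ φ.encode) r hr
    have e : l ++ [.and] ++ φ.encode ++ (ψ.encode ++ r) = l ++ (Formula.and φ ψ).encode ++ r := by
      simp [Formula.encode]
    have e' : l ++ [.and] ++ φ.encode ++ ψ.encode ++ r = l ++ (Formula.and φ ψ).encode ++ r := by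
      simp [Formula.encode]
    rw [e] at h₁
    rw [e', List.length_append] at h₂
    have h₀ : (l ++ (Formula.and φ ψ).encode ++ r)[l.length]? = some .and := by
      simp [Formula.encode]
    rw [List.length_append, List.length_singleton] at h₁ h₂
    rw [show l.length + (Formula.and φ ψ).encode.length =
      l.length + 1 + φ.encode.length + ψ.encode.length by
        simp only [Formula.encode, List.length_append, List.length_cons]; omega]
    exact Occ.and h₀ h₁ h₂
  | or φ ψ ihφ ihψ =>
    intro l r hr
    have h₁ := ihφ (l ++ [.or]) (ψ.encode ++ r) (encode_head? ψ r)
    have h₂ := ihψ (l ++ [.or] ++ φ.encode) r hr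
    have e : l ++ [.or] ++ φ.encode ++ (ψ.encode ++ r) = l ++ (Formula.or φ ψ).encode ++ r := by
      simp [Formula.encode]
    have e' : l ++ [.or] ++ φ.encode ++ ψ.encode ++ r = l ++ (Formula.or φ ψ).encode ++ r := by
      simp [Formula.encode]
    rw [e] at h₁
    rw [e', List.length_append] at h₂
    have h₀ : (l ++ (Formula.or φ ψ).encode ++ r)[l.length]? = some .or := by
      simp [Formula.encode]
    rw [List.length_append, List.length_singleton] at h₁ h₂
    rw [show l.length + (Formula.or φ ψ).encode.length =
      l.length + 1 + φ.encode.length + ψ.encode.length by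
        simp only [Formula.encode, List.length_append, List.length_cons]; omega]
    exact Occ.or h₀ h₁ h₂
  | neg φ ih =>
    intro l r hr
    have h₁ := ih (l ++ [.neg]) r hr
    have e : l ++ [.neg] ++ φ.encode ++ r = l ++ (Formula.neg φ).encode ++ r := by
      simp [Formula.encode]
    rw [e] at h₁
    have h₀ : (l ++ (Formula.neg φ).encode ++ r)[l.length]? = some .neg := by
      simp [Formula.encode]
    rw [List.length_append, List.length_singleton] at h₁
    rw [show l.length + (Formula.neg φ).encode.length = l.length + 1 + φ.encode.length by
        simp only [Formula.encode, List.length_cons]; omega]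
    exact Occ.neg h₀ h₁

theorem occ_encodeEntailment (φ ψ : Formula) : ∃ e, Occ (encodeEntailment φ ψ) 0 φ e ∧
    (encodeEntailment φ ψ)[e]? = some .entails ∧
    Occ (encodeEntailment φ ψ) (e + 1) ψ (encodeEntailment φ ψ).length := by
  refine ⟨φ.encode.length, ?_, ?_, ?_⟩
  · have := occ_of_encode φ [] (.entails :: ψ.encode) (by simp [IsBit])
    simpa [encodeEntailment] using this
  · simp [encodeEntailment]
  · have := occ_of_encode ψ (φ.encode ++ [.entails]) [] (by simp [IsBit])
    simpa [encodeEntailment, add_assoc, add_comm, add_left_comm] using this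

theorem eq_encodeEntailment {e : ℕ} {φ ψ : Formula} (h₁ : Occ x 0 φ e) (h₂ : x[e]? = some .entails)
    (h₃ : Occ x (e + 1) ψ x.length) : x = encodeEntailment φ ψ := by
  have := h₁.drop
  rw [List.drop_zero, drop_eq_cons h₂, h₃.drop, List.drop_length, List.append_nil] at this
  exact this

end CQL

/-! ### Certificates -/

namespace CQL

/-- A row of a certificate: a labelling of the positions of the word by three values. -/
abbrev Row : Type := ℕ → Option Bool

/-- The kinds of rows. A row of kind `span` marks the first position of a subformula by `true` and
the position behind it by `false`; a row of kind `stuck` marks by `true` a position at which no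
formula starts. The other rows are the points of a countermodel and assign truth values to the
first positions of subformulas: the rows of kind `point` form an orthoframe, and those of the
kinds `root` and `leaf` form a Kripke frame in which all leaves lie above all roots. -/
inductive RowKind : Type
  | span
  | stuck
  | point
  | root
  | leaf
  deriving DecidableEq

instance : Fintype RowKind := ⟨{.span, .stuck, .point, .root, .leaf}, fun k => by cases k <;> simp⟩

/-- Some row in `S` says that a subformula stands between the positions `i` and `e`. -/
def SpanIn (S : Set Row) (i e : ℕ) : Prop := ∃ f ∈ S, f i = some true ∧ f e = some false

/-- Some row in `S` marks the position `i`. -/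
def MarkIn (S : Set Row) (i : ℕ) : Prop := ∃ f ∈ S, f i = some true

/-- The claim that a formula stands between `i` and `e` follows from such claims `P` about later
positions. -/
def SpanStep (x : List Token) (P : ℕ → ℕ → Prop) (i e : ℕ) : Prop :=
  ((x[i]? = some .top ∨ x[i]? = some .bot) ∧ e = i + 1) ∨
  (x[i]? = some .neg ∧ P (i + 1) e) ∨
  ((x[i]? = some .and ∨ x[i]? = some .or) ∧ ∃ k ≤ x.length, P (i + 1) k ∧ P k e) ∨
  (x[i]? = some .var ∧ ∃ u, VarLength x i u ∧ e = i + 1 + u)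

/-- The claim that no formula starts at `i` follows from such claims `N` about later positions and
from claims `P` as before. -/
def StuckStep (x : List Token) (P : ℕ → ℕ → Prop) (N : ℕ → Prop) (i : ℕ) : Prop :=
  (x[i]? = none ∨ IsBit x[i]? ∨ x[i]? = some .entails) ∨
  (x[i]? = some .neg ∧ N (i + 1)) ∨
  ((x[i]? = some .and ∨ x[i]? = some .or) ∧
    (N (i + 1) ∨ ∃ k ≤ x.length, P (i + 1) k ∧ N k)) ∨
  (x[i]? = some .var ∧ ¬∃ u, VarLength x i u)

/-- The word is not an entailment, according to the claims `P` and `N`. -/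
def Illformed (x : List Token) (P : ℕ → ℕ → Prop) (N : ℕ → Prop) : Prop :=
  N 0 ∨ ∃ e ≤ x.length, P 0 e ∧
    (x[e]? ≠ some .entails ∨ N (e + 1) ∨ ∃ e' ≤ x.length, P (e + 1) e' ∧ x[e']? ≠ none)

/-- Two rows conflict, that is, they are orthogonal, if one of them affirms and the other one denies
some subformula. -/
def Conflict (n : ℕ) (f g : Row) : Prop :=
  ∃ j ≤ n, (f j = some true ∧ g j = some false) ∨ (f j = some false ∧ g j = some true)

/-- The rows in `S` form an orthoframe that refutes the entailment. At each row, a subformula is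
affirmed or denied if it belongs to the row, or to all rows orthogonal to it. -/
structure OrthoModel (x : List Token) (P : ℕ → ℕ → Prop) (S : Set Row) : Prop where
  exists_point : ∀ i ≤ x.length, ∀ e ≤ x.length, P i e → ∀ f ∈ S, ∀ b : Bool,
    f i ≠ some (!b) → ∃ g ∈ S, g i = some b ∧ ¬Conflict x.length f g
  top : ∀ i ≤ x.length, x[i]? = some .top → ∀ f ∈ S, f i = some true
  bot : ∀ i ≤ x.length, x[i]? = some .bot → ∀ f ∈ S, f i = some false
  neg : ∀ i ≤ x.length, ∀ e ≤ x.length, x[i]? = some .neg → P (i + 1) e → ∀ f ∈ S,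
    (f i = some true ↔ f (i + 1) = some false)
  and : ∀ i ≤ x.length, ∀ k ≤ x.length, ∀ e ≤ x.length, x[i]? = some .and → P (i + 1) k → P k e →
    ∀ f ∈ S, (f i = some true ↔ f (i + 1) = some true ∧ f k = some true)
  or : ∀ i ≤ x.length, ∀ k ≤ x.length, ∀ e ≤ x.length, x[i]? = some .or → P (i + 1) k → P k e →
    ∀ f ∈ S, (f i = some false ↔ f (i + 1) = some false ∧ f k = some false)
  var : ∀ i ≤ x.length, ∀ j ≤ x.length, x[i]? = some .var → x[j]? = some .var → SameDigits x i j →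
    ∀ f ∈ S, ∀ b : Bool, f i = some b → f j = some b
  refutes : ∃ e ≤ x.length, P 0 e ∧ (∃ e' ≤ x.length, P (e + 1) e') ∧
    ∃ f ∈ S, f 0 = some true ∧ f (e + 1) ≠ some true

/-- The rows in `R` and `S` are the roots and the leaves of a Kripke model that refutes the
entailment. -/
structure FanModel (x : List Token) (P : ℕ → ℕ → Prop) (R S : Set Row) : Prop where
  top : ∀ i ≤ x.length, x[i]? = some .top → ∀ f ∈ R ∪ S, f i = some true
  bot : ∀ i ≤ x.length, x[i]? = some .bot → ∀ f ∈ R ∪ S, f i ≠ some true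
  and : ∀ i ≤ x.length, ∀ k ≤ x.length, ∀ e ≤ x.length, x[i]? = some .and → P (i + 1) k → P k e →
    ∀ f ∈ R ∪ S, (f i = some true ↔ f (i + 1) = some true ∧ f k = some true)
  or : ∀ i ≤ x.length, ∀ k ≤ x.length, ∀ e ≤ x.length, x[i]? = some .or → P (i + 1) k → P k e →
    ∀ f ∈ R ∪ S, (f i = some true ↔ f (i + 1) = some true ∨ f k = some true)
  neg_leaf : ∀ i ≤ x.length, ∀ e ≤ x.length, x[i]? = some .neg → P (i + 1) e → ∀ f ∈ S,
    (f i = some true ↔ f (i + 1) ≠ some true)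
  neg_root : ∀ i ≤ x.length, ∀ e ≤ x.length, x[i]? = some .neg → P (i + 1) e → ∀ f ∈ R,
    (f i = some true ↔ f (i + 1) ≠ some true ∧ ∀ g ∈ S, g (i + 1) ≠ some true)
  var : ∀ i ≤ x.length, ∀ j ≤ x.length, x[i]? = some .var → x[j]? = some .var → SameDigits x i j →
    ∀ f ∈ R ∪ S, f i = some true → f j = some true
  mono : ∀ i ≤ x.length, ∀ e ≤ x.length, x[i]? = some .var → P i e → ∀ f ∈ R, f i = some true →
    ∀ g ∈ S, g i = some true
  refutes : ∃ e ≤ x.length, P 0 e ∧ (∃ e' ≤ x.length, P (e + 1) e') ∧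
    ∃ f ∈ R, f 0 = some true ∧ f (e + 1) ≠ some true

/-- The rows certify that the word does not encode an entailment that belongs to Ex-logic. -/
def Certifies (x : List Token) (rows : RowKind → Set Row) : Prop :=
  (∀ i ≤ x.length, ∀ e ≤ x.length, SpanIn (rows .span) i e →
    SpanStep x (SpanIn (rows .span)) i e) ∧
  (((∀ i ≤ x.length, MarkIn (rows .stuck) i →
      StuckStep x (SpanIn (rows .span)) (MarkIn (rows .stuck)) i) ∧
    Illformed x (SpanIn (rows .span)) (MarkIn (rows .stuck))) ∨
  OrthoModel x (SpanIn (rows .span)) (rows .point) ∨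
  FanModel x (SpanIn (rows .span)) (rows .root) (rows .leaf))

/-! ### Soundness of certificates -/

section Soundness

variable {x : List Token} {P : ℕ → ℕ → Prop} {N : ℕ → Prop}

theorem lt_length_of_getElem? {i : ℕ} {t : Token} (h : x[i]? = some t) : i < x.length :=
  (List.getElem?_eq_some_iff.1 h).1

/-- Claims about subformulas that are justified by such claims are true, because the justification
refers to later positions only. -/
theorem exists_occ_of_span (hP : ∀ i ≤ x.length, ∀ e ≤ x.length, P i e → SpanStep x P i e) :
    ∀ d i e, i + d = x.length → e ≤ x.length → P i e → ∃ φ, Occ x i φ e := by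
  intro d
  induction d using Nat.strong_induction_on with
  | _ d ih =>
    intro i e hi he h
    rcases hP i (by omega) e he h with ⟨ht | ht, rfl⟩ | ⟨h, h'⟩ | ⟨h, k, hk, h₁, h₂⟩ | ⟨ht, u, hu, rfl⟩
    · exact ⟨_, Occ.top ht⟩
    · exact ⟨_, Occ.bot ht⟩
    · have := lt_length_of_getElem? h
      obtain ⟨φ, hφ⟩ := ih (d - 1) (by omega) (i + 1) e (by omega) he h'
      exact ⟨_, Occ.neg h hφ⟩
    · have : i < x.length := h.elim lt_length_of_getElem? lt_length_of_getElem?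
      obtain ⟨φ, hφ⟩ := ih (d - 1) (by omega) (i + 1) k (by omega) hk h₁
      have := hφ.lt
      obtain ⟨ψ, hψ⟩ := ih (x.length - k) (by omega) k e (by omega) he h₂
      exact h.elim (fun h => ⟨_, Occ.and h hφ hψ⟩) fun h => ⟨_, Occ.or h hφ hψ⟩
    · obtain ⟨m, hm⟩ := hu.exists_occ ht
      exact ⟨_, hm⟩

/-- No formula starts at a position for which this is claimed, if the claims are justified. -/
theorem not_occ_of_stuck (hP : ∀ i ≤ x.length, ∀ e ≤ x.length, P i e → ∃ φ, Occ x i φ e)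
    (hN : ∀ i ≤ x.length, N i → StuckStep x P N i) {i e : ℕ} {φ : Formula} (hi : i ≤ x.length)
    (h : Occ x i φ e) : ¬N i := by
  induction h with
  | @var i m ht hu hd =>
    intro h
    rcases hN _ hi h with (h | h | h) | ⟨h, -⟩ | ⟨h, -⟩ | ⟨-, h⟩
    all_goals try simp_all [IsBit]
  | top ht => intro h; rcases hN _ hi h with h | ⟨h, -⟩ | ⟨h, -⟩ | ⟨h, -⟩ <;> simp_all [IsBit]
  | bot ht => intro h; rcases hN _ hi h with h | ⟨h, -⟩ | ⟨h, -⟩ | ⟨h, -⟩ <;> simp_all [IsBit]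
  | neg ht hφ ih =>
    intro h
    rcases hN _ hi h with h | ⟨-, h⟩ | ⟨h, -⟩ | ⟨h, -⟩
    · simp_all [IsBit]
    · exact ih (lt_length_of_getElem? ht) h
    · simp_all
    · simp_all
  | and ht hφ hψ ihφ ihψ =>
    intro h
    rcases hN _ hi h with h | ⟨h, -⟩ | ⟨-, h | ⟨k, hk, h₁, h₂⟩⟩ | ⟨h, -⟩
    · simp_all [IsBit]
    · simp_all
    · exact ihφ (lt_length_of_getElem? ht) h
    · obtain ⟨χ, hχ⟩ := hP _ (lt_length_of_getElem? ht) _ hk h₁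
      obtain ⟨-, rfl⟩ := hφ.unique hχ
      exact ihψ hk h₂
    · simp_all
  | or ht hφ hψ ihφ ihψ =>
    intro h
    rcases hN _ hi h with h | ⟨h, -⟩ | ⟨-, h | ⟨k, hk, h₁, h₂⟩⟩ | ⟨h, -⟩
    · simp_all [IsBit]
    · simp_all
    · exact ihφ (lt_length_of_getElem? ht) h
    · obtain ⟨χ, hχ⟩ := hP _ (lt_length_of_getElem? ht) _ hk h₁
      obtain ⟨-, rfl⟩ := hφ.unique hχ
      exact ihψ hk h₂
    · simp_all

theorem not_illformed (hP : ∀ i ≤ x.length, ∀ e ≤ x.length, P i e → ∃ φ, Occ x i φ e)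
    (hN : ∀ i ≤ x.length, N i → StuckStep x P N i) {e : ℕ} {φ ψ : Formula} (h₁ : Occ x 0 φ e)
    (h₂ : x[e]? = some .entails) (h₃ : Occ x (e + 1) ψ x.length) : ¬Illformed x P N := by
  rintro (h | ⟨e', he', h, h'⟩)
  · exact not_occ_of_stuck hP hN (Nat.zero_le _) h₁ h
  · obtain ⟨χ, hχ⟩ := hP _ (Nat.zero_le _) _ he' h
    obtain ⟨-, rfl⟩ := h₁.unique hχ
    rcases h' with h' | h' | ⟨e', he', h', h''⟩
    · exact h' h₂
    · exact not_occ_of_stuck hP hN (lt_length_of_getElem? h₂) h₃ h'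
    · obtain ⟨χ, hχ⟩ := hP _ (lt_length_of_getElem? h₂) _ he' h'
      obtain ⟨-, rfl⟩ := h₃.unique hχ
      exact h'' (by simp)

/-- In the claims `P`, the immediate subformulas of a conjunction or disjunction appear. -/
theorem span_children (hP : ∀ i ≤ x.length, ∀ e ≤ x.length, P i e → SpanStep x P i e)
    (hP' : ∀ i ≤ x.length, ∀ e ≤ x.length, P i e → ∃ φ, Occ x i φ e) {i k e : ℕ} {φ ψ : Formula}
    (ht : x[i]? = some .and ∨ x[i]? = some .or) (hφ : Occ x (i + 1) φ k) (hψ : Occ x k ψ e)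
    (h : P i e) : P (i + 1) k ∧ P k e := by
  have hi : i < x.length := ht.elim lt_length_of_getElem? lt_length_of_getElem?
  rcases hP i hi.le e hψ.le_length h with ⟨h | h, -⟩ | ⟨h, -⟩ | ⟨-, k', hk, h₁, h₂⟩ | ⟨h, -⟩
  · rcases ht with ht | ht <;> simp_all
  · rcases ht with ht | ht <;> simp_all
  · rcases ht with ht | ht <;> simp_all
  · obtain ⟨χ, hχ⟩ := hP' _ hi _ hk h₁
    obtain ⟨-, rfl⟩ := hφ.unique hχ
    exact ⟨h₁, h₂⟩
  · rcases ht with ht | ht <;> simp_all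

theorem span_child_neg (hP : ∀ i ≤ x.length, ∀ e ≤ x.length, P i e → SpanStep x P i e) {i e : ℕ}
    (ht : x[i]? = some .neg) (he : e ≤ x.length) (h : P i e) : P (i + 1) e := by
  rcases hP i (lt_length_of_getElem? ht).le e he h with ⟨h | h, -⟩ | ⟨h, h'⟩ | ⟨h | h, -⟩ | ⟨h, -⟩
  all_goals first | exact h' | simp_all

theorem conflict_comm {n : ℕ} {f g : Row} (h : Conflict n f g) : Conflict n g f :=
  let ⟨j, hj, h⟩ := h
  ⟨j, hj, h.symm.imp And.symm And.symm⟩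

theorem not_conflict_self {n : ℕ} {f : Row} : ¬Conflict n f f := by
  rintro ⟨j, -, ⟨h, h'⟩ | ⟨h, h'⟩⟩ <;> simp [h] at h'

/-- Orthoframes refute: the truth values in the rows are those of subformulas in the ortholattice of
the orthoframe. -/
theorem OrthoModel.not_exLogic {S : Set Row} (hM : OrthoModel x P S)
    (hP : ∀ i ≤ x.length, ∀ e ≤ x.length, P i e → SpanStep x P i e)
    (hP' : ∀ i ≤ x.length, ∀ e ≤ x.length, P i e → ∃ φ, Occ x i φ e) {e : ℕ} {φ ψ : Formula}
    (h₁ : Occ x 0 φ e) (h₂ : x[e]? = some .entails) (h₃ : Occ x (e + 1) ψ x.length) :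
    ¬ExLogic φ ψ := by
  intro hex
  let C : S → S → Prop := fun f g => Conflict x.length f g
  have hC : ∀ f g, C f g → C g f := fun _ _ => conflict_comm
  have hC' : ∀ f, ¬C f f := fun _ => not_conflict_self
  -- The rows that affirm a subformula and those that deny it are orthogonal complements.
  have perp_eq : ∀ i ≤ x.length, ∀ e ≤ x.length, P i e → ∀ b : Bool,
      perp C {f : S | f.1 i = some b} = {f : S | f.1 i = some (!b)} := by
    intro i hi e he h b
    ext f
    constructor
    · intro hf
      by_contra hne
      obtain ⟨g, hg, hgi, hfg⟩ := hM.exists_point i hi e he h f f.2 b hne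
      exact hfg (hf ⟨g, hg⟩ hgi)
    · intro hf g hg
      refine ⟨i, hi, ?_⟩
      cases b
      · exact Or.inl ⟨hf, hg⟩
      · exact Or.inr ⟨hf, hg⟩
  have perp_false : ∀ i ≤ x.length, ∀ e ≤ x.length, P i e →
      perp C {f : S | f.1 i = some false} = {f : S | f.1 i = some true} :=
    fun i hi e he h => perp_eq i hi e he h false
  have perp_true : ∀ i ≤ x.length, ∀ e ≤ x.length, P i e →
      perp C {f : S | f.1 i = some true} = {f : S | f.1 i = some false} :=
    fun i hi e he h => perp_eq i hi e he h true
  -- The closure is redundant for variables that occur, and yields the empty set for the others.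
  let v : ℕ → Set S := fun m => perp C (perp C
    {f : S | ∃ i e, P i e ∧ Occ x i (.var m) e ∧ f.1 i = some true})
  have hv : ∀ m, perp C (perp C (v m)) = v m := fun m => perp_perp_perp hC _
  have truth : ∀ i e χ, Occ x i χ e → P i e → orthoEval C v χ = {f : S | f.1 i = some true} := by
    intro i e χ ho
    induction ho with
    | @var i m ht hu hd =>
      intro h
      have hocc := Occ.var ht hu hd
      have : {f : S | ∃ i e, P i e ∧ Occ x i (.var m) e ∧ f.1 i = some true} =
          {f : S | f.1 i = some true} := by
        ext f
        constructor
        · rintro ⟨j, e, hj, ho, hf⟩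
          exact hM.var j (lt_length_of_getElem? ho.getElem?_var).le i (lt_length_of_getElem? ht).le
            ho.getElem?_var ht (ho.sameDigits hocc) f f.2 true hf
        · exact fun hf => ⟨i, _, h, hocc, hf⟩
      change perp C (perp C _) = _
      have hi := (lt_length_of_getElem? ht).le
      rw [this, perp_true i hi _ hocc.le_length h, perp_false i hi _ hocc.le_length h]
    | top ht =>
      intro h
      symm
      exact Set.eq_univ_of_forall fun f => hM.top _ (lt_length_of_getElem? ht).le ht f f.2
    | bot ht =>
      intro h
      symm
      refine Set.eq_empty_of_forall_notMem fun f hf => ?_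
      rw [Set.mem_ofPred_eq, hM.bot _ (lt_length_of_getElem? ht).le ht f f.2] at hf
      simp at hf
    | @and i k e φ ψ ht hφ hψ ihφ ihψ =>
      intro h
      obtain ⟨h₁, h₂⟩ := span_children hP hP' (Or.inl ht) hφ hψ h
      change orthoEval C v φ ∩ orthoEval C v ψ = _
      rw [ihφ h₁, ihψ h₂]
      ext f
      exact (hM.and i (lt_length_of_getElem? ht).le k hφ.le_length e hψ.le_length ht h₁ h₂ f
        f.2).symm
    | @or i k e φ ψ ht hφ hψ ihφ ihψ =>
      intro h
      obtain ⟨h₁, h₂⟩ := span_children hP hP' (Or.inr ht) hφ hψ h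
      have hi := lt_length_of_getElem? ht
      change perp C (perp C (orthoEval C v φ) ∩ perp C (orthoEval C v ψ)) = _
      rw [ihφ h₁, ihψ h₂, perp_true _ hi _ hφ.le_length h₁,
        perp_true _ hφ.le_length _ hψ.le_length h₂, ← perp_false i hi.le e hψ.le_length h]
      congr 1
      ext f
      exact (hM.or i hi.le k hφ.le_length e hψ.le_length ht h₁ h₂ f f.2).symm
    | @neg i e φ ht hφ ihφ =>
      intro h
      have h₁ := span_child_neg hP ht hφ.le_length h
      have hi := lt_length_of_getElem? ht
      change perp C (orthoEval C v φ) = _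
      rw [ihφ h₁, perp_true _ hi _ hφ.le_length h₁]
      ext f
      exact (hM.neg i hi.le e hφ.le_length ht h₁ f f.2).symm
  obtain ⟨e', he', h₄, ⟨e'', he'', h₅⟩, f, hf, hf₁, hf₂⟩ := hM.refutes
  obtain ⟨χ, hχ⟩ := hP' _ (Nat.zero_le _) _ he' h₄
  obtain ⟨-, rfl⟩ := h₁.unique hχ
  obtain ⟨χ', hχ'⟩ := hP' _ (lt_length_of_getElem? h₂) _ he'' h₅
  obtain ⟨-, rfl⟩ := h₃.unique hχ'
  have := hex.orthoEval_subset hC hC' hv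
  rw [truth _ _ _ h₁ h₄, truth _ _ _ h₃ h₅] at this
  exact hf₂ (this (a := ⟨f, hf⟩) hf₁)

/-- Kripke frames refute: the truth values in the rows are those of subformulas under intuitionistic
forcing. -/
theorem FanModel.not_exLogic {R S : Set Row} (hM : FanModel x P R S)
    (hP : ∀ i ≤ x.length, ∀ e ≤ x.length, P i e → SpanStep x P i e)
    (hP' : ∀ i ≤ x.length, ∀ e ≤ x.length, P i e → ∃ φ, Occ x i φ e) {e : ℕ} {φ ψ : Formula}
    (h₁ : Occ x 0 φ e) (h₂ : x[e]? = some .entails) (h₃ : Occ x (e + 1) ψ x.length) :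
    ¬ExLogic φ ψ := by
  intro hex
  let row : R ⊕ S → Row := Sum.elim Subtype.val Subtype.val
  have hrow : ∀ p, row p ∈ R ∪ S := by
    rintro (p | p)
    · exact Or.inl p.2
    · exact Or.inr p.2
  let r : R ⊕ S → R ⊕ S → Prop := fun p q => p = q ∨ (p.isLeft = true ∧ q.isRight = true)
  have hr : ∀ p, r p p := fun _ => Or.inl rfl
  have hr' : ∀ p q s, r p q → r q s → r p s := by
    rintro p q s (rfl | h) h'
    · exact h'
    · rcases h' with rfl | h'
      · exact Or.inr h
      · exact Or.inr ⟨h.1, h'.2⟩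
  let v : R ⊕ S → ℕ → Prop := fun p m => ∃ i e, P i e ∧ Occ x i (.var m) e ∧ row p i = some true
  have hv : ∀ p q m, r p q → v p m → v q m := by
    rintro p q m (rfl | ⟨hp, hq⟩) ⟨i, e, h, ho, hf⟩
    · exact ⟨i, e, h, ho, hf⟩
    · obtain ⟨f, rfl⟩ := Sum.isLeft_iff.1 hp
      obtain ⟨g, rfl⟩ := Sum.isRight_iff.1 hq
      exact ⟨i, e, h, ho, hM.mono i (lt_length_of_getElem? ho.getElem?_var).le e ho.le_length
        ho.getElem?_var h f f.2 hf g g.2⟩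
  have truth : ∀ i e χ, Occ x i χ e → P i e → ∀ p, Forces r v χ p ↔ row p i = some true := by
    intro i e χ ho
    induction ho with
    | @var i m ht hu hd =>
      intro h p
      have hocc := Occ.var ht hu hd
      constructor
      · rintro ⟨j, e, hj, ho, hf⟩
        exact hM.var j (lt_length_of_getElem? ho.getElem?_var).le i (lt_length_of_getElem? ht).le
          ho.getElem?_var ht (ho.sameDigits hocc) _ (hrow p) hf
      · exact fun hf => ⟨i, _, h, hocc, hf⟩
    | top ht =>
      exact fun h p => iff_of_true trivial
        (hM.top _ (lt_length_of_getElem? ht).le ht _ (hrow p))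
    | bot ht =>
      exact fun h p => iff_of_false id (hM.bot _ (lt_length_of_getElem? ht).le ht _ (hrow p))
    | @and i k e φ ψ ht hφ hψ ihφ ihψ =>
      intro h p
      obtain ⟨h₁, h₂⟩ := span_children hP hP' (Or.inl ht) hφ hψ h
      exact (and_congr (ihφ h₁ p) (ihψ h₂ p)).trans (hM.and i (lt_length_of_getElem? ht).le k
        hφ.le_length e hψ.le_length ht h₁ h₂ _ (hrow p)).symm
    | @or i k e φ ψ ht hφ hψ ihφ ihψ =>
      intro h p
      obtain ⟨h₁, h₂⟩ := span_children hP hP' (Or.inr ht) hφ hψ h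
      exact (or_congr (ihφ h₁ p) (ihψ h₂ p)).trans (hM.or i (lt_length_of_getElem? ht).le k
        hφ.le_length e hψ.le_length ht h₁ h₂ _ (hrow p)).symm
    | @neg i e φ ht hφ ihφ =>
      intro h p
      have h₁ := span_child_neg hP ht hφ.le_length h
      have hi := (lt_length_of_getElem? ht).le
      have ih := ihφ h₁
      rcases p with f | f
      · refine Iff.trans ?_ (hM.neg_root i hi e hφ.le_length ht h₁ f f.2).symm
        constructor
        · intro H
          exact ⟨fun hf => H _ (hr _) ((ih _).2 hf), fun g hg hgi =>
            H (Sum.inr ⟨g, hg⟩) (Or.inr ⟨rfl, rfl⟩) ((ih _).2 hgi)⟩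
        · rintro ⟨H, H'⟩ q (rfl | ⟨-, hq⟩) hφq
          · exact H ((ih _).1 hφq)
          · obtain ⟨g, rfl⟩ := Sum.isRight_iff.1 hq
            exact H' g g.2 ((ih _).1 hφq)
      · refine Iff.trans ?_ (hM.neg_leaf i hi e hφ.le_length ht h₁ f f.2).symm
        constructor
        · exact fun H hf => H _ (hr _) ((ih _).2 hf)
        · rintro H q (rfl | ⟨hq, -⟩) hφq
          · exact H ((ih _).1 hφq)
          · simp at hq
  obtain ⟨e', he', h₄, ⟨e'', he'', h₅⟩, f, hf, hf₁, hf₂⟩ := hM.refutes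
  obtain ⟨χ, hχ⟩ := hP' _ (Nat.zero_le _) _ he' h₄
  obtain ⟨-, rfl⟩ := h₁.unique hχ
  obtain ⟨χ', hχ'⟩ := hP' _ (lt_length_of_getElem? h₂) _ he'' h₅
  obtain ⟨-, rfl⟩ := h₃.unique hχ'
  have := hex.forces hr hr' hv (Sum.inl ⟨f, hf⟩)
  rw [truth _ _ _ h₁ h₄, truth _ _ _ h₃ h₅] at this
  exact hf₂ (this hf₁)

/-- Soundness of certificates. -/
theorem Certifies.not_exLogic {rows : RowKind → Set Row} {φ ψ : Formula}
    (h : Certifies (encodeEntailment φ ψ) rows) : ¬ExLogic φ ψ := by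
  obtain ⟨e, h₁, h₂, h₃⟩ := occ_encodeEntailment φ ψ
  obtain ⟨hP, h⟩ := h
  have hP' : ∀ i ≤ (encodeEntailment φ ψ).length, ∀ e ≤ (encodeEntailment φ ψ).length,
      SpanIn (rows .span) i e → ∃ φ', Occ (encodeEntailment φ ψ) i φ' e := fun i hi e he h =>
    exists_occ_of_span hP _ i e (Nat.add_sub_cancel' hi) he h
  rcases h with ⟨hN, h⟩ | h | h
  · exact absurd h (not_illformed hP' hN h₁ h₂ h₃)
  · exact h.not_exLogic hP hP' h₁ h₂ h₃
  · exact h.not_exLogic hP hP' h₁ h₂ h₃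

end Soundness

end CQL

/-! ### Completeness of certificates -/

namespace CQL

open Classical in
/-- The rows `g i`, for all positions `i ≤ n` with the property `p`. -/
noncomputable def rowsOf (n : ℕ) (k : RowKind) (p : ℕ → Prop) (g : ℕ → Row) :
    List (RowKind × Row) :=
  ((List.range (n + 1)).filter p).map fun i => (k, g i)

theorem mem_rowsOf {n : ℕ} {k k' : RowKind} {p : ℕ → Prop} {g : ℕ → Row} {f : Row} :
    (k', f) ∈ rowsOf n k p g ↔ k' = k ∧ ∃ i ≤ n, p i ∧ f = g i := by
  simp only [rowsOf, List.mem_map, List.mem_filter, List.mem_range, Nat.lt_succ_iff,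
    decide_eq_true_eq, Prod.mk.injEq]
  constructor
  · rintro ⟨i, ⟨hi, hp⟩, rfl, rfl⟩
    exact ⟨rfl, i, hi, hp, rfl⟩
  · rintro ⟨rfl, i, hi, hp, rfl⟩
    exact ⟨i, ⟨hi, hp⟩, rfl, rfl⟩

theorem length_rowsOf_le {n : ℕ} {k : RowKind} {p : ℕ → Prop} {g : ℕ → Row} :
    (rowsOf n k p g).length ≤ n + 1 := by
  rw [rowsOf, List.length_map]
  exact (List.length_filter_le _ _).trans (by simp)

section

variable (x : List Token)

/-- The rows of kind `k` among `rs`. -/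
def kindRows (rs : List (RowKind × Row)) (k : RowKind) : Set Row := {f | (k, f) ∈ rs}

/-- The claim that a formula stands between `i` and `e`. -/
def TrueSpan (i e : ℕ) : Prop := ∃ φ, Occ x i φ e

/-- The position behind the formula that starts at `i`. -/
noncomputable def endOf (i : ℕ) : ℕ := by
  classical exact if h : ∃ e, TrueSpan x i e then h.choose else 0

/-- The row that expresses that a formula stands between `i` and `e`. -/
def spanRow (i e : ℕ) : Row := fun j =>
  if j = i then some true else if j = e then some false else none

/-- The rows for all subformulas. -/
noncomputable def spanRows : List (RowKind × Row) :=
  rowsOf x.length .span (fun i => ∃ e, TrueSpan x i e) fun i => spanRow i (endOf x i)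

/-- The rows for all positions at which no formula starts. -/
noncomputable def stuckRows : List (RowKind × Row) :=
  rowsOf x.length .stuck (fun i => ¬∃ e, TrueSpan x i e) fun i j => if j = i then some true else none

variable {x}

theorem trueSpan_endOf {i e : ℕ} (h : TrueSpan x i e) : endOf x i = e := by
  have h' : ∃ e, TrueSpan x i e := ⟨e, h⟩
  rw [endOf, dif_pos h']
  obtain ⟨φ, hφ⟩ := h
  obtain ⟨ψ, hψ⟩ := h'.choose_spec
  exact (hψ.unique hφ).2

/-- The rows of kind `span` express the true claims only: each row has one mark of each sort. -/
theorem spanIn_iff {S : Set Row}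
    (hS : ∀ f, f ∈ S ↔ ∃ i ≤ x.length, (∃ e, TrueSpan x i e) ∧ f = spanRow i (endOf x i))
    {i e : ℕ} : SpanIn S i e ↔ TrueSpan x i e := by
  constructor
  · rintro ⟨f, hf, h₁, h₂⟩
    obtain ⟨j, -, ⟨e', he'⟩, rfl⟩ := (hS f).1 hf
    rw [trueSpan_endOf he'] at h₁ h₂
    have hlt : j < e' := he'.choose_spec.lt
    unfold spanRow at h₁ h₂
    have hi : i = j := by
      by_contra hne
      rw [if_neg hne] at h₁
      split_ifs at h₁; simp at h₁
    have he : e = e' := by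
      by_contra hne
      rw [if_neg hne] at h₂
      split_ifs at h₂; simp at h₂
    rwa [hi, he]
  · intro h
    have hlt : i < e := h.choose_spec.lt
    refine ⟨_, (hS _).2 ⟨i, hlt.le.trans h.choose_spec.le_length, ⟨e, h⟩, rfl⟩, ?_, ?_⟩
    · simp [spanRow]
    · rw [trueSpan_endOf h]
      simp [spanRow, hlt.ne']

theorem markIn_iff {S : Set Row} (hS : ∀ f, f ∈ S ↔ ∃ i ≤ x.length, (¬∃ e, TrueSpan x i e) ∧
    f = fun j => if j = i then some true else none) {i : ℕ} :
    MarkIn S i ↔ i ≤ x.length ∧ ¬∃ e, TrueSpan x i e := by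
  constructor
  · rintro ⟨f, hf, h⟩
    obtain ⟨j, hj, hn, rfl⟩ := (hS f).1 hf
    have : i = j := by
      by_contra hne
      simp [hne] at h
    exact this ▸ ⟨hj, hn⟩
  · exact fun ⟨hi, h⟩ => ⟨_, (hS _).2 ⟨i, hi, h, rfl⟩, by simp⟩

theorem trueSpan_step {i e : ℕ} (h : TrueSpan x i e) : SpanStep x (TrueSpan x) i e := by
  obtain ⟨φ, h⟩ := h
  cases h with
  | var hi hu hd => exact Or.inr (Or.inr (Or.inr ⟨hi, _, hu, rfl⟩))
  | top hi => exact Or.inl ⟨Or.inl hi, rfl⟩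
  | bot hi => exact Or.inl ⟨Or.inr hi, rfl⟩
  | and hi h₁ h₂ => exact Or.inr (Or.inr (Or.inl ⟨Or.inl hi, _, h₁.le_length, ⟨_, h₁⟩, ⟨_, h₂⟩⟩))
  | or hi h₁ h₂ => exact Or.inr (Or.inr (Or.inl ⟨Or.inr hi, _, h₁.le_length, ⟨_, h₁⟩, ⟨_, h₂⟩⟩))
  | neg hi h => exact Or.inr (Or.inl ⟨hi, _, h⟩)

theorem stuck_step {i : ℕ} (h : ¬∃ e, TrueSpan x i e) :
    StuckStep x (TrueSpan x) (fun i => i ≤ x.length ∧ ¬∃ e, TrueSpan x i e) i := by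
  rcases ht : x[i]? with _ | t
  · exact Or.inl (Or.inl ht)
  have hi := lt_length_of_getElem? ht
  have bin : (∀ k φ ψ e, Occ x (i + 1) φ k → Occ x k ψ e → False) →
      (i + 1 ≤ x.length ∧ ¬∃ e, TrueSpan x (i + 1) e) ∨
        ∃ k ≤ x.length, TrueSpan x (i + 1) k ∧ k ≤ x.length ∧ ¬∃ e, TrueSpan x k e := by
    intro H
    by_cases hk : ∃ k, TrueSpan x (i + 1) k
    · obtain ⟨k, φ, hφ⟩ := hk
      exact Or.inr ⟨k, hφ.le_length, ⟨φ, hφ⟩, hφ.le_length, fun ⟨e, ψ, hψ⟩ => H k φ ψ e hφ hψ⟩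
    · exact Or.inl ⟨hi, hk⟩
  cases t with
  | var =>
    refine Or.inr (Or.inr (Or.inr ⟨ht, fun ⟨u, hu⟩ => h ?_⟩))
    obtain ⟨m, hm⟩ := hu.exists_occ ht
    exact ⟨_, _, hm⟩
  | bit b => exact Or.inl (Or.inr (Or.inl ⟨b, ht⟩))
  | top => exact absurd ⟨_, _, Occ.top ht⟩ h
  | bot => exact absurd ⟨_, _, Occ.bot ht⟩ h
  | and =>
    exact Or.inr (Or.inr (Or.inl ⟨Or.inl ht, bin fun k φ ψ e hφ hψ => h ⟨e, _, Occ.and ht hφ hψ⟩⟩))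
  | or =>
    exact Or.inr (Or.inr (Or.inl ⟨Or.inr ht, bin fun k φ ψ e hφ hψ => h ⟨e, _, Occ.or ht hφ hψ⟩⟩))
  | neg => exact Or.inr (Or.inl ⟨ht, hi, fun ⟨e, φ, hφ⟩ => h ⟨e, _, Occ.neg ht hφ⟩⟩)
  | entails => exact Or.inl (Or.inr (Or.inr ht))

theorem illformed_of_forall_ne (h : ∀ φ ψ, x ≠ encodeEntailment φ ψ) :
    Illformed x (TrueSpan x) (fun i => i ≤ x.length ∧ ¬∃ e, TrueSpan x i e) := by
  by_cases h₀ : ∃ e, TrueSpan x 0 e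
  · obtain ⟨e, φ, hφ⟩ := h₀
    refine Or.inr ⟨e, hφ.le_length, ⟨φ, hφ⟩, ?_⟩
    by_contra! hne
    obtain ⟨ht, hn, hs⟩ := hne
    obtain ⟨e', ψ, hψ⟩ := hn (lt_length_of_getElem? ht)
    have := hs e' hψ.le_length ⟨ψ, hψ⟩
    have he' : e' = x.length := le_antisymm hψ.le_length (by simpa using this)
    exact h φ ψ (eq_encodeEntailment hφ ht (he' ▸ hψ))
  · exact Or.inl ⟨Nat.zero_le _, h₀⟩

end

section Countermodel

variable {L : Type} [FundamentalLattice L] (v : ℕ → L) (x : List Token)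

/-- The value of the formula that starts at `i`. -/
noncomputable def valueAt (i : ℕ) : L := by
  classical exact if h : ∃ φ e, Occ x i φ e then h.choose.eval v else ⊥

variable {v x}

theorem Occ.valueAt_eq {i e : ℕ} {φ : Formula} (h : Occ x i φ e) : valueAt v x i = φ.eval v := by
  have h' : ∃ φ e, Occ x i φ e := ⟨φ, e, h⟩
  rw [valueAt, dif_pos h']
  obtain ⟨e', he'⟩ := h'.choose_spec
  rw [(he'.unique h).1]

variable (v x)

open Classical in
/-- The row of an element `a` of an Ex-lattice: it affirms what `a` implies up to double negation,
and denies what `a` implies the negation of. -/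
noncomputable def orthoRow (a : L) : Row := fun j =>
  if ∃ e, TrueSpan x j e then
    if a ≤ (valueAt v x j)ᶜᶜ then some true else if a ≤ (valueAt v x j)ᶜ then some false else none
  else none

variable {v x}

theorem orthoRow_eq_true {a : L} {j e : ℕ} (h : TrueSpan x j e) :
    orthoRow v x a j = some true ↔ a ≤ (valueAt v x j)ᶜᶜ := by
  have h' : ∃ e, TrueSpan x j e := ⟨e, h⟩
  unfold orthoRow
  rw [if_pos h']
  split_ifs <;> simp_all

theorem eq_bot_of_le {a b : L} (h : a ≤ bᶜᶜ) (h' : a ≤ bᶜ) : a = ⊥ :=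
  le_bot_iff.1 ((le_inf h' h).trans (FundamentalLattice.inf_compl_eq_bot _).le)

theorem orthoRow_eq_false {a : L} (ha : a ≠ ⊥) {j e : ℕ} (h : TrueSpan x j e) :
    orthoRow v x a j = some false ↔ a ≤ (valueAt v x j)ᶜ := by
  have h' : ∃ e, TrueSpan x j e := ⟨e, h⟩
  unfold orthoRow
  rw [if_pos h']
  split_ifs with h₁ h₂
  · simp only [Option.some.injEq, Bool.true_eq_false, false_iff]
    exact fun h₂ => ha (eq_bot_of_le h₁ h₂)
  · simpa using h₂
  · simpa using h₂

theorem exists_span_of_orthoRow {a : L} {j : ℕ} {b : Bool} (h : orthoRow v x a j = some b) :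
    ∃ e, TrueSpan x j e := by
  unfold orthoRow at h
  by_contra hne
  rw [if_neg hne] at h
  simp at h

theorem le_compl_of_conflict {a b : L} (ha : a ≠ ⊥) (hb : b ≠ ⊥) {n : ℕ}
    (h : Conflict n (orthoRow v x a) (orthoRow v x b)) : a ≤ bᶜ := by
  obtain ⟨j, -, ⟨h₁, h₂⟩ | ⟨h₁, h₂⟩⟩ := h
  · obtain ⟨e, he⟩ := exists_span_of_orthoRow h₁
    rw [orthoRow_eq_true he] at h₁
    rw [orthoRow_eq_false hb he] at h₂
    exact h₁.trans (FundamentalLattice.compl_antitone _ _ h₂)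
  · obtain ⟨e, he⟩ := exists_span_of_orthoRow h₁
    rw [orthoRow_eq_true he] at h₂
    rw [orthoRow_eq_false ha he] at h₁
    rw [← compl_compl_compl_eq] at h₁
    exact h₁.trans (FundamentalLattice.compl_antitone _ _ h₂)

/-- If double negation separates the two sides of an entailment in an Ex-lattice, then the rows of
the values of subformulas and of their complements form an orthoframe that refutes it. -/
theorem IsExLattice.orthoModel (hL : IsExLattice L) {S : Set Row}
    (hS : ∀ f, f ∈ S ↔ ∃ i e, TrueSpan x i e ∧ ∃ a, (a = valueAt v x i ∨ a = (valueAt v x i)ᶜ) ∧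
      a ≠ ⊥ ∧ f = orthoRow v x a)
    {e : ℕ} {φ ψ : Formula} (h₁ : Occ x 0 φ e) (h₃ : Occ x (e + 1) ψ x.length)
    (hne : ¬φ.eval v ≤ (ψ.eval v)ᶜᶜ) : OrthoModel x (TrueSpan x) S := by
  have hS' : ∀ f ∈ S, ∃ a, a ≠ ⊥ ∧ f = orthoRow v x a := by
    intro f hf
    obtain ⟨_, _, _, a, _, ha, rfl⟩ := (hS f).1 hf
    exact ⟨a, ha, rfl⟩
  have hspan : ∀ {i χ e}, Occ x i χ e → TrueSpan x i e := fun h => ⟨_, h⟩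
  constructor
  · intro i hi e he h f hf b hfi
    obtain ⟨a, ha, rfl⟩ := hS' f hf
    cases b
    · have hai : ¬a ≤ (valueAt v x i)ᶜᶜ := fun h' => hfi ((orthoRow_eq_true h).2 h')
      have hb : (valueAt v x i)ᶜ ≠ ⊥ := fun h' => hai (by rw [h', compl_bot_eq]; exact le_top)
      refine ⟨orthoRow v x (valueAt v x i)ᶜ, (hS _).2 ⟨i, e, h, _, Or.inr rfl, hb, rfl⟩,
        (orthoRow_eq_false hb h).2 le_rfl, fun hc => hai (le_compl_of_conflict ha hb hc)⟩
    · have hai : ¬a ≤ (valueAt v x i)ᶜ := fun h' => hfi ((orthoRow_eq_false ha h).2 h')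
      have hb : valueAt v x i ≠ ⊥ := fun h' => hai (by rw [h', compl_bot_eq]; exact le_top)
      refine ⟨orthoRow v x (valueAt v x i), (hS _).2 ⟨i, e, h, _, Or.inl rfl, hb, rfl⟩,
        (orthoRow_eq_true h).2 (FundamentalLattice.le_compl_compl _),
        fun hc => hai (le_compl_of_conflict ha hb hc)⟩
  · intro i hi ht f hf
    obtain ⟨a, ha, rfl⟩ := hS' f hf
    have ho := Occ.top ht
    rw [orthoRow_eq_true (hspan ho), ho.valueAt_eq]
    exact le_top.trans (FundamentalLattice.le_compl_compl _)
  · intro i hi ht f hf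
    obtain ⟨a, ha, rfl⟩ := hS' f hf
    have ho := Occ.bot ht
    rw [orthoRow_eq_false ha (hspan ho), ho.valueAt_eq]
    exact le_top.trans compl_bot_eq.ge
  · rintro i hi e he ht ⟨χ, hχ⟩ f hf
    obtain ⟨a, ha, rfl⟩ := hS' f hf
    have ho := Occ.neg ht hχ
    rw [orthoRow_eq_true (hspan ho), orthoRow_eq_false ha (hspan hχ), ho.valueAt_eq, hχ.valueAt_eq,
      Formula.eval, compl_compl_compl_eq]
  · rintro i hi k hk e he ht ⟨χ, hχ⟩ ⟨χ', hχ'⟩ f hf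
    obtain ⟨a, ha, rfl⟩ := hS' f hf
    have ho := Occ.and ht hχ hχ'
    rw [orthoRow_eq_true (hspan ho), orthoRow_eq_true (hspan hχ), orthoRow_eq_true (hspan hχ'),
      ho.valueAt_eq, hχ.valueAt_eq, hχ'.valueAt_eq]
    exact hL.le_compl_compl_inf
  · rintro i hi k hk e he ht ⟨χ, hχ⟩ ⟨χ', hχ'⟩ f hf
    obtain ⟨a, ha, rfl⟩ := hS' f hf
    have ho := Occ.or ht hχ hχ'
    rw [orthoRow_eq_false ha (hspan ho), orthoRow_eq_false ha (hspan hχ),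
      orthoRow_eq_false ha (hspan hχ'), ho.valueAt_eq, hχ.valueAt_eq, hχ'.valueAt_eq]
    exact le_compl_sup
  · rintro i hi j hj ht ht' hd f hf b hb
    obtain ⟨a, ha, rfl⟩ := hS' f hf
    obtain ⟨m, ⟨e, he⟩, ⟨e', he'⟩⟩ := hd.exists_occ ht ht'
    cases b
    · rwa [orthoRow_eq_false ha (hspan he'), he'.valueAt_eq, ← he.valueAt_eq,
        ← orthoRow_eq_false ha (hspan he)]
    · rwa [orthoRow_eq_true (hspan he'), he'.valueAt_eq, ← he.valueAt_eq,
        ← orthoRow_eq_true (hspan he)]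
  · have hb : valueAt v x 0 ≠ ⊥ := fun h' => hne (by rw [← h₁.valueAt_eq, h']; exact bot_le)
    refine ⟨e, h₁.le_length, hspan h₁, ⟨_, le_rfl, hspan h₃⟩, orthoRow v x (valueAt v x 0),
      (hS _).2 ⟨0, e, hspan h₁, _, Or.inl rfl, hb, rfl⟩, ?_, ?_⟩
    · rw [orthoRow_eq_true (hspan h₁)]
      exact FundamentalLattice.le_compl_compl _
    · rw [Ne, orthoRow_eq_true (hspan h₃), h₃.valueAt_eq, h₁.valueAt_eq]
      exact hne

variable (v x)

open Classical in
/-- The row of a set `F` of elements: it affirms the subformulas with values in `F`. -/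
noncomputable def filterRow (F : Set L) : Row := fun j =>
  if (∃ e, TrueSpan x j e) ∧ valueAt v x j ∈ F then some true else none

variable {v x}

theorem filterRow_eq_true {F : Set L} {j e : ℕ} {χ : Formula} (h : Occ x j χ e) :
    filterRow v x F j = some true ↔ χ.eval v ∈ F := by
  have h' : ∃ e, TrueSpan x j e := ⟨e, χ, h⟩
  unfold filterRow
  rw [h.valueAt_eq]
  simp [h']

/-- A prime filter `F` that separates the two sides of an entailment is the root of a Kripke model
that refutes it; the leaves are maximal filters above it, one for each subformula whose complement
does not belong to `F`. -/
theorem IsPrime.fanModel {F : Set L} (hF : IsFilter F) (hp : IsPrime F)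
    {M : ℕ → Set L} {R S : Set Row} (hR : ∀ f, f ∈ R ↔ f = filterRow v x F)
    (hS : ∀ f, f ∈ S ↔ ∃ i e, TrueSpan x i e ∧ (valueAt v x i)ᶜ ∉ F ∧ f = filterRow v x (M i))
    (hM : ∀ i, (valueAt v x i)ᶜ ∉ F → IsFilter (M i) ∧ F ⊆ M i ∧ ⊥ ∉ M i ∧ valueAt v x i ∈ M i ∧
      IsPrime (M i) ∧ ∀ a, a ∈ M i ∨ aᶜ ∈ M i)
    {e : ℕ} {φ ψ : Formula} (h₁ : Occ x 0 φ e) (h₃ : Occ x (e + 1) ψ x.length)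
    (hφ : φ.eval v ∈ F) (hψ : ψ.eval v ∉ F) : FanModel x (TrueSpan x) R S := by
  have hbot : ⊥ ∉ F := fun h => hψ (hF.mem_of_le bot_le h)
  have hleaf : ∀ f ∈ S, ∃ G, IsFilter G ∧ F ⊆ G ∧ ⊥ ∉ G ∧ IsPrime G ∧ (∀ a, a ∈ G ∨ aᶜ ∈ G) ∧
      f = filterRow v x G := by
    intro f hf
    obtain ⟨i, _, _, h, rfl⟩ := (hS f).1 hf
    obtain ⟨h₁, h₂, h₃, -, h₄, h₅⟩ := hM i h
    exact ⟨_, h₁, h₂, h₃, h₄, h₅, rfl⟩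
  have hrow : ∀ f ∈ R ∪ S, ∃ G, IsFilter G ∧ ⊥ ∉ G ∧ IsPrime G ∧ f = filterRow v x G := by
    rintro f (hf | hf)
    · exact ⟨F, hF, hbot, hp, (hR f).1 hf⟩
    · obtain ⟨G, h₁, -, h₃, h₄, -, rfl⟩ := hleaf f hf
      exact ⟨G, h₁, h₃, h₄, rfl⟩
  have hnot : ∀ {G : Set L}, IsFilter G → ⊥ ∉ G → ∀ {a : L}, a ∈ G → aᶜ ∉ G := fun hG hb a ha hac =>
    hb (hG.mem_of_le (FundamentalLattice.inf_compl_eq_bot _).le (hG.inf_mem ha hac))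
  constructor
  · intro i hi ht f hf
    obtain ⟨G, hG, -, -, rfl⟩ := hrow f hf
    rw [filterRow_eq_true (Occ.top ht)]
    exact hG.top_mem
  · intro i hi ht f hf
    obtain ⟨G, hG, hb, -, rfl⟩ := hrow f hf
    rw [Ne, filterRow_eq_true (Occ.bot ht)]
    exact hb
  · rintro i hi k hk e he ht ⟨χ, hχ⟩ ⟨χ', hχ'⟩ f hf
    obtain ⟨G, hG, -, -, rfl⟩ := hrow f hf
    rw [filterRow_eq_true (Occ.and ht hχ hχ'), filterRow_eq_true hχ, filterRow_eq_true hχ']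
    exact ⟨fun h => ⟨hG.mem_of_le inf_le_left h, hG.mem_of_le inf_le_right h⟩,
      fun h => hG.inf_mem h.1 h.2⟩
  · rintro i hi k hk e he ht ⟨χ, hχ⟩ ⟨χ', hχ'⟩ f hf
    obtain ⟨G, hG, -, hGp, rfl⟩ := hrow f hf
    rw [filterRow_eq_true (Occ.or ht hχ hχ'), filterRow_eq_true hχ, filterRow_eq_true hχ']
    exact ⟨hGp _ _, fun h => h.elim (hG.mem_of_le le_sup_left) (hG.mem_of_le le_sup_right)⟩
  · rintro i hi e he ht ⟨χ, hχ⟩ f hf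
    obtain ⟨G, hG, -, hb, -, hmax, rfl⟩ := hleaf f hf
    rw [Ne, filterRow_eq_true (Occ.neg ht hχ), filterRow_eq_true hχ]
    exact ⟨fun h h' => hnot hG hb h' h, (hmax _).resolve_left⟩
  · rintro i hi e he ht ⟨χ, hχ⟩ f hf
    rw [(hR f).1 hf, Ne, filterRow_eq_true (Occ.neg ht hχ), filterRow_eq_true hχ]
    constructor
    · refine fun h => ⟨fun h' => hnot hF hbot h' h, fun g hg => ?_⟩
      obtain ⟨G, hG, hFG, hb, -, -, rfl⟩ := hleaf g hg
      rw [Ne, filterRow_eq_true hχ]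
      exact fun h' => hnot hG hb h' (hFG h)
    · rintro ⟨-, h⟩
      by_contra hn
      have hn' : (valueAt v x (i + 1))ᶜ ∉ F := by rwa [hχ.valueAt_eq]
      refine h (filterRow v x (M (i + 1))) ((hS _).2 ⟨i + 1, e, ⟨χ, hχ⟩, hn', rfl⟩) ?_
      rw [filterRow_eq_true hχ, ← hχ.valueAt_eq]
      exact (hM _ hn').2.2.2.1
  · rintro i hi j hj ht ht' hd f hf hb
    obtain ⟨G, hG, -, -, rfl⟩ := hrow f hf
    obtain ⟨m, ⟨e, he⟩, ⟨e', he'⟩⟩ := hd.exists_occ ht ht'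
    rwa [filterRow_eq_true he', ← filterRow_eq_true he]
  · rintro i hi e he ht ⟨χ, hχ⟩ f hf hfi g hg
    obtain ⟨G, -, hFG, -, -, -, rfl⟩ := hleaf g hg
    rw [(hR f).1 hf, filterRow_eq_true hχ] at hfi
    rw [filterRow_eq_true hχ]
    exact hFG hfi
  · refine ⟨e, h₁.le_length, ⟨φ, h₁⟩, ⟨_, le_rfl, ψ, h₃⟩, filterRow v x F, (hR _).2 rfl, ?_, ?_⟩
    · rwa [filterRow_eq_true h₁]
    · rwa [Ne, filterRow_eq_true h₃]

end Countermodel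

/-- The rows of a list vanish beyond the position `n`. -/
def SupportedBelow (n : ℕ) (rs : List (RowKind × Row)) : Prop :=
  ∀ r ∈ rs, ∀ j, n < j → r.2 j = none

theorem SupportedBelow.append {n : ℕ} {rs rs' : List (RowKind × Row)} (h : SupportedBelow n rs)
    (h' : SupportedBelow n rs') : SupportedBelow n (rs ++ rs') := fun r hr =>
  (List.mem_append.1 hr).elim (h r) (h' r)

theorem supportedBelow_rowsOf {n : ℕ} {k : RowKind} {p : ℕ → Prop} {g : ℕ → Row}
    (h : ∀ i ≤ n, p i → ∀ j, n < j → g i j = none) : SupportedBelow n (rowsOf n k p g) := by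
  rintro ⟨k', f⟩ hr
  obtain ⟨rfl, i, hi, hp, rfl⟩ := mem_rowsOf.1 hr
  exact h i hi hp

theorem not_trueSpan_of_length_lt {x : List Token} {j : ℕ} (hj : x.length < j) :
    ¬∃ e, TrueSpan x j e := fun ⟨_, _, h⟩ => absurd (h.lt.trans_le h.le_length) hj.asymm

theorem supportedBelow_spanRows (x : List Token) : SupportedBelow x.length (spanRows x) := by
  refine supportedBelow_rowsOf fun i hi ⟨e, φ, h⟩ j hj => ?_
  have := h.le_length
  rw [spanRow, trueSpan_endOf ⟨φ, h⟩, if_neg (by omega), if_neg (by omega)]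

theorem orthoRow_eq_none {L : Type} [FundamentalLattice L] {v : ℕ → L} {x : List Token} {a : L}
    {j : ℕ} (hj : x.length < j) : orthoRow v x a j = none :=
  if_neg (not_trueSpan_of_length_lt hj)

theorem filterRow_eq_none {L : Type} [FundamentalLattice L] {v : ℕ → L} {x : List Token}
    {F : Set L} {j : ℕ} (hj : x.length < j) : filterRow v x F j = none :=
  if_neg fun h => not_trueSpan_of_length_lt hj h.1

/-- Every word that does not encode an entailment of Ex-logic has a certificate with a linear number
of rows. -/
theorem exists_certifies (x : List Token) (h : ∀ φ ψ, x = encodeEntailment φ ψ → ¬ExLogic φ ψ) :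
    ∃ rs : List (RowKind × Row), rs.length ≤ 5 * (x.length + 1) ∧ SupportedBelow x.length rs ∧
      Certifies x (kindRows rs) := by
  have hspan : ∀ rs, (∀ f, f ∈ kindRows (spanRows x ++ rs) .span ↔ (.span, f) ∈ spanRows x) →
      SpanIn (kindRows (spanRows x ++ rs) .span) = TrueSpan x := fun rs hrs => by
    funext i e
    exact propext (spanIn_iff fun f => by rw [hrs, spanRows, mem_rowsOf]; simp)
  have hlen : (spanRows x).length ≤ x.length + 1 := length_rowsOf_le
  by_cases hx : ∀ φ ψ, x ≠ encodeEntailment φ ψ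
  · refine ⟨spanRows x ++ stuckRows x, ?_, (supportedBelow_spanRows x).append
      (supportedBelow_rowsOf fun i hi _ j hj => if_neg (by omega)), ?_⟩
    · have : (stuckRows x).length ≤ x.length + 1 := length_rowsOf_le
      rw [List.length_append]
      omega
    · have hs := hspan (stuckRows x) fun f => by simp [kindRows, stuckRows, mem_rowsOf]
      have hm : MarkIn (kindRows (spanRows x ++ stuckRows x) .stuck) =
          fun i => i ≤ x.length ∧ ¬∃ e, TrueSpan x i e := by
        funext i
        exact propext (markIn_iff fun f => by simp [kindRows, spanRows, stuckRows, mem_rowsOf])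
      rw [Certifies, hs, hm]
      exact ⟨fun i _ e _ => trueSpan_step,
        Or.inl ⟨fun i _ hi => stuck_step hi.2, illformed_of_forall_ne hx⟩⟩
  push Not at hx
  obtain ⟨φ, ψ, hx⟩ := hx
  have hne := h φ ψ hx
  obtain ⟨e, h₁, -, h₃⟩ := occ_encodeEntailment φ ψ
  rw [← hx] at h₁ h₃
  let v : ℕ → Lindenbaum.{0} := fun n => Lindenbaum.mk (.var n)
  have hL := Lindenbaum.isExLattice.{0}
  have hle : ¬φ.eval v ≤ ψ.eval v := by
    rwa [Lindenbaum.eval_var, Lindenbaum.eval_var, Lindenbaum.mk_le_mk]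
  by_cases hcc : φ.eval v ≤ (ψ.eval v)ᶜᶜ
  · obtain ⟨F, hF, hφ, hψ, hp⟩ := hL.exists_prime hle hcc
    have hbot : ⊥ ∉ F := fun h => hψ (hF.mem_of_le bot_le h)
    choose! M hM using fun (i : ℕ) (hi : (valueAt v x i)ᶜ ∉ F) => hp.exists_maximal hL hF hbot hi
    let leaves := rowsOf x.length .leaf
      (fun i => (∃ e, TrueSpan x i e) ∧ (valueAt v x i)ᶜ ∉ F) fun i => filterRow v x (M i)
    have hleaves : leaves.length ≤ x.length + 1 := length_rowsOf_le
    refine ⟨spanRows x ++ ((.root, filterRow v x F) :: leaves), ?_,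
      (supportedBelow_spanRows x).append ?_, ?_⟩
    · rw [List.length_append, List.length_cons]
      omega
    · intro r hr
      rcases List.mem_cons.1 hr with rfl | hr
      · exact fun j => filterRow_eq_none
      · exact supportedBelow_rowsOf (fun i _ _ j => filterRow_eq_none) r hr
    · rw [Certifies, hspan _ fun f => by simp [kindRows, leaves, mem_rowsOf]]
      refine ⟨fun i _ e _ => trueSpan_step, Or.inr (Or.inr ?_)⟩
      refine hp.fanModel hF (fun f => ?_) (fun f => ?_) hM h₁ h₃ hφ hψ
      · simp [kindRows, spanRows, leaves, mem_rowsOf]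
      · simp only [kindRows, Set.mem_ofPred_eq, List.mem_append, List.mem_cons, leaves, spanRows,
          mem_rowsOf]
        simp only [reduceCtorEq, false_and, Prod.mk.injEq, false_or, true_and]
        exact ⟨fun ⟨i, _, ⟨⟨e, h⟩, h'⟩, h''⟩ => ⟨i, e, h, h', h''⟩, fun ⟨i, e, h, h', h''⟩ =>
          ⟨i, h.choose_spec.lt.le.trans h.choose_spec.le_length, ⟨⟨e, h⟩, h'⟩, h''⟩⟩
  · let points : (Lindenbaum.{0} → Lindenbaum.{0}) → List (RowKind × Row) := fun s =>
      rowsOf x.length .point (fun i => (∃ e, TrueSpan x i e) ∧ s (valueAt v x i) ≠ ⊥)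
        fun i => orthoRow v x (s (valueAt v x i))
    have hpoints : ∀ s, (points s).length ≤ x.length + 1 := fun s => length_rowsOf_le
    have hsupp : ∀ s, SupportedBelow x.length (points s) := fun s =>
      supportedBelow_rowsOf fun i _ _ j => orthoRow_eq_none
    have hmem : ∀ s f, (.point, f) ∈ points s ↔ ∃ i e, TrueSpan x i e ∧ s (valueAt v x i) ≠ ⊥ ∧
        f = orthoRow v x (s (valueAt v x i)) := by
      intro s f
      simp only [points, mem_rowsOf, true_and]
      exact ⟨fun ⟨i, _, ⟨⟨e, h⟩, h'⟩, h''⟩ => ⟨i, e, h, h', h''⟩, fun ⟨i, e, h, h', h''⟩ =>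
        ⟨i, h.choose_spec.lt.le.trans h.choose_spec.le_length, ⟨⟨e, h⟩, h'⟩, h''⟩⟩
    refine ⟨spanRows x ++ (points id ++ points (·ᶜ)), ?_,
      (supportedBelow_spanRows x).append ((hsupp _).append (hsupp _)), ?_⟩
    · have := hpoints id
      have := hpoints (·ᶜ)
      rw [List.length_append, List.length_append]
      omega
    · rw [Certifies, hspan _ fun f => by simp [kindRows, points, mem_rowsOf]]
      refine ⟨fun i _ e _ => trueSpan_step, Or.inr (Or.inl ?_)⟩
      refine hL.orthoModel (fun f => ?_) h₁ h₃ hcc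
      rw [kindRows, Set.mem_ofPred_eq, List.mem_append, List.mem_append, hmem, hmem]
      simp only [spanRows, mem_rowsOf, reduceCtorEq, false_and, false_or, id]
      constructor
      · rintro (⟨i, e, h, h', h''⟩ | ⟨i, e, h, h', h''⟩)
        · exact ⟨i, e, h, _, Or.inl rfl, h', h''⟩
        · exact ⟨i, e, h, _, Or.inr rfl, h', h''⟩
      · rintro ⟨i, e, h, _, rfl | rfl, h', h''⟩
        · exact Or.inl ⟨i, e, h, h', h''⟩
        · exact Or.inr ⟨i, e, h, h', h''⟩

end CQL

/-! ### Certificates as words -/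

namespace CQL

/-- The alphabet in which certificates are written: the letters that start a row of a given kind,
and the values in a row. -/
abbrev Mark : Type := RowKind ⊕ Option Bool

/-- A word together with a certificate. -/
abbrev pairWord (x : List Token) (w : List Mark) : List (Token ⊕ Mark) :=
  x.map Sum.inl ++ w.map Sum.inr

/-- The row that is written behind the position `s`; it extends over the positions up to the length
of `x`. -/
def rowAt (x : List Token) (w : List Mark) (s : ℕ) : Row := fun j =>
  if j ≤ x.length then
    match (pairWord x w)[s + 1 + j]? with
    | some (.inr (.inr o)) => o
    | _ => none
  else none

/-- The rows of kind `k` that are written in a certificate. -/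
def writtenRows (x : List Token) (w : List Mark) (k : RowKind) : Set Row :=
  {f | ∃ s < (pairWord x w).length, (pairWord x w)[s]? = some (.inr (.inl k)) ∧ f = rowAt x w s}

/-! ### Definability of correctness -/

/-- A term: a function of the values of `d` variables that is the sum of a constant and of some of
the variables. -/
def IsTerm {d : ℕ} (t : (Fin d → ℕ) → ℕ) : Prop :=
  ∃ (n : ℕ) (ts : List (Fin d)), ∀ ρ, t ρ = n + (ts.map ρ).sum

namespace IsTerm

variable {d : ℕ} {s t : (Fin d → ℕ) → ℕ}

theorem const (n : ℕ) : IsTerm fun _ : Fin d → ℕ => n := ⟨n, [], fun _ => rfl⟩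

theorem var (k : Fin d) : IsTerm fun ρ => ρ k := ⟨0, [k], fun _ => by simp⟩

theorem add (hs : IsTerm s) (ht : IsTerm t) : IsTerm fun ρ => s ρ + t ρ := by
  obtain ⟨n, ns, hn⟩ := hs
  obtain ⟨m, ms, hm⟩ := ht
  refine ⟨n + m, ns ++ ms, fun ρ => ?_⟩
  beta_reduce
  rw [hn, hm, List.map_append, List.sum_append]
  omega

theorem succ (ht : IsTerm t) : IsTerm fun ρ => t ρ + 1 := ht.add (const 1)

theorem lift (ht : IsTerm t) : IsTerm fun ρ : Fin (d + 1) → ℕ => t fun j => ρ j.castSucc := by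
  obtain ⟨n, ns, hn⟩ := ht
  exact ⟨n, ns.map Fin.castSucc, fun ρ => by beta_reduce; rw [hn, List.map_map]; rfl⟩

end IsTerm

/-- A relation between a word, a nonempty certificate and `d` positions is definable if it is
expressed by a first-order formula about the word followed by the certificate. The bound `m₀` is one
for the number of variables. -/
def Definable {d : ℕ} (P : List Token → List Mark → (Fin d → ℕ) → Prop) : Prop :=
  ∃ (φ : WordFormula (Token ⊕ Mark)) (m₀ : ℕ), (∀ m ≥ m₀, φ.wellScoped m d = true) ∧
    ∀ x w, w ≠ [] → ∀ ρ : ℕ → ℕ, φ.Holds (pairWord x w) d ρ ↔ P x w fun k => ρ k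

namespace Definable

variable {d : ℕ} {P Q : List Token → List Mark → (Fin d → ℕ) → Prop} {r s t : (Fin d → ℕ) → ℕ}

theorem congr (hP : Definable P) (h : ∀ x w, w ≠ [] → ∀ ρ, P x w ρ ↔ Q x w ρ) : Definable Q := by
  obtain ⟨φ, m₀, hφ, hP⟩ := hP
  exact ⟨φ, m₀, hφ, fun x w hw ρ => (hP x w hw ρ).trans (h x w hw _)⟩

theorem not (hP : Definable P) : Definable fun x w ρ => ¬P x w ρ := by
  obtain ⟨φ, m₀, hφ, hP⟩ := hP
  exact ⟨.not φ, m₀, hφ, fun x w hw ρ => not_congr (hP x w hw ρ)⟩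

theorem and (hP : Definable P) (hQ : Definable Q) : Definable fun x w ρ => P x w ρ ∧ Q x w ρ := by
  obtain ⟨φ, m₀, hφ, hP⟩ := hP
  obtain ⟨ψ, m₁, hψ, hQ⟩ := hQ
  refine ⟨.and φ ψ, max m₀ m₁, fun m hm => ?_, fun x w hw ρ => and_congr (hP x w hw ρ) (hQ x w hw ρ)⟩
  rw [WordFormula.wellScoped, hφ m (le_of_max_le_left hm), hψ m (le_of_max_le_right hm)]
  rfl

theorem or (hP : Definable P) (hQ : Definable Q) : Definable fun x w ρ => P x w ρ ∨ Q x w ρ :=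
  (hP.not.and hQ.not).not.congr fun _ _ _ _ => by tauto

theorem imp (hP : Definable P) (hQ : Definable Q) : Definable fun x w ρ => P x w ρ → Q x w ρ :=
  (hP.and hQ.not).not.congr fun _ _ _ _ => by tauto

theorem iff (hP : Definable P) (hQ : Definable Q) : Definable fun x w ρ => (P x w ρ ↔ Q x w ρ) :=
  ((hP.imp hQ).and (hQ.imp hP)).congr fun _ _ _ _ => by tauto

theorem forall_bool {R : Bool → List Token → List Mark → (Fin d → ℕ) → Prop}
    (h : ∀ b, Definable (R b)) : Definable fun x w ρ => ∀ b, R b x w ρ :=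
  ((h false).and (h true)).congr fun _ _ _ _ => by simp [Bool.forall_bool]

theorem forall_position {R : List Token → List Mark → (Fin d → ℕ) → ℕ → Prop}
    (h : Definable fun x w (ρ : Fin (d + 1) → ℕ) => R x w (fun j => ρ j.castSucc) (ρ (Fin.last d))) :
    Definable fun x w ρ => ∀ i < (pairWord x w).length, R x w ρ i := by
  obtain ⟨φ, m₀, hφ, h⟩ := h
  refine ⟨.all φ, max m₀ (d + 1), fun m hm => ?_, fun x w hw ρ => ?_⟩
  · rw [WordFormula.wellScoped, hφ m (le_of_max_le_left hm), Bool.and_true, decide_eq_true_eq]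
    exact le_of_max_le_right hm
  · refine forall₂_congr fun i _ => (h x w hw _).trans (iff_of_eq ?_)
    have : (fun j : Fin d => Function.update ρ d i j.castSucc) = fun j : Fin d => ρ j :=
      funext fun j => Function.update_of_ne j.2.ne _ _
    beta_reduce
    rw [this, Fin.val_last, Function.update_self]

theorem exists_position {R : List Token → List Mark → (Fin d → ℕ) → ℕ → Prop}
    (h : Definable fun x w (ρ : Fin (d + 1) → ℕ) => R x w (fun j => ρ j.castSucc) (ρ (Fin.last d))) :
    Definable fun x w ρ => ∃ i < (pairWord x w).length, R x w ρ i :=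
  (forall_position (R := fun x w ρ i => ¬R x w ρ i) h.not).not.congr fun _ _ _ _ => by
    push Not; rfl

theorem letter (p : Option (Token ⊕ Mark) → Prop) (ht : IsTerm t) :
    Definable fun x w ρ => p (pairWord x w)[t ρ]? := by
  classical
  obtain ⟨n, ts, h⟩ := ht
  refine ⟨.letter n (ts.map Fin.val) fun o => decide (p o), 0, fun m _ => ?_, fun x w hw ρ => ?_⟩
  · simp [WordFormula.wellScoped]
  · simp only [WordFormula.Holds, List.map_map, h, decide_eq_true_eq]
    rfl

theorem getElem?_pairWord (x : List Token) (w : List Mark) (i : ℕ) :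
    (pairWord x w)[i]?.bind Sum.getLeft? = x[i]? := by
  rcases lt_or_ge i x.length with h | h
  · simp [pairWord, List.getElem?_append, h]
  · simp only [pairWord, List.getElem?_append, List.length_map, h.not_gt, if_false,
      List.getElem?_eq_none h]
    rcases hw : w[i - x.length]? <;> simp [hw]

theorem token (p : Option Token → Prop) (ht : IsTerm t) : Definable fun x _ ρ => p x[t ρ]? :=
  (letter (fun o => p (o.bind Sum.getLeft?)) ht).congr fun x w _ ρ => by rw [getElem?_pairWord]

/-- Positions are compared by their distance from the end of the word. -/
theorem lt_and_eq (hs : IsTerm s) (ht : IsTerm t) :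
    Definable fun x w ρ => s ρ < (pairWord x w).length ∧ s ρ = t ρ := by
  refine ((letter (fun o => o ≠ none) hs).and (forall_position
    (R := fun x w ρ u => (pairWord x w)[s ρ + u]? = none ↔ (pairWord x w)[t ρ + u]? = none)
    ((letter (fun o => o = none) (hs.lift.add (.var _))).iff
      (letter (fun o => o = none) (ht.lift.add (.var _)))))).congr fun x w _ ρ => ?_
  simp only [ne_eq, List.getElem?_eq_none_iff, not_le]
  refine and_congr_right fun h => ⟨fun h' => ?_, fun h' => by simp [h']⟩
  -- If the positions differ, then the shift that moves the larger one behind the end of the word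
  -- separates them.
  rcases lt_trichotomy (s ρ) (t ρ) with hlt | heq | hlt
  · have := h' ((pairWord x w).length - t ρ) (by omega)
    omega
  · exact heq
  · have := h' ((pairWord x w).length - s ρ) (by omega)
    omega

/-- A position is at most the length of the first part if it is `0`, or next to a position in the
first part. -/
theorem le_length (ht : IsTerm t) : Definable fun x _ ρ => t ρ ≤ x.length := by
  refine ((lt_and_eq (.const 0) ht).or (exists_position
    (R := fun x w ρ i => x[i]? ≠ none ∧ i + 1 < (pairWord x w).length ∧ i + 1 = t ρ)
    ((token (fun o => o ≠ none) (.var _)).and (lt_and_eq (IsTerm.var _).succ ht.lift)))).congr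
    fun x w hw ρ => ?_
  have hw := List.length_pos_iff.2 hw
  simp only [ne_eq, List.getElem?_eq_none_iff, not_le, List.length_append, List.length_map]
  constructor
  · rintro (h | ⟨i, -, h⟩) <;> omega
  · intro h
    rcases Nat.eq_zero_or_pos (t ρ) with h₁ | h₁
    · exact Or.inl (by omega)
    · exact Or.inr ⟨t ρ - 1, by omega⟩

theorem le_and_eq (hs : IsTerm s) (ht : IsTerm t) :
    Definable fun x _ ρ => s ρ ≤ x.length ∧ s ρ = t ρ :=
  ((le_length hs).and (lt_and_eq hs ht)).congr fun x w hw ρ => by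
    have := List.length_pos_iff.2 hw
    simp only [List.length_append, List.length_map]
    omega

theorem forall_le {R : List Token → List Mark → (Fin d → ℕ) → ℕ → Prop}
    (h : Definable fun x w (ρ : Fin (d + 1) → ℕ) => R x w (fun j => ρ j.castSucc) (ρ (Fin.last d))) :
    Definable fun x w ρ => ∀ i ≤ x.length, R x w ρ i :=
  (forall_position (R := fun x w ρ i => i ≤ x.length → R x w ρ i)
    ((le_length (.var _)).imp h)).congr fun x w hw ρ => by
      have := List.length_pos_iff.2 hw
      simp only [List.length_append, List.length_map]
      exact ⟨fun h i hi => h i (by omega) hi, fun h i _ hi => h i hi⟩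

theorem exists_le {R : List Token → List Mark → (Fin d → ℕ) → ℕ → Prop}
    (h : Definable fun x w (ρ : Fin (d + 1) → ℕ) => R x w (fun j => ρ j.castSucc) (ρ (Fin.last d))) :
    Definable fun x w ρ => ∃ i ≤ x.length, R x w ρ i :=
  (forall_le (R := fun x w ρ i => ¬R x w ρ i) h.not).not.congr fun _ _ _ _ => by
    push Not; rfl

theorem le_and_lt (hs : IsTerm s) (ht : IsTerm t) :
    Definable fun x _ ρ => t ρ ≤ x.length ∧ s ρ < t ρ :=
  (exists_le (R := fun x w ρ u => t ρ ≤ x.length ∧ t ρ = s ρ + u + 1)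
    (le_and_eq ht.lift (hs.lift.add (.var _)).succ)).congr fun x w hw ρ =>
      ⟨fun ⟨u, _, h⟩ => by omega, fun h => ⟨t ρ - s ρ - 1, by omega⟩⟩

theorem forall_row {k : RowKind} {R : List Token → List Mark → (Fin d → ℕ) → Row → Prop}
    (h : Definable fun x w (ρ : Fin (d + 1) → ℕ) =>
      R x w (fun j => ρ j.castSucc) (rowAt x w (ρ (Fin.last d)))) :
    Definable fun x w ρ => ∀ f ∈ writtenRows x w k, R x w ρ f :=
  (forall_position (R := fun x w ρ s => (pairWord x w)[s]? = some (.inr (.inl k)) →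
    R x w ρ (rowAt x w s)) ((letter (fun o => o = some (.inr (.inl k))) (.var _)).imp h)).congr
    fun _ _ _ _ => ⟨fun h _ ⟨s, hs, hk, hf⟩ => hf ▸ h s hs hk, fun h s hs hk =>
      h _ ⟨s, hs, hk, rfl⟩⟩

theorem exists_row {k : RowKind} {R : List Token → List Mark → (Fin d → ℕ) → Row → Prop}
    (h : Definable fun x w (ρ : Fin (d + 1) → ℕ) =>
      R x w (fun j => ρ j.castSucc) (rowAt x w (ρ (Fin.last d)))) :
    Definable fun x w ρ => ∃ f ∈ writtenRows x w k, R x w ρ f :=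
  (forall_row (R := fun x w ρ f => ¬R x w ρ f) h.not).not.congr fun _ _ _ _ => by
    push Not; rfl

theorem row_eq (b : Bool) (hs : IsTerm s) (ht : IsTerm t) :
    Definable fun x w ρ => rowAt x w (s ρ) (t ρ) = some b :=
  ((le_length ht).and (letter (fun o => o = some (.inr (.inr (some b)))) (hs.succ.add ht))).congr
    fun x w _ ρ => by
      unfold rowAt
      split_ifs with h
      · simp only [h, true_and]
        rcases (pairWord x w)[s ρ + 1 + t ρ]? with _ | (_ | _ | _) <;> simp
      · simp [h]

theorem isBit (ht : IsTerm t) : Definable fun x _ ρ => IsBit x[t ρ]? := token IsBit ht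

theorem varLength (hs : IsTerm s) (ht : IsTerm t) :
    Definable fun x _ ρ => VarLength x (s ρ) (t ρ) := by
  refine ((le_length (hs.succ.add ht)).and ((isBit (hs.succ.add ht)).not.and
    ((forall_le (R := fun x w ρ a => t ρ ≤ x.length ∧ a < t ρ → IsBit x[s ρ + 1 + a]?)
      ((le_and_lt (.var _) ht.lift).imp (isBit (hs.lift.succ.add (.var _))))).and
    (forall_le (R := fun x w ρ a => t ρ ≤ x.length ∧ t ρ = a + 1 →
        x[s ρ + 1 + a]? = some (.bit true))
      ((le_and_eq ht.lift (IsTerm.var _).succ).imp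
        (token (· = some (.bit true)) (hs.lift.succ.add (.var _)))))))).congr fun x w _ ρ => ?_
  constructor
  · rintro ⟨h₁, h₂, h₃, h₄⟩
    exact ⟨h₁, h₂, fun a ha => h₃ a (by omega) (by omega), fun a ha => h₄ a (by omega) (by omega)⟩
  · rintro ⟨h₁, h₂, h₃, h₄⟩
    exact ⟨h₁, h₂, fun a _ ha => h₃ a ha.2, fun a _ ha => h₄ a ha.2.symm⟩

theorem sameDigits (hs : IsTerm s) (ht : IsTerm t) :
    Definable fun x _ ρ => SameDigits x (s ρ) (t ρ) := by
  refine (exists_le (R := fun x w ρ u => VarLength x (s ρ) u ∧ ¬IsBit x[t ρ + 1 + u]? ∧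
    ∀ a ≤ x.length, u ≤ x.length ∧ a < u → ∀ b,
      x[s ρ + 1 + a]? = some (.bit b) → x[t ρ + 1 + a]? = some (.bit b))
    ((varLength hs.lift (.var _)).and ((isBit (ht.lift.succ.add (.var _))).not.and
      (forall_le ((le_and_lt (.var _) (.var _)).imp (forall_bool fun b =>
        (token (· = some (.bit b)) (hs.lift.lift.succ.add (.var _))).imp
          (token (· = some (.bit b)) (ht.lift.lift.succ.add (.var _))))))))).congr
    fun x w _ ρ => ?_
  constructor
  · rintro ⟨u, hu, h₁, h₂, h₃⟩
    refine ⟨u, h₁, h₂, fun a ha => ?_⟩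
    obtain ⟨b, hb⟩ := h₁.isBit a ha
    rw [hb, h₃ a (by omega) ⟨hu, ha⟩ b hb]
  · rintro ⟨u, h₁, h₂, h₃⟩
    have := h₁.le_length
    exact ⟨u, by omega, h₁, h₂, fun a _ ha b hb => (h₃ a ha.2).symm.trans hb⟩

theorem spanIn {k : RowKind} (hs : IsTerm s) (ht : IsTerm t) :
    Definable fun x w ρ => SpanIn (writtenRows x w k) (s ρ) (t ρ) :=
  exists_row ((row_eq true (.var _) hs.lift).and (row_eq false (.var _) ht.lift))

theorem markIn {k : RowKind} (hs : IsTerm s) :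
    Definable fun x w ρ => MarkIn (writtenRows x w k) (s ρ) :=
  exists_row (row_eq true (.var _) hs.lift)

theorem conflict (hs : IsTerm s) (ht : IsTerm t) :
    Definable fun x w ρ => Conflict x.length (rowAt x w (s ρ)) (rowAt x w (t ρ)) :=
  exists_le (((row_eq true hs.lift (.var _)).and (row_eq false ht.lift (.var _))).or
    ((row_eq false hs.lift (.var _)).and (row_eq true ht.lift (.var _))))

theorem exists_varLength (hs : IsTerm s) : Definable fun x _ ρ => ∃ u, VarLength x (s ρ) u :=
  (exists_le (R := fun x w ρ u => VarLength x (s ρ) u) (varLength hs.lift (.var _))).congr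
    fun x w _ ρ => ⟨fun ⟨u, _, h⟩ => ⟨u, h⟩, fun ⟨u, h⟩ => ⟨u, by have := h.le_length; omega, h⟩⟩

theorem spanStep (hs : IsTerm s) (ht : IsTerm t) :
    Definable fun x w ρ => SpanStep x (SpanIn (writtenRows x w .span)) (s ρ) (t ρ) := by
  have h₁ : Definable fun x w ρ => (x[s ρ]? = some .top ∨ x[s ρ]? = some .bot) ∧
      s ρ + 1 ≤ x.length ∧ s ρ + 1 = t ρ :=
    ((token (· = some .top) hs).or (token (· = some .bot) hs)).and (le_and_eq hs.succ ht)
  have h₂ : Definable fun x w ρ => x[s ρ]? = some .var ∧ ∃ u ≤ x.length,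
      VarLength x (s ρ) u ∧ s ρ + 1 + u ≤ x.length ∧ s ρ + 1 + u = t ρ :=
    (token (· = some .var) hs).and (exists_le ((varLength hs.lift (.var _)).and
      (le_and_eq (hs.lift.succ.add (.var _)) ht.lift)))
  refine (h₁.or (((token (· = some .neg) hs).and (spanIn hs.succ ht)).or
    ((((token (· = some .and) hs).or (token (· = some .or) hs)).and
      (exists_le ((spanIn hs.lift.succ (.var _)).and (spanIn (.var _) ht.lift)))).or h₂))).congr
    fun x w _ ρ => or_congr (and_congr_right fun h => ?_) (or_congr Iff.rfl (or_congr Iff.rfl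
      (and_congr_right fun h => ?_)))
  · have : s ρ < x.length := h.elim lt_length_of_getElem? lt_length_of_getElem?
    exact ⟨fun h => h.2.symm, fun h => ⟨this, h.symm⟩⟩
  · constructor
    · rintro ⟨u, -, h₁, -, h₂⟩
      exact ⟨u, h₁, h₂.symm⟩
    · rintro ⟨u, h₁, h₂⟩
      have := h₁.le_length
      exact ⟨u, by omega, h₁, this, h₂.symm⟩

theorem stuckStep (hs : IsTerm s) : Definable fun x w ρ =>
    StuckStep x (SpanIn (writtenRows x w .span)) (MarkIn (writtenRows x w .stuck)) (s ρ) :=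
  ((token (· = none) hs).or ((isBit hs).or (token (· = some .entails) hs))).or
    (((token (· = some .neg) hs).and (markIn hs.succ)).or
    ((((token (· = some .and) hs).or (token (· = some .or) hs)).and
      ((markIn hs.succ).or
        (exists_le ((spanIn hs.lift.succ (.var _)).and (markIn (.var _)))))).or
    ((token (· = some .var) hs).and (exists_varLength hs).not)))

theorem illformed : Definable fun x w (_ : Fin 0 → ℕ) =>
    Illformed x (SpanIn (writtenRows x w .span)) (MarkIn (writtenRows x w .stuck)) :=
  (markIn (.const 0)).or (exists_le ((spanIn (.const 0) (.var _)).and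
    ((token (· ≠ some .entails) (.var _)).or ((markIn (IsTerm.var _).succ).or
      (exists_le ((spanIn (IsTerm.var _).succ (.var _)).and (token (· ≠ none) (.var _))))))))

/-- A universally quantified condition on the immediate subformulas of a formula with a binary
connective. -/
theorem forall_binary {R : List Token → List Mark → ℕ → ℕ → Prop} (c : Token)
    (h : ∀ {d} {s t : (Fin d → ℕ) → ℕ}, IsTerm s → IsTerm t →
      Definable fun x w ρ => R x w (s ρ) (t ρ)) :
    Definable fun x w (_ : Fin 0 → ℕ) => ∀ i ≤ x.length, ∀ k ≤ x.length, ∀ e ≤ x.length,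
      x[i]? = some c → SpanIn (writtenRows x w .span) (i + 1) k →
      SpanIn (writtenRows x w .span) k e → R x w i k :=
  forall_le (forall_le (forall_le ((token (· = some c) (.var _)).imp
    ((spanIn (IsTerm.var _).succ (.var _)).imp ((spanIn (.var _) (.var _)).imp
      (h (.var _) (.var _)))))))

theorem forall_neg {R : List Token → List Mark → ℕ → Prop}
    (h : ∀ {d} {s : (Fin d → ℕ) → ℕ}, IsTerm s → Definable fun x w ρ => R x w (s ρ)) :
    Definable fun x w (_ : Fin 0 → ℕ) => ∀ i ≤ x.length, ∀ e ≤ x.length, x[i]? = some .neg →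
      SpanIn (writtenRows x w .span) (i + 1) e → R x w i :=
  forall_le (forall_le ((token (· = some .neg) (.var _)).imp
    ((spanIn (IsTerm.var _).succ (.var _)).imp (h (.var _)))))

theorem refutes {k : RowKind} : Definable fun x w (_ : Fin 0 → ℕ) =>
    ∃ e ≤ x.length, SpanIn (writtenRows x w .span) 0 e ∧
      (∃ e' ≤ x.length, SpanIn (writtenRows x w .span) (e + 1) e') ∧
      ∃ f ∈ writtenRows x w k, f 0 = some true ∧ f (e + 1) ≠ some true :=
  exists_le ((spanIn (.const 0) (.var _)).and ((exists_le (spanIn (IsTerm.var _).succ (.var _))).and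
    (exists_row ((row_eq true (.var _) (.const 0)).and
      (row_eq true (.var _) (IsTerm.var _).succ).not))))

theorem orthoModel : Definable fun x w (_ : Fin 0 → ℕ) =>
    OrthoModel x (SpanIn (writtenRows x w .span)) (writtenRows x w .point) := by
  have exists_point : Definable fun x w (_ : Fin 0 → ℕ) => ∀ i ≤ x.length, ∀ e ≤ x.length,
      SpanIn (writtenRows x w .span) i e → ∀ f ∈ writtenRows x w .point, ∀ b : Bool,
      f i ≠ some (!b) → ∃ g ∈ writtenRows x w .point, g i = some b ∧ ¬Conflict x.length f g :=
    forall_le (forall_le ((spanIn (.var _) (.var _)).imp (forall_row (forall_bool fun b =>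
      (row_eq (!b) (.var _) (.var _)).not.imp (exists_row ((row_eq b (.var _) (.var _)).and
        (conflict (.var _) (.var _)).not))))))
  have top : Definable fun x w (_ : Fin 0 → ℕ) => ∀ i ≤ x.length, x[i]? = some .top →
      ∀ f ∈ writtenRows x w .point, f i = some true :=
    forall_le ((token (· = some .top) (.var _)).imp (forall_row (row_eq true (.var _) (.var _))))
  have bot : Definable fun x w (_ : Fin 0 → ℕ) => ∀ i ≤ x.length, x[i]? = some .bot →
      ∀ f ∈ writtenRows x w .point, f i = some false :=
    forall_le ((token (· = some .bot) (.var _)).imp (forall_row (row_eq false (.var _) (.var _))))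
  have neg := forall_neg (R := fun x w i => ∀ f ∈ writtenRows x w .point,
    (f i = some true ↔ f (i + 1) = some false)) fun hs => forall_row
      ((row_eq true (.var _) hs.lift).iff (row_eq false (.var _) hs.lift.succ))
  have and := forall_binary (R := fun x w i k => ∀ f ∈ writtenRows x w .point,
    (f i = some true ↔ f (i + 1) = some true ∧ f k = some true)) .and fun hs ht => forall_row
      ((row_eq true (.var _) hs.lift).iff
        ((row_eq true (.var _) hs.lift.succ).and (row_eq true (.var _) ht.lift)))
  have or := forall_binary (R := fun x w i k => ∀ f ∈ writtenRows x w .point,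
    (f i = some false ↔ f (i + 1) = some false ∧ f k = some false)) .or fun hs ht => forall_row
      ((row_eq false (.var _) hs.lift).iff
        ((row_eq false (.var _) hs.lift.succ).and (row_eq false (.var _) ht.lift)))
  have var : Definable fun x w (_ : Fin 0 → ℕ) => ∀ i ≤ x.length, ∀ j ≤ x.length,
      x[i]? = some .var → x[j]? = some .var → SameDigits x i j →
      ∀ f ∈ writtenRows x w .point, ∀ b : Bool, f i = some b → f j = some b :=
    forall_le (forall_le ((token (· = some .var) (.var _)).imp
      ((token (· = some .var) (.var _)).imp ((sameDigits (.var _) (.var _)).imp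
        (forall_row (forall_bool fun b =>
          (row_eq b (.var _) (.var _)).imp (row_eq b (.var _) (.var _))))))))
  exact (exists_point.and (top.and (bot.and (neg.and (and.and (or.and (var.and refutes))))))).congr
    fun _ _ _ _ => ⟨fun ⟨h₁, h₂, h₃, h₄, h₅, h₆, h₇, h₈⟩ => ⟨h₁, h₂, h₃, h₄, h₅, h₆, h₇, h₈⟩,
      fun ⟨h₁, h₂, h₃, h₄, h₅, h₆, h₇, h₈⟩ => ⟨h₁, h₂, h₃, h₄, h₅, h₆, h₇, h₈⟩⟩

theorem forall_row_union {k l : RowKind} {R : List Token → List Mark → (Fin d → ℕ) → Row → Prop}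
    (h : Definable fun x w (ρ : Fin (d + 1) → ℕ) =>
      R x w (fun j => ρ j.castSucc) (rowAt x w (ρ (Fin.last d)))) :
    Definable fun x w ρ => ∀ f ∈ writtenRows x w k ∪ writtenRows x w l, R x w ρ f :=
  ((forall_row (k := k) h).and (forall_row (k := l) h)).congr fun _ _ _ _ =>
    ⟨fun h f hf => hf.elim (h.1 f) (h.2 f), fun h =>
      ⟨fun f hf => h f (Or.inl hf), fun f hf => h f (Or.inr hf)⟩⟩

theorem fanModel : Definable fun x w (_ : Fin 0 → ℕ) =>
    FanModel x (SpanIn (writtenRows x w .span)) (writtenRows x w .root)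
      (writtenRows x w .leaf) := by
  have top : Definable fun x w (_ : Fin 0 → ℕ) => ∀ i ≤ x.length, x[i]? = some .top →
      ∀ f ∈ writtenRows x w .root ∪ writtenRows x w .leaf, f i = some true :=
    forall_le ((token (· = some .top) (.var _)).imp
      (forall_row_union (row_eq true (.var _) (.var _))))
  have bot : Definable fun x w (_ : Fin 0 → ℕ) => ∀ i ≤ x.length, x[i]? = some .bot →
      ∀ f ∈ writtenRows x w .root ∪ writtenRows x w .leaf, f i ≠ some true :=
    forall_le ((token (· = some .bot) (.var _)).imp
      (forall_row_union (row_eq true (.var _) (.var _)).not))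
  have and := forall_binary (R := fun x w i k =>
    ∀ f ∈ writtenRows x w .root ∪ writtenRows x w .leaf,
      (f i = some true ↔ f (i + 1) = some true ∧ f k = some true)) .and fun hs ht =>
    forall_row_union ((row_eq true (.var _) hs.lift).iff
      ((row_eq true (.var _) hs.lift.succ).and (row_eq true (.var _) ht.lift)))
  have or := forall_binary (R := fun x w i k =>
    ∀ f ∈ writtenRows x w .root ∪ writtenRows x w .leaf,
      (f i = some true ↔ f (i + 1) = some true ∨ f k = some true)) .or fun hs ht =>
    forall_row_union ((row_eq true (.var _) hs.lift).iff
      ((row_eq true (.var _) hs.lift.succ).or (row_eq true (.var _) ht.lift)))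
  have neg_leaf := forall_neg (R := fun x w i => ∀ f ∈ writtenRows x w .leaf,
    (f i = some true ↔ f (i + 1) ≠ some true)) fun hs => forall_row
      ((row_eq true (.var _) hs.lift).iff (row_eq true (.var _) hs.lift.succ).not)
  have neg_root := forall_neg (R := fun x w i => ∀ f ∈ writtenRows x w .root,
    (f i = some true ↔ f (i + 1) ≠ some true ∧
      ∀ g ∈ writtenRows x w .leaf, g (i + 1) ≠ some true)) fun hs => forall_row
    ((row_eq true (.var _) hs.lift).iff ((row_eq true (.var _) hs.lift.succ).not.and
      (forall_row (row_eq true (.var _) hs.lift.lift.succ).not)))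
  have var : Definable fun x w (_ : Fin 0 → ℕ) => ∀ i ≤ x.length, ∀ j ≤ x.length,
      x[i]? = some .var → x[j]? = some .var → SameDigits x i j →
      ∀ f ∈ writtenRows x w .root ∪ writtenRows x w .leaf, f i = some true → f j = some true :=
    forall_le (forall_le ((token (· = some .var) (.var _)).imp
      ((token (· = some .var) (.var _)).imp ((sameDigits (.var _) (.var _)).imp
        (forall_row_union ((row_eq true (.var _) (.var _)).imp (row_eq true (.var _) (.var _))))))))
  have mono : Definable fun x w (_ : Fin 0 → ℕ) => ∀ i ≤ x.length, ∀ e ≤ x.length,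
      x[i]? = some .var → SpanIn (writtenRows x w .span) i e →
      ∀ f ∈ writtenRows x w .root, f i = some true →
      ∀ g ∈ writtenRows x w .leaf, g i = some true :=
    forall_le (forall_le ((token (· = some .var) (.var _)).imp ((spanIn (.var _) (.var _)).imp
      (forall_row ((row_eq true (.var _) (.var _)).imp
        (forall_row (row_eq true (.var _) (.var _))))))))
  exact (top.and (bot.and (and.and (or.and (neg_leaf.and (neg_root.and (var.and
    (mono.and refutes)))))))).congr fun _ _ _ _ =>
      ⟨fun ⟨h₁, h₂, h₃, h₄, h₅, h₆, h₇, h₈, h₉⟩ => ⟨h₁, h₂, h₃, h₄, h₅, h₆, h₇, h₈, h₉⟩,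
      fun ⟨h₁, h₂, h₃, h₄, h₅, h₆, h₇, h₈, h₉⟩ => ⟨h₁, h₂, h₃, h₄, h₅, h₆, h₇, h₈, h₉⟩⟩

/-- It is a first-order property of a word and a certificate that the latter is correct. -/
theorem certifies : Definable fun x w (_ : Fin 0 → ℕ) => Certifies x (writtenRows x w) := by
  have span : Definable fun x w (_ : Fin 0 → ℕ) => ∀ i ≤ x.length, ∀ e ≤ x.length,
      SpanIn (writtenRows x w .span) i e → SpanStep x (SpanIn (writtenRows x w .span)) i e :=
    forall_le (forall_le ((spanIn (.var _) (.var _)).imp (spanStep (.var _) (.var _))))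
  have stuck : Definable fun x w (_ : Fin 0 → ℕ) => ∀ i ≤ x.length,
      MarkIn (writtenRows x w .stuck) i →
      StuckStep x (SpanIn (writtenRows x w .span)) (MarkIn (writtenRows x w .stuck)) i :=
    forall_le ((markIn (.var _)).imp (stuckStep (.var _)))
  exact span.and ((stuck.and illformed).or (orthoModel.or fanModel))

end Definable

end CQL

namespace CQL

/-! ### Certificates of polynomial length -/

/-- A row as a word: its kind, followed by its values at the positions up to `n`. -/
def writeRow (n : ℕ) (r : RowKind × Row) : List Mark :=
  .inl r.1 :: (List.range (n + 1)).map fun j => .inr (r.2 j)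

/-- Rows as a word. The initial letter makes the word nonempty. -/
def writeRows (n : ℕ) (rs : List (RowKind × Row)) : List Mark :=
  .inr none :: rs.flatMap (writeRow n)

theorem length_writeRows (n : ℕ) (rs : List (RowKind × Row)) :
    (writeRows n rs).length = rs.length * (n + 2) + 1 := by
  simp [writeRows, writeRow, List.length_flatMap]

theorem exists_eq_append_of_flatMap_writeRow {n i : ℕ} {k : RowKind} {rs : List (RowKind × Row)}
    (h : (rs.flatMap (writeRow n))[i]? = some (.inl k)) :
    ∃ l₁ f l₂, rs = l₁ ++ (k, f) :: l₂ ∧ i = (l₁.flatMap (writeRow n)).length := by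
  induction rs generalizing i with
  | nil => simp at h
  | cons r rs ih =>
    rw [List.flatMap_cons] at h
    rcases lt_or_ge i (writeRow n r).length with hi | hi
    · rw [List.getElem?_append_left hi] at h
      rcases i with _ | i
      · simp only [writeRow, List.getElem?_cons_zero, Option.some.injEq, Sum.inl.injEq] at h
        exact ⟨[], r.2, rs, by rw [← h]; rfl, rfl⟩
      · simp [writeRow] at h
    · rw [List.getElem?_append_right hi] at h
      obtain ⟨l₁, f, l₂, rfl, hl⟩ := ih h
      exact ⟨r :: l₁, f, l₂, rfl, by rw [List.flatMap_cons, List.length_append]; omega⟩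

theorem getElem?_writeRows {n : ℕ} (l₁ l₂ : List (RowKind × Row)) (r : RowKind × Row) (j : ℕ)
    (hj : j < n + 2) :
    (writeRows n (l₁ ++ r :: l₂))[(l₁.flatMap (writeRow n)).length + 1 + j]? =
      (writeRow n r)[j]? := by
  have : j < (writeRow n r).length := by simp [writeRow]; omega
  rw [writeRows, add_right_comm, List.getElem?_cons_succ, List.flatMap_append, List.flatMap_cons,
    List.getElem?_append_right (by omega), Nat.add_sub_cancel_left, List.getElem?_append_left this]

theorem getElem?_pairWord_add (x : List Token) (w : List Mark) (i : ℕ) :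
    (pairWord x w)[x.length + i]? = w[i]?.map Sum.inr := by
  rw [pairWord, List.getElem?_append_right (by simp), List.getElem?_map]
  simp

theorem rowAt_writeRows {x : List Token} (l₁ l₂ : List (RowKind × Row)) (r : RowKind × Row)
    (h : ∀ j, x.length < j → r.2 j = none) :
    rowAt x (writeRows x.length (l₁ ++ r :: l₂))
      (x.length + ((l₁.flatMap (writeRow x.length)).length + 1)) = r.2 := by
  funext j
  rw [rowAt]
  split_ifs with hj
  · rw [add_assoc, add_assoc, getElem?_pairWord_add, add_comm 1 j,
      getElem?_writeRows _ _ _ _ (by omega), writeRow, List.getElem?_cons_succ, List.getElem?_map,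
      List.getElem?_range (by omega)]
    rfl
  · exact (h j (by omega)).symm

theorem writtenRows_writeRows {x : List Token} {rs : List (RowKind × Row)}
    (h : SupportedBelow x.length rs) :
    writtenRows x (writeRows x.length rs) = kindRows rs := by
  funext k
  ext f
  constructor
  · rintro ⟨s, -, hs, rfl⟩
    rcases lt_or_ge s x.length with hlt | hle
    · simp [pairWord, List.getElem?_append, hlt] at hs
    obtain ⟨i, rfl⟩ := Nat.exists_eq_add_of_le hle
    rw [getElem?_pairWord_add] at hs
    rcases i with _ | i
    · simp [writeRows] at hs
    rw [writeRows, List.getElem?_cons_succ, Option.map_eq_some_iff] at hs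
    obtain ⟨m, hm, hmk⟩ := hs
    obtain rfl := Sum.inr_injective hmk
    obtain ⟨l₁, f, l₂, rfl, rfl⟩ := exists_eq_append_of_flatMap_writeRow hm
    have hr : (k, f) ∈ l₁ ++ (k, f) :: l₂ := by simp
    rw [rowAt_writeRows _ _ _ (h _ hr)]
    exact hr
  · intro hf
    obtain ⟨l₁, l₂, rfl⟩ := List.append_of_mem hf
    have hs : (pairWord x (writeRows x.length (l₁ ++ (k, f) :: l₂)))[x.length +
        ((l₁.flatMap (writeRow x.length)).length + 1)]? = some (.inr (.inl k)) := by
      rw [getElem?_pairWord_add, ← add_zero (_ + 1), getElem?_writeRows _ _ _ _ (by omega)]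
      rfl
    exact ⟨_, (List.getElem?_eq_some_iff.1 hs).1, hs, (rowAt_writeRows _ _ _ (h _ hf)).symm⟩

/-- The words that consist of a word and a certificate for it form a language in P. -/
theorem exists_inP_certifies : ∃ R : Language (Token ⊕ Mark), InP R ∧
    ∀ x w, pairWord x w ∈ R ↔ w ≠ [] ∧ Certifies x (writtenRows x w) := by
  obtain ⟨φ, m, hφ, h⟩ := Definable.certifies
  let ne : WordFormula (Token ⊕ Mark) :=
    .not (.all (.letter 0 [0] fun o => (o.bind Sum.getRight?).isNone))
  have hne : ∀ x w ρ, ne.Holds (pairWord x w) 0 ρ ↔ w ≠ [] := by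
    intro x w ρ
    simp only [ne, WordFormula.Holds, List.map_cons, List.map_nil, List.sum_cons, List.sum_nil,
      Function.update_self, zero_add, add_zero]
    refine not_congr ⟨fun H => ?_, ?_⟩
    · by_contra hw
      have hw := List.length_pos_iff.2 hw
      have := H x.length (by simpa [pairWord] using hw)
      rw [← add_zero x.length, getElem?_pairWord_add, List.getElem?_eq_getElem hw] at this
      simp at this
    · rintro rfl i hi
      simp [pairWord]
  have : Inhabited (Token ⊕ Mark) := ⟨.inl .top⟩
  refine ⟨{z | (WordFormula.and ne φ).Holds z 0 fun _ => 0},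
    WordFormula.inP (.and ne φ) m ?_ _ fun z => Iff.rfl, fun x w => ?_⟩
  · simp only [WordFormula.wellScoped, ne, hφ (m + 1) (by omega)]
    simp
  · exact (and_congr_left' (hne x w _)).trans (and_congr_right fun hw => h x w hw _)

theorem inCoNP_exLogic : InCoNP (entailmentProblem ExLogic) := by
  obtain ⟨R, hR, h⟩ := exists_inP_certifies
  refine ⟨Mark, inferInstance, R, 5 * (.X + 1) * (.X + 2) + 1, hR, fun x => ?_⟩
  constructor
  · intro hx
    obtain ⟨rs, hlen, hsupp, hrs⟩ := exists_certifies x fun φ ψ he hφ => hx ⟨φ, ψ, hφ, he⟩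
    refine ⟨writeRows x.length rs, ?_, (h _ _).2 ⟨List.cons_ne_nil _ _, ?_⟩⟩
    · rw [length_writeRows]
      simp only [Polynomial.eval_add, Polynomial.eval_mul, Polynomial.eval_X, Polynomial.eval_one,
        Polynomial.eval_ofNat]
      gcongr
    · rwa [writtenRows_writeRows hsupp]
  · rintro ⟨w, -, hw⟩ ⟨φ, ψ, hφ, rfl⟩
    exact ((h _ _).1 hw).2.not_exLogic hφ

end CQL

theorem mainTheorem10 :
    CQL.InCoNP (CQL.entailmentProblem CQL.ExLogic) ∧
      CQL.InCoNP (CQL.entailmentProblem CQL.ExValid.{u}) := by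
  have : CQL.ExValid.{u} = CQL.ExLogic := by
    funext φ ψ
    exact propext (CQL.exValid_iff_exLogic φ ψ)
  rw [this]
  exact ⟨CQL.inCoNP_exLogic, CQL.inCoNP_exLogic⟩
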